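/- **Setting.** Let $q$ be a prime, $d$ a power of two, $l\mid d$, $l\ge 64$, $n=d/l$, and $\zeta\in\mathbb Z_q$ a primitive $2l$-th root of unity such that all $X^{n}-\zeta^{2j+1}$ ($0\le j<l$) are irreducible over $\mathbb Z_q$. Put $\mathcal R_q=\mathbb Z_q[X]/(X^d+1)$, and let $\mathrm{NTT}(p)_j=p \bmod (X^{n}-\zeta^{2j+1})$, an element of $\mathcal M_q=\{$polynomials over $\mathbb Z_q$ of degree $<n\}$. Norms on $\mathcal R_q$ use centred coefficients. Let $m=\kappa+\lambda+3$; let $\chi$ be a distribution on $\{-1,0,1\}$; let $\mathcal C$ be the distribution of challenges with independent coefficients, equal to $0$ with probability $p$ and to $\pm1$ with probability $(1-p)/2$ each; let $\omega$ bound $\|c\|_1$ for all challenges (i.e. $\omega\ge d$); let $\mathfrak s>0$, $D_{\mathfrak s}$ the discrete Gaussian on $\mathbb Z$, and $B=\mathfrak s\sqrt{2md}$. Let $$\varepsilon=\frac1q\sum_{j\in\mathbb Z_q^\times}\prod_{k=0}^{l-1}\Bigl|p+(1-p)\cos\frac{2\pi j\zeta^k}{q}\Bigr| .$$ The key consists of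 $\mathbf A\in\mathcal R_q^{\kappa\times m}$ and $\mathbf{pk}_1,\mathbf{pk}_2,\mathbf b,\mathbf a_{bin},\mathbf a'_{bin},\mathbf a_g\in\mathcal R_q^m$. A commitment to $(m_1,m_2,m_3)\in\mathcal R_q^3$ with randomness $\mathbf r$ is $(\mathbf{Ar},\mathbf{pk}_1^T\mathbf r+m_1,\mathbf{pk}_2^T\mathbf r+m_2,\mathbf b^T\mathbf r+m_3)=(\mathbf{com}_0,\dots,\mathbf{com}_3)$. Let $Q\in\mathbb Z_q^{l\times l}$ have all rows equal to $(1,2,\dots,2^{63},0,\dots,0)$. **Protocol.** The prover holds an opening of the commitment with $\mathbf r$ ternary and $m_1=v$, $0\le v<2^{64}$ an integer. Let $v_{bin}\in\mathcal R_q$ have as NTT slots the bits of $v$ (and zeros). 1. The prover samples $\mathbf y\leftarrow D_{\mathfrak s}^{md}$ and $g\in\mathcal R_q$ uniform among elements whose first $n$ coefficients vanish, and sends $f=\mathbf a_{bin}^T\mathbf r+v_{bin}$, $u_1=\mathbf a_{bin}'^T\mathbf r+(\mathbf a_{bin}^T\mathbf y)(1-2v_{bin})$, $u_2=\mathbf a_g^T\mathbf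 r+g$, $u_3=(\mathbf a_{bin}^T\mathbf y)^2+\mathbf a_{bin}'^T\mathbf y$, $\mathbf w=\mathbf{Ay}$. 2. The verifier sends uniform $\varphi\in\mathcal M_q^l\cong\mathbb Z_q^d$. 3. With $P=\mathrm{NTT}^{-1}(Q^T\varphi)$, $F=\mathrm{NTT}^{-1}(\varphi)$, the prover sends $h=g+Pv_{bin}-Fv$ and $u_4=\mathbf a_g^T\mathbf y+P\,\mathbf a_{bin}^T\mathbf y-F\,\mathbf{pk}_1^T\mathbf y$. 4. The verifier sends $c\leftarrow\mathcal C$. 5. The prover sets $\mathbf z=\mathbf y+c\mathbf r$ over the integers (using the centred representative of $c\mathbf r$), and sends it with probability $\min\bigl(1,\tfrac13\exp\frac{-2\langle\mathbf z,c\mathbf r\rangle+\|c\mathbf r\|^2}{2\mathfrak s^2}\bigr)$; otherwise it aborts. The verifier accepts iff $\|\mathbf z\|\le B$; $\mathbf{Az}=\mathbf w+c\,\mathbf{com}_0$; $(\mathbf a_{bin}^T\mathbf z-cf)(\mathbf a_{bin}^T\mathbf z-cf+c)+\mathbf a_{bin}'^T\mathbf z-cu_1=u_3$; $c(Pf-F\mathbf{com}_1+u_2-h)+u_4=\mathbf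 a_g^T\mathbf z+P\,\mathbf a_{bin}^T\mathbf z-F\,\mathbf{pk}_1^T\mathbf z$; and the first $n$ coefficients of $h$ vanish. **Theorem.** There is an absolute constant $C>0$ such that the following holds for every family of such parameters indexed by a security parameter $\eta$ with $d,\kappa,\lambda,\log q$ polynomially bounded, $md\ge\eta$, $q\varepsilon\le1$, and $\exp\bigl(\sqrt{2\eta\ln2}\,\tfrac{T}{\mathfrak s}+\tfrac{T^2}{2\mathfrak s^2}\bigr)\le3$ where $T=\omega\sqrt{md}$. Efficient algorithms are families of polynomial-size probabilistic arithmetic/Boolean circuits over $\mathbb Z_q$-words, which may also sample from $\chi$, from the coefficient law of $\mathcal C$, and from $D_{\mathfrak s}$. 1. *Completeness.* There is a negligible $\delta$ such that for every statement and honest witness the prover does not abort with probability at least $(1-\delta)/3$, and, conditioned on not aborting, the verifier accepts with probability at least $1-\delta$. 2. *Knowledge soundness* with knowledge error $$\mathrm{err}=C\,\frac{l+3}{q^{d/l}}+C\varepsilon .$$ There are a constant $e$, a positive polynomial $P$, and a polynomial-size extractor with rewinding black-box access to a prover such that, for every statement and every (unbounded, randomized) prover $\mathcal P^*$ that convinces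 the verifier with probability $a>\mathrm{err}$, the extractor outputs with probability at least $(a-\mathrm{err})^e/P(\eta)$ one of the following: an invertible $\bar c$ with $\|\bar c\|_1\le2\omega$ together with $\mathbf r^*$ and $(m_1^*,m_2^*,m_3^*)$ such that $\|\bar c\mathbf r^*\|\le2B$, the commitment equals that of $(m_1^*,m_2^*,m_3^*)$ with randomness $\mathbf r^*$, and $m_1^*$ is an integer in $[0,2^{64})$; or an $\mathrm{MSIS}$ solution for $\mathbf A$, i.e. $\mathbf s$ with $\mathbf{As}=0$ and $0<\|\mathbf s\|\le8\omega B$. 3. *Honest-verifier zero-knowledge.* Assume that $\mathrm{MLWE}$ is hard (for uniform $\mathbf M\in\mathcal R_q^{m\times\kappa}$ and $\mathbf s,\mathbf e$ with coefficients from $\chi$, $(\mathbf M,\mathbf{Ms}+\mathbf e)$ is indistinguishable from uniform) and that dual $\mathrm{MLWE}$ is hard for uniform $\mathbf M\in\mathcal R_q^{(\kappa+6)\times m}$ ($(\mathbf M,\mathbf{Ms})$ is indistinguishable from uniform). Then there is an efficient simulator such that for all messages $(v,m_2,m_3)$ with $v\in[0,2^{64})$, for honestly generated keys ($\mathbf A,\mathbf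 b,\mathbf a_{bin},\mathbf a_{bin}',\mathbf a_g$ uniform, $\mathbf{pk}_i=\mathbf A^T\mathbf s_i+\mathbf e_i$ with $\mathbf s_i,\mathbf e_i$ from $\chi$) and commitment randomness $\mathbf r$ with coefficients from $\chi$, the pair (statement, non-aborting honest transcript) is indistinguishable from (statement, simulated transcript) by polynomial-size circuits. -/

import Mathlib

open scoped ENNReal Matrix

namespace PoA

noncomputable section

/-! ## Elementary probability -/

/-- Probability of an event under a discrete distribution, as a real number. -/
def prob {α : Type*} (p : PMF α) (P : α → Prop) : ℝ :=
  (p.toOuterMeasure {a | P a}).toReal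

/-- `n` independent samples from `p`. -/
def iid {α : Type} (p : PMF α) : (n : ℕ) → PMF (Fin n → α)
  | 0 => PMF.pure Fin.elim0
  | n + 1 => p.bind fun a => (iid p n).map (Fin.cons a)

/-- A coin showing `true` with probability `min 1 (max 0 x)`. -/
def coin (x : ℝ) : PMF Bool :=
  PMF.ofFintype
    (fun b => if b then ENNReal.ofReal (min 1 (max 0 x))
      else ENNReal.ofReal (1 - min 1 (max 0 x)))
    (by
      have h0 : (0 : ℝ) ≤ min 1 (max 0 x) := le_min zero_le_one (le_max_left _ _)
      have h1 : (0 : ℝ) ≤ 1 - min 1 (max 0 x) := sub_nonneg.2 (min_le_left _ _)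
      rw [Fintype.sum_bool, if_pos rfl, if_neg Bool.false_ne_true, ← ENNReal.ofReal_add h0 h1,
        add_sub_cancel, ENNReal.ofReal_one])

/-- The unnormalised discrete Gaussian weight on `ℤ`. -/
def gaussWeight (s : ℝ) (x : ℤ) : ℝ≥0∞ :=
  ENNReal.ofReal (Real.exp (-((x : ℝ) ^ 2) / (2 * s ^ 2)))

theorem gaussWeight_tsum_ne_zero (s : ℝ) : ∑' x, gaussWeight s x ≠ 0 := by
  intro h
  have h0 := ENNReal.tsum_eq_zero.1 h 0
  simp [gaussWeight] at h0

theorem gaussWeight_tsum_ne_top {s : ℝ} (hs : 0 < s) : ∑' x, gaussWeight s x ≠ ∞ := by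
  have hN : Summable fun n : ℕ => Real.exp (-((n : ℝ) ^ 2) / (2 * s ^ 2)) := by
    have hc : -(1 / (2 * s ^ 2)) < 0 := by
      have : 0 < 1 / (2 * s ^ 2) := by positivity
      linarith
    have := Real.summable_exp_nat_mul_of_ge (c := -(1 / (2 * s ^ 2))) hc
      (f := fun n : ℕ => (n : ℝ) ^ 2)
      (fun i => by
        have : i ≤ i ^ 2 := Nat.le_self_pow two_ne_zero i
        exact_mod_cast this)
    refine this.congr fun n => ?_
    congr 1
    ring
  have hZ : Summable fun x : ℤ => Real.exp (-((x : ℝ) ^ 2) / (2 * s ^ 2)) := by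
    refine Summable.of_nat_of_neg ?_ ?_
    · simpa using hN
    · simpa using hN
  exact hZ.tsum_ofReal_ne_top

/-- The discrete Gaussian on `ℤ` centred at `0` with standard deviation `s`. Its product over
`n` coordinates, `iid (gauss s hs) n`, is the spherical discrete Gaussian on `ℤ ^ n`. -/
def gauss (s : ℝ) (hs : 0 < s) : PMF ℤ :=
  PMF.normalize (gaussWeight s) (gaussWeight_tsum_ne_zero s) (gaussWeight_tsum_ne_top hs)

/-- The ternary law with `P(0) = p` and `P(1) = P(-1) = (1 - p) / 2`. -/
def ternary (p : ℝ) : PMF ℤ :=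
  (coin p).bind fun b => if b then PMF.pure 0
    else (coin (1 / 2)).map fun b' => if b' then 1 else -1

/-- Law of the first component conditioned on the flag being `true`
(if the flag has probability `0`, no conditioning takes place). -/
def condFlag {α : Type} (p : PMF (α × Bool)) : PMF α :=
  open Classical in
  if h : ∃ a ∈ {a : α × Bool | a.2 = true}, a ∈ p.support then
    (p.filter {a | a.2 = true} h).map Prod.fst
  else p.map Prod.fst

/-! ## Scheme parameters -/

/-- One set of public parameters. -/
structure Params where
  /-- modulus -/
  q : ℕ
  /-- ring degree -/
  d : ℕ
  /-- number of NTT slots -/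
  l : ℕ
  /-- height of the commitment matrix -/
  κ : ℕ
  /-- hiding rank -/
  lam : ℕ
  /-- bound on the `ℓ₁` norm of challenges -/
  ω : ℕ
  /-- root of unity defining the NTT -/
  ζ : ZMod q
  /-- probability that a challenge coefficient vanishes -/
  p : ℝ
  /-- law of the coefficients of secrets, errors and commitment randomness -/
  χ : PMF ℤ
  /-- standard deviation of the masking vector -/
  σ : ℝ
  q_prime : q.Prime
  d_two_pow : ∃ a : ℕ, d = 2 ^ a
  l_dvd_d : l ∣ d
  l_ge : 64 ≤ l
  ζ_prim : IsPrimitiveRoot ζ (2 * l)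
  slot_irreducible : ∀ j < l,
    Irreducible (Polynomial.X ^ (d / l) - Polynomial.C (ζ ^ (2 * j + 1)) : Polynomial (ZMod q))
  p_nonneg : 0 ≤ p
  p_le_one : p ≤ 1
  /-- Challenges are ternary, so this says that `ω` bounds the `ℓ₁` norm of all of them. -/
  d_le_ω : d ≤ ω
  χ_ternary : ∀ x ∈ χ.support, x = -1 ∨ x = 0 ∨ x = 1
  σ_pos : 0 < σ

instance (pp : Params) : Fact pp.q.Prime := ⟨pp.q_prime⟩

namespace Params

variable (pp : Params)

/-- Length `κ + λ + 3` of the commitment randomness. -/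
abbrev m : ℕ := pp.κ + pp.lam + 3

/-- Number of coefficients of an NTT slot. -/
abbrev n : ℕ := pp.d / pp.l

/-- Words: integers modulo `q`. -/
abbrev W : Type := ZMod pp.q

/-- The polynomial `X ^ d + 1`. -/
abbrev modulus : Polynomial (ZMod pp.q) := Polynomial.X ^ pp.d + Polynomial.C 1

/-- The ring `ℤ_q[X] / (X ^ d + 1)`. -/
abbrev Rq : Type := AdjoinRoot pp.modulus

theorem modulus_monic : pp.modulus.Monic := by
  obtain ⟨a, ha⟩ := pp.d_two_pow
  exact Polynomial.monic_X_pow_add_C 1 (by rw [ha]; positivity)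

variable {pp}

/-- The representative of degree `< d`. -/
def rep (a : pp.Rq) : Polynomial (ZMod pp.q) := AdjoinRoot.modByMonicHom pp.modulus_monic a

/-- The coefficients of a ring element. -/
def coef (a : pp.Rq) (k : Fin pp.d) : pp.W := (rep a).coeff k

/-- The ring element with given coefficients. -/
def ofCoef (v : Fin pp.d → pp.W) : pp.Rq :=
  AdjoinRoot.mk _ (∑ k : Fin pp.d, Polynomial.C (v k) * Polynomial.X ^ (k : ℕ))

/-- The ring element with given integer coefficients. -/
def ofInt (v : Fin pp.d → ℤ) : pp.Rq := ofCoef fun k => (v k : pp.W)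

/-- Centred integer representatives of the coefficients. -/
def lift (a : pp.Rq) (k : Fin pp.d) : ℤ := (coef a k).valMinAbs

/-- The `ℓ₁` norm of a ring element. -/
def norm1 (a : pp.Rq) : ℤ := ∑ k, |lift a k|

/-- The Euclidean norm of a vector of ring elements. -/
def norm2 {r : ℕ} (a : Fin r → pp.Rq) : ℝ := √(∑ i, ∑ k, (lift (a i) k : ℝ) ^ 2)

/-- Values of the NTT: `l` polynomials of degree `< d / l`, given by their coefficients. -/
abbrev Slots (pp : Params) : Type := Fin pp.l → Fin pp.n → pp.W

/-- The number theoretic transform: slot `j` is the residue modulo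
`X ^ (d / l) - ζ ^ (2 j + 1)`. -/
def ntt (a : pp.Rq) : Slots pp := fun j i =>
  (rep a %ₘ (Polynomial.X ^ pp.n - Polynomial.C (pp.ζ ^ (2 * (j : ℕ) + 1)))).coeff i

/-- The inverse transform: `invNtt v` is the ring element `a` with `ntt a = v`. -/
def invNtt : Slots pp → pp.Rq := Function.invFun ntt

/-- The `l × l` matrix whose product with a vector of bits puts the 64-bit integer with these
bits in every slot. -/
def Q (pp : Params) : Matrix (Fin pp.l) (Fin pp.l) pp.W :=
  fun _ j => if (j : ℕ) < 64 then 2 ^ (j : ℕ) else 0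

/-- `Qᵀ φ`, acting on the slots coefficientwise. -/
def QT (φ : Slots pp) : Slots pp := fun j i => ∑ k, Q pp k j * φ k i

/-- The ring element whose `j`-th NTT slot is the `j`-th bit of `v`. -/
def bits (v : ℕ) : pp.Rq := invNtt fun j i =>
  if (i : ℕ) = 0 ∧ (j : ℕ) < 64 ∧ v.testBit j then 1 else 0

variable (pp)

/-- Acceptance bound `𝔰 √(2 (κ + λ + 3) d)` for responses. -/
def bound : ℝ := pp.σ * √(2 * pp.m * pp.d)

/-- Bound `ω √((κ + λ + 3) d)` on the norm of `c r` for a challenge `c` and ternary `r`. -/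
def shift : ℝ := pp.ω * √(pp.m * pp.d)

/-- Deviation from uniformity of an NTT coefficient of a challenge:
`ε = (1/q) ∑_{j ≠ 0} ∏_{k < l} |p + (1 - p) cos (2 π j ζ ^ k / q)|`. -/
def ε : ℝ := (1 / pp.q) * ∑ j : (pp.W)ˣ, ∏ k ∈ Finset.range pp.l,
  |pp.p + (1 - pp.p) * Real.cos (2 * Real.pi * ((j : pp.W) * pp.ζ ^ k).val / pp.q)|

/-! ## Distributions -/

/-- Uniform ring element. -/
def unifR : PMF pp.Rq := (PMF.uniformOfFintype (Fin pp.d → pp.W)).map ofCoef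

/-- Ring element with coefficients from `χ`. -/
def smallR : PMF pp.Rq := (iid pp.χ pp.d).map ofInt

/-- Challenge: ternary ring element with independent coefficients. -/
def chal : PMF pp.Rq := (iid (ternary pp.p) pp.d).map ofInt

/-- Challenge of the first round: uniform in `ℤ_q ^ d`, arranged in slots. -/
def unifSlots : PMF (Slots pp) := PMF.uniformOfFintype (Slots pp)

/-- Uniform ring element whose first `d / l` coefficients vanish. -/
def unifG : PMF pp.Rq := (PMF.uniformOfFintype (Fin pp.d → pp.W)).map fun v =>
  ofCoef fun k => if (k : ℕ) < pp.n then 0 else v k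

/-- Masking vector over the integers. -/
def mask : PMF (Fin pp.m → Fin pp.d → ℤ) := iid (iid (gauss pp.σ pp.σ_pos) pp.d) pp.m

/-- Uniform matrix. -/
def unifMat (r s : ℕ) : PMF (Matrix (Fin r) (Fin s) pp.Rq) := iid (iid pp.unifR s) r

/-! ## Statements, witnesses, transcripts -/

/-- The commitment key (with the extra rows used by the proof) and the commitment. -/
structure Stmt where
  A : Matrix (Fin pp.κ) (Fin pp.m) pp.Rq
  pk1 : Fin pp.m → pp.Rq
  pk2 : Fin pp.m → pp.Rq
  b : Fin pp.m → pp.Rq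
  aBin : Fin pp.m → pp.Rq
  aBin' : Fin pp.m → pp.Rq
  aG : Fin pp.m → pp.Rq
  com0 : Fin pp.κ → pp.Rq
  com1 : pp.Rq
  com2 : pp.Rq
  com3 : pp.Rq

/-- The witness of an honest prover: randomness, committed integer, two further messages. -/
structure Wit where
  r : Fin pp.m → pp.Rq
  v : ℕ
  m2 : pp.Rq
  m3 : pp.Rq

/-- What an extractor outputs as an opening: a relaxation factor, randomness, messages. -/
structure Opening where
  cbar : pp.Rq
  r : Fin pp.m → pp.Rq
  msg : Fin 3 → pp.Rq

/-- Prover's first message. -/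
structure Msg1 where
  f : pp.Rq
  u1 : pp.Rq
  u2 : pp.Rq
  u3 : pp.Rq
  w : Fin pp.κ → pp.Rq

/-- Prover's second message. -/
structure Msg2 where
  h : pp.Rq
  u4 : pp.Rq

/-- A transcript `(msg1, φ, msg2, c, z)`. -/
structure Transcript where
  msg1 : Msg1 pp
  φ : Slots pp
  msg2 : Msg2 pp
  c : pp.Rq
  z : Fin pp.m → pp.Rq

variable {pp}

/-- `x` commits, with ternary randomness, to a 64-bit integer (and two further messages). -/
def honestRel (x : Stmt pp) (w : Wit pp) : Prop :=
  w.v < 2 ^ 64 ∧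
  (∀ i k, |lift (w.r i) k| ≤ 1) ∧
  x.com0 = x.A *ᵥ w.r ∧
  x.com1 = x.pk1 ⬝ᵥ w.r + (w.v : pp.Rq) ∧
  x.com2 = x.pk2 ⬝ᵥ w.r + w.m2 ∧
  x.com3 = x.b ⬝ᵥ w.r + w.m3

/-- The relation that is proved: `o` is a weak opening of the commitment whose first message is
an integer in `[0, 2 ^ 64)`. -/
def rel (x : Stmt pp) (o : Opening pp) : Prop :=
  IsUnit o.cbar ∧
  norm1 o.cbar ≤ 2 * pp.ω ∧
  norm2 (fun i => o.cbar * o.r i) ≤ 2 * pp.bound ∧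
  x.com0 = x.A *ᵥ o.r ∧
  x.com1 = x.pk1 ⬝ᵥ o.r + o.msg 0 ∧
  x.com2 = x.pk2 ⬝ᵥ o.r + o.msg 1 ∧
  x.com3 = x.b ⬝ᵥ o.r + o.msg 2 ∧
  ∃ v : ℕ, v < 2 ^ 64 ∧ o.msg 0 = (v : pp.Rq)

/-- `s` solves the module-SIS instance `A` with norm bound `β`. -/
def solvesMSIS {r t : ℕ} (A : Matrix (Fin r) (Fin t) pp.Rq) (β : ℝ) (s : Fin t → pp.Rq) : Prop :=
  A *ᵥ s = 0 ∧ 0 < norm2 s ∧ norm2 s ≤ β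

/-! ## The protocol -/

/-- Acceptance probability of rejection sampling with repetition rate `3`:
`(1/3) exp ((-2⟨z, v⟩ + ‖v‖²) / (2 𝔰²))`, truncated at `1` by `coin`. -/
def rejProb (z v : Fin pp.m → Fin pp.d → ℤ) : ℝ :=
  (1 / 3) * Real.exp ((-2 * ∑ i, ∑ k, (z i k : ℝ) * v i k + ∑ i, ∑ k, (v i k : ℝ) ^ 2)
    / (2 * pp.σ ^ 2))

/-- Honest prover's first message, from the mask `y` and the garbage term `g`. -/
def prove1 (x : Stmt pp) (w : Wit pp) (y : Fin pp.m → pp.Rq) (g : pp.Rq) : Msg1 pp where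
  f := x.aBin ⬝ᵥ w.r + bits w.v
  u1 := x.aBin' ⬝ᵥ w.r + (x.aBin ⬝ᵥ y) * (1 - 2 * bits w.v)
  u2 := x.aG ⬝ᵥ w.r + g
  u3 := (x.aBin ⬝ᵥ y) ^ 2 + x.aBin' ⬝ᵥ y
  w := x.A *ᵥ y

/-- Honest prover's second message. -/
def prove2 (x : Stmt pp) (w : Wit pp) (y : Fin pp.m → pp.Rq) (g : pp.Rq) (φ : Slots pp) :
    Msg2 pp where
  h := g + invNtt (QT φ) * bits w.v - invNtt φ * (w.v : pp.Rq)
  u4 := x.aG ⬝ᵥ y + invNtt (QT φ) * (x.aBin ⬝ᵥ y) - invNtt φ * (x.pk1 ⬝ᵥ y)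

/-- One run of the honest prover with the honest verifier. The flag is `false` if the prover
aborts in rejection sampling. -/
def honestRun (x : Stmt pp) (w : Wit pp) : PMF (Transcript pp × Bool) :=
  pp.mask.bind fun yZ =>
  pp.unifG.bind fun g =>
  pp.unifSlots.bind fun φ =>
  pp.chal.bind fun c =>
    let y : Fin pp.m → pp.Rq := fun i => ofInt (yZ i)
    let v : Fin pp.m → Fin pp.d → ℤ := fun i => lift (c * w.r i)
    let z : Fin pp.m → Fin pp.d → ℤ := fun i k => yZ i k + v i k
    (coin (rejProb z v)).map fun ok =>
      (⟨prove1 x w y g, φ, prove2 x w y g φ, c, fun i => ofInt (z i)⟩, ok)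

/-- The verifier's decision. -/
def accepts (x : Stmt pp) (t : Transcript pp) : Prop :=
  norm2 t.z ≤ pp.bound ∧
  x.A *ᵥ t.z = t.msg1.w + t.c • x.com0 ∧
  (x.aBin ⬝ᵥ t.z - t.c * t.msg1.f) * (x.aBin ⬝ᵥ t.z - t.c * t.msg1.f + t.c)
    + x.aBin' ⬝ᵥ t.z - t.c * t.msg1.u1 = t.msg1.u3 ∧
  t.c * (invNtt (QT t.φ) * t.msg1.f - invNtt t.φ * x.com1 + t.msg1.u2 - t.msg2.h) + t.msg2.u4
    = x.aG ⬝ᵥ t.z + (x.aBin ⬝ᵥ t.z) * invNtt (QT t.φ) - (x.pk1 ⬝ᵥ t.z) * invNtt t.φ ∧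
  ∀ k : Fin pp.d, (k : ℕ) < pp.n → coef t.msg2.h k = 0

/-! ## Malicious provers -/

/-- A prover with its random coins fixed: next-message functions. -/
structure Strategy (pp : Params) where
  first : Msg1 pp
  second : Slots pp → Msg2 pp
  third : Slots pp → pp.Rq → Fin pp.m → pp.Rq

/-- The interaction of a prover (with its coins fixed) and the honest verifier. -/
def runStrategy (P : Strategy pp) : PMF (Transcript pp) :=
  pp.unifSlots.bind fun φ => pp.chal.map fun c =>
    ⟨P.first, φ, P.second φ, c, P.third φ c⟩

end Params

open Params

/-! ## Encoding of data as words -/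

/-- An encoding of the elements of `α` as words of `ℤ_q`, one for each wire. -/
class WordEnc (q : outParam ℕ) (α : Type) where
  Wire : Type
  enc : α → Wire → ZMod q
  dec : (Wire → ZMod q) → α

/-- The wires of an encoded type. -/
abbrev Wire {q : ℕ} (α : Type) [WordEnc q α] : Type := WordEnc.Wire (q := q) α

section encodings

variable {pp : Params}

instance : WordEnc pp.q pp.Rq where
  Wire := Fin pp.d
  enc := coef
  dec := ofCoef

instance : WordEnc pp.q (Slots pp) where
  Wire := Fin pp.l × Fin pp.n
  enc := fun a i => a i.1 i.2
  dec := fun v j i => v (j, i)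

instance {q : ℕ} {α : Type} [WordEnc q α] {r : ℕ} : WordEnc q (Fin r → α) where
  Wire := Fin r × Wire α
  enc := fun a i => WordEnc.enc (a i.1) i.2
  dec := fun v j => WordEnc.dec fun i => v (j, i)

instance {q : ℕ} {α : Type} [WordEnc q α] {r s : ℕ} : WordEnc q (Matrix (Fin r) (Fin s) α) where
  Wire := (Fin r × Fin s) × Wire α
  enc := fun a i => WordEnc.enc (a i.1.1 i.1.2) i.2
  dec := fun v j k => WordEnc.dec fun i => v ((j, k), i)

instance {q : ℕ} {α β : Type} [WordEnc q α] [WordEnc q β] : WordEnc q (α × β) where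
  Wire := Wire α ⊕ Wire β
  enc := fun a => Sum.elim (WordEnc.enc a.1) (WordEnc.enc a.2)
  dec := fun v => (WordEnc.dec fun i => v (.inl i), WordEnc.dec fun i => v (.inr i))

/-- Transport of an encoding along inverse maps. -/
abbrev WordEnc.via {q : ℕ} {α β : Type} [WordEnc q β] (f : α → β) (g : β → α) : WordEnc q α where
  Wire := Wire β
  enc := fun a => WordEnc.enc (f a)
  dec := fun v => g (WordEnc.dec v)

instance : WordEnc pp.q (Stmt pp) :=
  WordEnc.via (fun x => (x.A, x.pk1, x.pk2, x.b, x.aBin, x.aBin', x.aG,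
      x.com0, x.com1, x.com2, x.com3))
    (fun (A, pk1, pk2, b, aBin, aBin', aG, com0, com1, com2, com3) =>
      ⟨A, pk1, pk2, b, aBin, aBin', aG, com0, com1, com2, com3⟩)

instance : WordEnc pp.q (Opening pp) :=
  WordEnc.via (fun o => (o.cbar, o.r, o.msg)) (fun (cbar, r, msg) => ⟨cbar, r, msg⟩)

instance : WordEnc pp.q (Msg1 pp) :=
  WordEnc.via (fun a => (a.f, a.u1, a.u2, a.u3, a.w)) (fun (f, u1, u2, u3, w) => ⟨f, u1, u2, u3, w⟩)

instance : WordEnc pp.q (Msg2 pp) :=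
  WordEnc.via (fun a => (a.h, a.u4)) (fun (h, u4) => ⟨h, u4⟩)

instance : WordEnc pp.q (Transcript pp) :=
  WordEnc.via (fun t => (t.msg1, t.φ, t.msg2, t.c, t.z))
    (fun (msg1, φ, msg2, c, z) => ⟨msg1, φ, msg2, c, z⟩)

end encodings

/-! ## Machines: probabilistic circuits over words, with a gate count

Wires carry words of `ℤ_q`. Arithmetic, bit extraction and selection make the model polynomially
equivalent to Boolean circuits when `log q` is polynomial; the random gates draw a uniform word or
a coefficient from one of the distributions used by the scheme itself. -/

/-- A gate reading wires of type `ι`. -/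
inductive Gate (q : ℕ) (ι : Type) : Type
  | const (a : ZMod q)
  | add (i j : ι)
  | mul (i j : ι)
  /-- the `k`-th binary digit of wire `i` -/
  | bit (k : ℕ) (i : ι)
  /-- wire `j` if wire `i` is zero, and wire `k` otherwise -/
  | ite (i j k : ι)
  | unif
  | drawSecret
  | drawChallenge
  | drawGauss

/-- The (random) output of a gate. -/
def Gate.run (pp : Params) {ι : Type} (x : ι → pp.W) : Gate pp.q ι → PMF pp.W
  | .const a => PMF.pure a
  | .add i j => PMF.pure (x i + x j)
  | .mul i j => PMF.pure (x i * x j)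
  | .bit k i => PMF.pure (if (x i).val.testBit k then 1 else 0)
  | .ite i j k => PMF.pure (if x i = 0 then x j else x k)
  | .unif => PMF.uniformOfFintype pp.W
  | .drawSecret => pp.χ.map fun a => (a : pp.W)
  | .drawChallenge => (ternary pp.p).map fun a => (a : pp.W)
  | .drawGauss => (gauss pp.σ pp.σ_pos).map fun a => (a : pp.W)

/-- The types of the oracles a circuit may call. -/
structure OracleSig where
  Call : Type
  In : Call → Type
  Out : Call → Type

/-- No oracles. -/
def OracleSig.none : OracleSig := ⟨Empty, Empty.elim, Empty.elim⟩

/-- Circuits with input wires `α` and output wires `β`. `wire` only renames, copies and discards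
wires; `gate` adds one wire, `none`, carrying the value of a gate; `call` adds the wires of an
oracle's answer. -/
inductive Circuit (q : ℕ) (S : OracleSig) : Type → Type → Type 1
  | wire {α β : Type} (σ : β → α) : Circuit q S α β
  | gate {α : Type} (g : Gate q α) : Circuit q S α (Option α)
  | call {α : Type} (s : S.Call) (σ : S.In s → α) : Circuit q S α (α ⊕ S.Out s)
  | seq {α β γ : Type} (C : Circuit q S α β) (D : Circuit q S β γ) : Circuit q S α γ

/-- Number of gates and oracle calls. -/
def Circuit.size {q : ℕ} {S : OracleSig} : {α β : Type} → Circuit q S α β → ℕ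
  | _, _, .wire _ => 0
  | _, _, .gate _ => 1
  | _, _, .call _ _ => 1
  | _, _, .seq C D => C.size + D.size

/-- The (random) output of a circuit. -/
def Circuit.run (pp : Params) {S : OracleSig}
    (O : ∀ s : S.Call, (S.In s → pp.W) → (S.Out s → pp.W)) :
    {α β : Type} → Circuit pp.q S α β → (α → pp.W) → PMF (β → pp.W)
  | _, _, .wire σ, x => PMF.pure fun b => x (σ b)
  | _, _, .gate g, x => (g.run pp x).map fun a o => o.elim a x
  | _, _, .call s σ, x => PMF.pure (Sum.elim x (O s fun i => x (σ i)))
  | _, _, .seq C D, x => (C.run pp O x).bind fun y => D.run pp O y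

/-- An oracle-free circuit mapping encoded elements of `α` to encoded elements of `β`. -/
abbrev Algo (pp : Params) (α β : Type) [WordEnc pp.q α] [WordEnc pp.q β] : Type 1 :=
  Circuit pp.q OracleSig.none (Wire α) (Wire β)

/-- The random map computed by an oracle-free circuit. -/
def Algo.run {pp : Params} {α β : Type} [WordEnc pp.q α] [WordEnc pp.q β] (C : Algo pp α β)
    (a : α) : PMF β :=
  (Circuit.run pp (S := OracleSig.none) (fun s => s.elim) C (WordEnc.enc a)).map WordEnc.dec

/-- Distinguishers: oracle-free circuits with a single output wire. -/
abbrev Distinguisher (pp : Params) (α : Type) [WordEnc pp.q α] : Type 1 :=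
  Circuit pp.q OracleSig.none (Wire α) Unit

/-- Probability that a distinguisher outputs `1` on an input drawn from a distribution. -/
def Distinguisher.prob {pp : Params} {α : Type} [WordEnc pp.q α] (D : Distinguisher pp α)
    (p : PMF α) : ℝ :=
  PoA.prob (p.bind fun a =>
    Circuit.run pp (S := OracleSig.none) (fun s => s.elim) D (WordEnc.enc a)) fun o => o () = 1

/-- The three next-message queries to a prover. -/
inductive ProverCall
  | first
  | second
  | third

/-- Oracle access to a prover whose coins are fixed. Since every query carries all previous
challenges, the prover can be rewound to any point. -/
def proverSig (pp : Params) : OracleSig where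
  Call := ProverCall
  In
    | .first => Empty
    | .second => Wire (Slots pp)
    | .third => Wire (Slots pp × pp.Rq)
  Out
    | .first => Wire (Msg1 pp)
    | .second => Wire (Msg2 pp)
    | .third => Wire (Fin pp.m → pp.Rq)

/-- The oracle answering according to a strategy. -/
def proverOracle {pp : Params} (P : Strategy pp) : ∀ s : (proverSig pp).Call,
    ((proverSig pp).In s → pp.W) → ((proverSig pp).Out s → pp.W)
  | .first => fun _ => WordEnc.enc P.first
  | .second => fun x => WordEnc.enc (P.second (WordEnc.dec x))
  | .third => fun x =>
      let a : Slots pp × pp.Rq := WordEnc.dec x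
      WordEnc.enc (P.third a.1 a.2)

/-- Knowledge extractors: from the statement and with oracle access to a prover, they produce a
candidate opening and a candidate module-SIS solution. -/
abbrev Extractor (pp : Params) : Type 1 :=
  Circuit pp.q (proverSig pp) (Wire (Stmt pp)) (Wire (Opening pp × (Fin pp.m → pp.Rq)))

/-- The output of an extractor. -/
def Extractor.run {pp : Params} (K : Extractor pp) (P : Strategy pp) (x : Stmt pp) :
    PMF (Opening pp × (Fin pp.m → pp.Rq)) :=
  (Circuit.run pp (proverOracle P) K (WordEnc.enc x)).map WordEnc.dec

/-! ## Asymptotic notions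

The security parameter `η` indexes a family of public parameters. -/

/-- Negligible functions of the security parameter. -/
def Negligible (f : ℕ → ℝ) : Prop :=
  Asymptotics.SuperpolynomialDecay Filter.atTop (fun η : ℕ => (η : ℝ)) f

/-- Polynomially bounded functions of the security parameter. -/
def PolyBounded (f : ℕ → ℕ) : Prop := ∃ P : Polynomial ℕ, ∀ η, f η ≤ P.eval η

/-- Conditions on a parameter family: sizes are polynomial; the dimension of the commitment
randomness is at least `η`; the masking vector is wide enough for rejection sampling with
repetition rate `3` and statistical error `2 ^ (-η)`; and the NTT coefficients of challenges are
nearly uniform, `ε ≤ 1 / q`. -/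
structure Admissible (pp : ℕ → Params) : Prop where
  d_poly : PolyBounded fun η => (pp η).d
  κ_poly : PolyBounded fun η => (pp η).κ
  lam_poly : PolyBounded fun η => (pp η).lam
  log_q_poly : PolyBounded fun η => Nat.log 2 (pp η).q
  dim : ∀ η, η ≤ (pp η).m * (pp η).d
  rejection : ∀ η : ℕ,
    Real.exp (√(2 * η * Real.log 2) * (pp η).shift / (pp η).σ
      + (pp η).shift ^ 2 / (2 * (pp η).σ ^ 2)) ≤ 3
  equidistribution : ∀ η, (pp η).q * (pp η).ε ≤ 1

/-- Module-LWE samples `(A, A s + e)` with `A` of size `r × t`. -/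
def mlweReal (pp : Params) (r t : ℕ) : PMF (Matrix (Fin r) (Fin t) pp.Rq × (Fin r → pp.Rq)) :=
  (pp.unifMat r t).bind fun A => (iid pp.smallR t).bind fun s => (iid pp.smallR r).map fun e =>
    (A, A *ᵥ s + e)

/-- Dual (knapsack) module-LWE samples `(A, A s)` with `A` of size `r × t`. -/
def dualReal (pp : Params) (r t : ℕ) : PMF (Matrix (Fin r) (Fin t) pp.Rq × (Fin r → pp.Rq)) :=
  (pp.unifMat r t).bind fun A => (iid pp.smallR t).map fun s => (A, A *ᵥ s)

/-- Uniform samples `(A, u)`. -/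
def lweIdeal (pp : Params) (r t : ℕ) : PMF (Matrix (Fin r) (Fin t) pp.Rq × (Fin r → pp.Rq)) :=
  (pp.unifMat r t).bind fun A => (iid pp.unifR r).map fun u => (A, u)

/-- Computational indistinguishability by polynomial-size circuits. -/
def Indist (pp : ℕ → Params) (α : ℕ → Type) [∀ η, WordEnc (pp η).q (α η)]
    (X Y : ∀ η, PMF (α η)) : Prop :=
  ∀ D : ∀ η, Distinguisher (pp η) (α η), PolyBounded (fun η => (D η).size) →
    Negligible fun η => |(D η).prob (X η) - (D η).prob (Y η)|

/-- Hardness of module-LWE with `κ + λ + 3` samples and rank `κ`. -/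
def MLWEHard (pp : ℕ → Params) : Prop :=
  Indist pp (fun η => Matrix (Fin (pp η).m) (Fin (pp η).κ) (pp η).Rq × (Fin (pp η).m → (pp η).Rq))
    (fun η => mlweReal (pp η) (pp η).m (pp η).κ) (fun η => lweIdeal (pp η) (pp η).m (pp η).κ)

/-- Hardness of dual module-LWE for matrices of size `(κ + 6) × (κ + λ + 3)`. -/
def DualMLWEHard (pp : ℕ → Params) : Prop :=
  Indist pp
    (fun η => Matrix (Fin ((pp η).κ + 6)) (Fin (pp η).m) (pp η).Rq × (Fin ((pp η).κ + 6) → (pp η).Rq))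
    (fun η => dualReal (pp η) ((pp η).κ + 6) (pp η).m)
    (fun η => lweIdeal (pp η) ((pp η).κ + 6) (pp η).m)

/-! ## The three security properties -/

/-- Completeness: up to a negligible error, the honest prover gets through rejection sampling
with probability at least `1 / 3`, and if it does not abort the verifier accepts. -/
def Complete (pp : ℕ → Params) : Prop :=
  ∃ δ : ℕ → ℝ, Negligible δ ∧ ∀ η (x : Stmt (pp η)) (w : Wit (pp η)), honestRel x w →
    prob (honestRun x w) (fun t => t.2 = true) ≥ (1 - δ η) / 3 ∧
    prob (condFlag (honestRun x w)) (accepts x) ≥ 1 - δ η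

/-- Knowledge soundness with knowledge error `err`. A malicious prover is a distribution on
strategies (its coins). The extractor finds an opening to a 64-bit integer or a solution of the
module-SIS instance given by the commitment matrix `A`, with norm bound
`8 ω 𝔰 √(2 (κ + λ + 3) d)`. -/
def KnowledgeSound (pp : ℕ → Params) (err : ℕ → ℝ) : Prop :=
  ∃ e : ℕ, 0 < e ∧ ∃ P : Polynomial ℕ, (∀ η, 0 < P.eval η) ∧
  ∃ K : ∀ η, Extractor (pp η), PolyBounded (fun η => (K η).size) ∧
  ∀ η (x : Stmt (pp η)) (Pstar : PMF (Strategy (pp η))),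
    err η < prob (Pstar.bind runStrategy) (accepts x) →
    prob (Pstar.bind fun S => (K η).run S x)
        (fun o => rel x o.1 ∨ solvesMSIS x.A (8 * (pp η).ω * (pp η).bound) o.2)
      ≥ (prob (Pstar.bind runStrategy) (accepts x) - err η) ^ e / P.eval η

/-- Commitment key and commitment as generated by honest parties, for messages `(v, m2, m3)`,
together with the witness. -/
def genInstance (pp : Params) (v : ℕ) (m2 m3 : pp.Rq) : PMF (Stmt pp × Wit pp) :=
  (pp.unifMat pp.κ pp.m).bind fun A =>
  (iid pp.unifR pp.m).bind fun b =>
  (iid pp.unifR pp.m).bind fun aBin =>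
  (iid pp.unifR pp.m).bind fun aBin' =>
  (iid pp.unifR pp.m).bind fun aG =>
  (iid pp.smallR pp.κ).bind fun s1 => (iid pp.smallR pp.m).bind fun e1 =>
  (iid pp.smallR pp.κ).bind fun s2 => (iid pp.smallR pp.m).bind fun e2 =>
  (iid pp.smallR pp.m).map fun r =>
    let pk1 := Aᵀ *ᵥ s1 + e1
    let pk2 := Aᵀ *ᵥ s2 + e2
    (⟨A, pk1, pk2, b, aBin, aBin', aG,
      A *ᵥ r, pk1 ⬝ᵥ r + (v : pp.Rq), pk2 ⬝ᵥ r + m2, b ⬝ᵥ r + m3⟩, ⟨r, v, m2, m3⟩)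

/-- Honest-verifier zero-knowledge: a polynomial-size simulator that sees only the statement
produces transcripts which, together with the statement, are indistinguishable from non-aborting
honest ones. -/
def HVZK (pp : ℕ → Params) : Prop :=
  ∃ Sim : ∀ η, Algo (pp η) (Stmt (pp η)) (Transcript (pp η)),
    PolyBounded (fun η => (Sim η).size) ∧
    ∀ (v : ℕ → ℕ) (m2 m3 : ∀ η, (pp η).Rq), (∀ η, v η < 2 ^ 64) →
      Indist pp (fun η => Stmt (pp η) × Transcript (pp η))
        (fun η => (genInstance (pp η) (v η) (m2 η) (m3 η)).bind fun xw =>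
          (condFlag (honestRun xw.1 xw.2)).map fun t => (xw.1, t))
        (fun η => (genInstance (pp η) (v η) (m2 η) (m3 η)).bind fun xw =>
          (Algo.run (Sim η) xw.1).map fun t => (xw.1, t))

end

end PoA

/-! The three properties rest on largely separate arguments; completeness and zero-knowledge share
the rejection-sampling step.

Rejection sampling. Let `v = c r` and `z = y + v`. Completing the square shows that three times the
untruncated acceptance probability is the density ratio `D(y + v) / D(y)` of the Gaussian mask
(`mask_mul_exp`, `Ex_mask_shift`). Since `y = z - c r`, an honest transcript is a function of `z`,
`g`, `φ`, `c`. So three times the accepted part of an honest run is dominated by `idealRun`, where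
`z` is Gaussian and independent of the witness. Truncation matters only on a half-space, whose mass
the sub-Gaussian bound and the width condition make at most `2 ^ (-η)`; hence the conditioned run is
that close to the ideal one (`condFlag_close`, `honestRun_close`). In the ideal run all equations
hold identically and only the norm can fail; a Chernoff bound with `E exp(x² / 4𝔰²) ≤ √2` makes this
exponentially unlikely. Both Gaussian estimates come from Poisson summation.

Knowledge soundness. The extractor makes three independent runs against one fixed first message. Two
accepting runs with `c₁ - c₂` invertible give `r = (z₁ - z₂) / (c₁ - c₂)`, an opening up to the
shape of its first message. A third accepting run gives a short vector killed by `A` unless its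
response lies on the line `y + c r` fixed by the first two (`third_consistent`). On this line the
verification equations are polynomial in the challenge. The quadratic one has leading coefficient
`b² - b` with `b = f - a_bin·r`, so if `b` is not idempotent, a random `c` rarely satisfies it. If
`b` is idempotent, its slots are bits and define a 64-bit integer `v`. When the opened message `m₁`
differs from `v`, either a nonzero linear equation in `c` must hold, or the vanishing head of `h`
imposes on `φ` an affine equation of probability `q ^ (-n)` (`Ex_consistent_le`).

All bounds on challenges reduce to the probability that a slot takes a given value. The coefficients
of a slot depend on disjoint blocks of challenge coefficients, and Fourier inversion on `ℤ_q` bounds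
each by `1/q + ε`, so a slot value has probability at most `(1/q + ε) ^ n`; `slotBound_le` converts
this into the stated error. A deterministic prover then yields success at least the cube of its
advantage, and a tangent-line inequality extends this to random coins. This gives `C = 2`, exponent
`3` and polynomial `1`.

Zero-knowledge. The verification equations determine `u₃`, `w`, `u₄` from the rest of the
transcript. Stack `A`, both public keys and the four other key vectors into one matrix with `κ + 6`
rows. Module-LWE, used once per public key, makes the matrix uniform, and dual module-LWE then makes
its product with `r` uniform. Three entries of the product, absent from the statement, are one-time
pads for `f`, `u₁`, `u₂`, while `g` hides `h`. Thus honest and simulated views coincide on uniform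
key samples (`ideal_views`).

Efficiency is handled by a calculus of cost bounds (`RComp`, `Comp`, `Det`, `Samp`) closed under
composition, sampling and ring operations. -/

namespace PoA
noncomputable section

/-! ## Expectations under discrete distributions -/

/-- Expectation of an extended nonnegative function. -/
def Ex {α : Type*} (p : PMF α) (f : α → ℝ≥0∞) : ℝ≥0∞ := ∑' a, p a * f a

open Classical in
/-- Indicator of a proposition. -/
def ind (P : Prop) : ℝ≥0∞ := if P then 1 else 0

theorem ind_le_one (P : Prop) : ind P ≤ 1 := by
  unfold ind; split_ifs <;> simp

theorem ind_of_true {P : Prop} (h : P) : ind P = 1 := by simp [ind, h]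

theorem ind_of_false {P : Prop} (h : ¬ P) : ind P = 0 := by simp [ind, h]

theorem ind_mono {P Q : Prop} (h : P → Q) : ind P ≤ ind Q := by
  by_cases hP : P
  · rw [ind_of_true hP, ind_of_true (h hP)]
  · rw [ind_of_false hP]; exact zero_le

theorem ind_or_le (P Q : Prop) : ind (P ∨ Q) ≤ ind P + ind Q := by
  by_cases hP : P
  · rw [ind_of_true hP, ind_of_true (Or.inl hP)]; exact le_self_add
  · by_cases hQ : Q
    · rw [ind_of_true hQ, ind_of_true (Or.inr hQ)]; exact le_add_self
    · rw [ind_of_false (by tauto)]; exact zero_le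

section Ex

variable {α β γ : Type*}

theorem Ex_pure (a : α) (f : α → ℝ≥0∞) : Ex (PMF.pure a) f = f a := by
  classical
  unfold Ex
  rw [tsum_eq_single a]
  · simp
  · intro b hb; simp [PMF.pure_apply, hb]

theorem Ex_bind (p : PMF α) (g : α → PMF β) (f : β → ℝ≥0∞) :
    Ex (p.bind g) f = Ex p fun a => Ex (g a) f := by
  unfold Ex
  simp_rw [PMF.bind_apply, ← ENNReal.tsum_mul_right, ← ENNReal.tsum_mul_left]
  rw [ENNReal.tsum_comm]
  simp_rw [mul_assoc]

theorem Ex_map (p : PMF α) (g : α → β) (f : β → ℝ≥0∞) :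
    Ex (p.map g) f = Ex p fun a => f (g a) := by
  rw [← PMF.bind_pure_comp, Ex_bind]
  simp [Ex_pure]

theorem Ex_mono' (p : PMF α) {f g : α → ℝ≥0∞} (h : ∀ a ∈ p.support, f a ≤ g a) :
    Ex p f ≤ Ex p g := by
  refine ENNReal.tsum_le_tsum fun a => ?_
  by_cases ha : p a = 0
  · simp [ha]
  · exact mul_le_mul_right (h a ((p.mem_support_iff a).2 ha)) _

theorem Ex_mono (p : PMF α) {f g : α → ℝ≥0∞} (h : ∀ a, f a ≤ g a) : Ex p f ≤ Ex p g :=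
  Ex_mono' p fun a _ => h a

theorem Ex_const (p : PMF α) (c : ℝ≥0∞) : Ex p (fun _ => c) = c := by
  unfold Ex
  rw [ENNReal.tsum_mul_right, p.tsum_coe, one_mul]

theorem Ex_add (p : PMF α) (f g : α → ℝ≥0∞) :
    Ex p (fun a => f a + g a) = Ex p f + Ex p g := by
  unfold Ex
  simp_rw [mul_add]
  exact ENNReal.tsum_add

theorem Ex_mul_left (p : PMF α) (c : ℝ≥0∞) (f : α → ℝ≥0∞) :
    Ex p (fun a => c * f a) = c * Ex p f := by
  unfold Ex
  rw [← ENNReal.tsum_mul_left]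
  simp_rw [mul_left_comm]

theorem Ex_mul_right (p : PMF α) (c : ℝ≥0∞) (f : α → ℝ≥0∞) :
    Ex p (fun a => f a * c) = Ex p f * c := by
  simp_rw [mul_comm _ c]
  exact Ex_mul_left p c f

theorem Ex_comm (p : PMF α) (q : PMF β) (f : α → β → ℝ≥0∞) :
    (Ex p fun a => Ex q fun b => f a b) = Ex q fun b => Ex p fun a => f a b := by
  unfold Ex
  simp_rw [← ENNReal.tsum_mul_left]
  rw [ENNReal.tsum_comm]
  simp_rw [mul_left_comm]

theorem Ex_le_one (p : PMF α) {f : α → ℝ≥0∞} (h : ∀ a, f a ≤ 1) : Ex p f ≤ 1 :=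
  (Ex_mono p h).trans (Ex_const p 1).le

theorem Ex_finset_sum {ι : Type*} (p : PMF α) (s : Finset ι) (f : ι → α → ℝ≥0∞) :
    Ex p (fun a => ∑ i ∈ s, f i a) = ∑ i ∈ s, Ex p (f i) := by
  classical
  induction s using Finset.induction_on with
  | empty => simpa using Ex_const p 0
  | insert i s hi ih => simp_rw [Finset.sum_insert hi, Ex_add, ih]

theorem Ex_fintype [Fintype α] (p : PMF α) (f : α → ℝ≥0∞) : Ex p f = ∑ a, p a * f a :=
  tsum_fintype _

theorem Ex_uniform [Fintype α] [Nonempty α] (f : α → ℝ≥0∞) :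
    Ex (PMF.uniformOfFintype α) f = (Fintype.card α : ℝ≥0∞)⁻¹ * ∑ a, f a := by
  rw [Ex_fintype, Finset.mul_sum]
  simp [PMF.uniformOfFintype_apply]

theorem prob_eq (p : PMF α) (P : α → Prop) : prob p P = (Ex p fun a => ind (P a)).toReal := by
  classical
  unfold prob Ex
  rw [PMF.toOuterMeasure_apply]
  congr 1
  refine tsum_congr fun a => ?_
  by_cases h : P a <;> simp [Set.indicator, ind, h]

theorem Ex_ind_le_one (p : PMF α) (P : α → Prop) : (Ex p fun a => ind (P a)) ≤ 1 :=
  Ex_le_one p fun _ => ind_le_one _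

theorem Ex_ind_ne_top (p : PMF α) (P : α → Prop) : (Ex p fun a => ind (P a)) ≠ ∞ :=
  ne_top_of_le_ne_top ENNReal.one_ne_top (Ex_ind_le_one p P)

theorem Ex_compl (p : PMF α) {f : α → ℝ≥0∞} (h : ∀ a, f a ≤ 1) :
    Ex p f + Ex p (fun a => 1 - f a) = 1 := by
  rw [← Ex_add]
  simp_rw [add_tsub_cancel_of_le (h _)]
  exact Ex_const p 1

/-- Equalities of samplers become identities of iterated expectations, in which independent draws
are reordered by `Ex_comm`. -/
theorem pmf_ext_Ex {p q : PMF α} (h : ∀ f, Ex p f = Ex q f) : p = q := by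
  classical
  ext a
  have := h fun b => if b = a then 1 else 0
  simpa [Ex] using this

end Ex

/-! ## Independent samples -/

theorem Ex_iid_succ {α : Type} (p : PMF α) (n : ℕ) (f : (Fin (n + 1) → α) → ℝ≥0∞) :
    Ex (iid p (n + 1)) f = Ex p fun a => Ex (iid p n) fun v => f (Fin.cons a v) := by
  simp only [iid, Ex_bind, Ex_map]

theorem Ex_iid_prod {α : Type} (p : PMF α) (n : ℕ) (f : Fin n → α → ℝ≥0∞) :
    (Ex (iid p n) fun v => ∏ i, f i (v i)) = ∏ i, Ex p (f i) := by
  induction n with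
  | zero => simp [iid, Ex_pure]
  | succ n ih =>
    rw [Ex_iid_succ, Fin.prod_univ_succ]
    simp_rw [Fin.prod_univ_succ, Fin.cons_zero, Fin.cons_succ, Ex_mul_left, ih, Ex_mul_right]

theorem iid_apply {α : Type} (p : PMF α) (n : ℕ) (v : Fin n → α) :
    iid p n v = ∏ i, p (v i) := by
  classical
  have h := Ex_iid_prod p n fun i a => if a = v i then 1 else 0
  have h1 : ∀ w : Fin n → α,
      (∏ i, (if w i = v i then (1 : ℝ≥0∞) else 0)) = if w = v then 1 else 0 := by
    intro w
    rw [Finset.prod_ite_zero]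
    simp [funext_iff]
  simp_rw [h1] at h
  simpa [Ex] using h

theorem iid_map {α β : Type} (p : PMF α) (f : α → β) (n : ℕ) :
    iid (p.map f) n = (iid p n).map fun v i => f (v i) := by
  induction n with
  | zero =>
    simp only [iid, PMF.pure_map]
    congr 1
    exact Subsingleton.elim _ _
  | succ n ih =>
    refine pmf_ext_Ex fun g => ?_
    rw [Ex_iid_succ, Ex_map, Ex_map, Ex_iid_succ, ih]
    simp_rw [Ex_map]
    congr 1; funext a; congr 1; funext v; congr 1; funext i
    refine Fin.cases ?_ (fun j => ?_) i <;> simp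

theorem iid_uniform {α : Type} [Fintype α] [Nonempty α] (n : ℕ) :
    iid (PMF.uniformOfFintype α) n = PMF.uniformOfFintype (Fin n → α) := by
  classical
  ext v
  rw [iid_apply]
  simp only [PMF.uniformOfFintype_apply, Finset.prod_const, Finset.card_univ, Fintype.card_fin,
    Fintype.card_fun, Nat.cast_pow]
  rw [ENNReal.inv_pow]

theorem iid_support {α : Type} (p : PMF α) (n : ℕ) (v : Fin n → α) (h : v ∈ (iid p n).support)
    (i : Fin n) : v i ∈ p.support := by
  rw [PMF.mem_support_iff, iid_apply] at h
  rw [PMF.mem_support_iff]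
  exact Finset.prod_ne_zero_iff.1 h i (Finset.mem_univ i)

theorem uniform_map_equiv {α β : Type*} [Fintype α] [Nonempty α] [Fintype β] [Nonempty β]
    (e : α ≃ β) :
    (PMF.uniformOfFintype α).map e = PMF.uniformOfFintype β := by
  refine pmf_ext_Ex fun f => ?_
  rw [Ex_map, Ex_uniform, Ex_uniform, Fintype.card_congr e, e.sum_comp]

theorem coin_apply_true (x : ℝ) : coin x true = ENNReal.ofReal (min 1 (max 0 x)) := rfl

/-! ## Conditioning on a flag -/

/-- Written as a product with the mass of the flag, which avoids division in `ℝ≥0∞`. -/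
theorem Ex_condFlag {α : Type} (p : PMF (α × Bool)) (f : α → ℝ≥0∞)
    (h : (Ex p fun a => ind (a.2 = true)) ≠ 0) :
    Ex (condFlag p) f * (Ex p fun a => ind (a.2 = true)) =
      Ex p fun a => ind (a.2 = true) * f a.1 := by
  classical
  have hs : ∃ a ∈ {a : α × Bool | a.2 = true}, a ∈ p.support := by
    by_contra hcon
    push Not at hcon
    apply h
    unfold Ex
    rw [ENNReal.tsum_eq_zero]
    intro a
    by_cases ha : a.2 = true
    · have := hcon a ha
      rw [PMF.mem_support_iff, not_not] at this
      simp [this]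
    · simp [ind, ha]
  have hN : ∑' a', Set.indicator {a : α × Bool | a.2 = true} p a'
      = Ex p fun a => ind (a.2 = true) := by
    unfold Ex
    refine tsum_congr fun a => ?_
    by_cases ha : a.2 = true <;> simp [Set.indicator, ind, ha]
  unfold condFlag
  rw [dif_pos hs, Ex_map]
  set N := Ex p fun a => ind (a.2 = true) with hNdef
  have hNtop : N ≠ ∞ := Ex_ind_ne_top p _
  unfold Ex
  rw [← ENNReal.tsum_mul_right]
  refine tsum_congr fun a => ?_
  rw [PMF.filter_apply, hN]
  by_cases ha : a.2 = true
  · simp only [Set.indicator, Set.mem_ofPred_eq, ha, if_true, ind, one_mul]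
    calc p a * N⁻¹ * f a.1 * N = p a * f a.1 * (N⁻¹ * N) := by ring
      _ = _ := by rw [ENNReal.inv_mul_cancel h hNtop, mul_one]
  · simp [Set.indicator, ind, ha]

/-- If the flagged part of `p` is dominated by `q / 3` and has mass almost `1 / 3`, then `p`
conditioned on the flag is close to `q`. -/
theorem condFlag_close {α : Type} (p : PMF (α × Bool)) (q : PMF α) (δ : ℝ)
    (hdom : ∀ f : α → ℝ≥0∞, 3 * (Ex p fun a => ind (a.2 = true) * f a.1) ≤ Ex q f)
    (hmass : ENNReal.ofReal ((1 - δ) / 3) ≤ Ex p fun a => ind (a.2 = true))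
    (hδ : 0 ≤ δ) (f : α → ℝ≥0∞) (hf : ∀ a, f a ≤ 1) :
    |(Ex (condFlag p) f).toReal - (Ex q f).toReal| ≤ δ := by
  have real : ∀ {γ : Type} (r : PMF γ) (g : γ → ℝ≥0∞), (∀ a, g a ≤ 1) →
      0 ≤ (Ex r g).toReal ∧ (Ex r g).toReal ≤ 1 ∧
      (Ex r g).toReal + (Ex r fun a => 1 - g a).toReal = 1 := by
    intro γ r g hg
    have h1 := Ex_le_one r hg
    have h2 : (Ex r fun a => 1 - g a) ≤ 1 := Ex_le_one r fun a => tsub_le_self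
    refine ⟨ENNReal.toReal_nonneg, ENNReal.toReal_mono ENNReal.one_ne_top h1, ?_⟩
    rw [← ENNReal.toReal_add (ne_top_of_le_ne_top ENNReal.one_ne_top h1)
      (ne_top_of_le_ne_top ENNReal.one_ne_top h2), Ex_compl r hg, ENNReal.toReal_one]
  obtain ⟨z0, z1, hz⟩ := real (condFlag p) f hf
  obtain ⟨x0, x1, hx⟩ := real q f hf
  -- For `δ ≥ 1` the mass bound is void and the flag may have probability zero, but two numbers in
  -- `[0, 1]` differ by at most `1` anyway.
  rcases le_or_gt 1 δ with h1 | h1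
  · rw [abs_le]; constructor <;> linarith
  set N := Ex p fun a => ind (a.2 = true) with hN
  have hNpos : N ≠ 0 := by
    have : 0 < ENNReal.ofReal ((1 - δ) / 3) := by
      rw [ENNReal.ofReal_pos]; linarith
    exact (this.trans_le hmass).ne'
  have hNtop : N ≠ ∞ := Ex_ind_ne_top p _
  have hNr : (1 - δ) / 3 ≤ N.toReal := by
    rwa [← ENNReal.ofReal_le_iff_le_toReal hNtop]
  have hcond : ∀ g : α → ℝ≥0∞, (Ex (condFlag p) g).toReal * N.toReal =
      (Ex p fun a => ind (a.2 = true) * g a.1).toReal := by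
    intro g
    rw [← Ex_condFlag p g hNpos, ENNReal.toReal_mul]
  have hd : ∀ g : α → ℝ≥0∞, (∀ a, g a ≤ 1) →
      3 * ((Ex (condFlag p) g).toReal * N.toReal) ≤ (Ex q g).toReal := by
    intro g hg
    rw [hcond]
    have := ENNReal.toReal_mono (ne_top_of_le_ne_top ENNReal.one_ne_top (Ex_le_one q hg)) (hdom g)
    simpa [ENNReal.toReal_mul] using this
  -- Domination is one-sided, so it is applied to `f` and to `1 - f`. With `3 N` between `1 - δ` and
  -- `1`, these give the upper and the lower estimate.
  have e1 := hd f hf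
  have e2 := hd (fun a => 1 - f a) fun a => tsub_le_self
  set Z := (Ex (condFlag p) f).toReal
  set Z' := (Ex (condFlag p) fun a => 1 - f a).toReal
  have hZ' : 0 ≤ Z' := ENNReal.toReal_nonneg
  have hM : 3 * N.toReal ≤ 1 := by
    have : 3 * ((Z + Z') * N.toReal) ≤ 1 := by linarith
    rwa [hz, one_mul] at this
  rw [abs_le]
  constructor <;> nlinarith

end

end PoA

namespace PoA
noncomputable section

/-! ## Discrete Gaussians -/

theorem summable_gauss_lin {a : ℝ} (ha : 0 < a) (b : ℝ) :
    Summable fun n : ℤ => Real.exp (-Real.pi * a * (n : ℝ) ^ 2 + 2 * Real.pi * b * n) := by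
  have hm : ∀ b : ℝ, Summable fun n : ℕ =>
      Real.exp (-Real.pi * a * (n : ℝ) ^ 2 + 2 * Real.pi * b * n) := by
    intro b
    -- Beyond this `N` one has `π a n ≥ 2 π b + 1`, so the exponent is at most `-n`.
    obtain ⟨N, hN⟩ := exists_nat_gt ((2 * Real.pi * b + 1) / (Real.pi * a))
    have hpa : 0 < Real.pi * a := by positivity
    refine Summable.of_norm_bounded_eventually_nat (g := fun n : ℕ => Real.exp (-(n : ℝ))) ?_ ?_
    · simpa using Real.summable_exp_nat_mul_of_ge (c := -1) (by norm_num)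
        (f := fun n : ℕ => (n : ℝ)) (fun i => le_rfl)
    · filter_upwards [Filter.eventually_ge_atTop N] with n hn
      rw [Real.norm_eq_abs, Real.abs_exp, Real.exp_le_exp]
      rw [div_lt_iff₀ hpa] at hN
      have h2 : (N : ℝ) ≤ n := by exact_mod_cast hn
      have h3 : (2 * Real.pi * b + 1) ≤ n * (Real.pi * a) :=
        hN.le.trans (mul_le_mul_of_nonneg_right h2 hpa.le)
      nlinarith [mul_le_mul_of_nonneg_right h3 (Nat.cast_nonneg n : (0 : ℝ) ≤ n)]
  refine Summable.of_nat_of_neg ?_ ?_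
  · simpa using hm b
  · refine (hm (-b)).congr fun n => ?_
    congr 1
    push_cast
    ring

/-- Poisson summation turns the linear term into an imaginary shift of the dual sum. Each dual term
has modulus `exp(π b² / a) exp(-π n² / a)`; dropping the phases by the triangle inequality leaves
the dual of the sum without linear term. -/
theorem tsum_gauss_lin_le {a : ℝ} (ha : 0 < a) (b : ℝ) :
    ∑' n : ℤ, Real.exp (-Real.pi * a * (n : ℝ) ^ 2 + 2 * Real.pi * b * n) ≤
      Real.exp (Real.pi * b ^ 2 / a) * ∑' n : ℤ, Real.exp (-Real.pi * a * (n : ℝ) ^ 2) := by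
  have key := Complex.tsum_exp_neg_quadratic (a := (a : ℂ)) (by simpa using ha) (b : ℂ)
  have hS : Summable fun n : ℤ => Real.exp (-Real.pi / a * (n : ℝ) ^ 2) := by
    have := summable_gauss_lin (a := 1 / a) (by positivity) 0
    refine this.congr fun n => ?_
    congr 1
    ring
  have hterm : ∀ n : ℤ,
      ‖Complex.exp (-Real.pi / a * ((n : ℂ) + Complex.I * (b : ℂ)) ^ 2)‖
        = Real.exp (Real.pi * b ^ 2 / a) * Real.exp (-Real.pi / a * (n : ℝ) ^ 2) := by
    intro n
    rw [Complex.norm_exp, ← Real.exp_add]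
    congr 1
    have : (-(Real.pi : ℂ) / a * ((n : ℂ) + Complex.I * (b : ℂ)) ^ 2)
        = ((Real.pi * b ^ 2 / a + -Real.pi / a * (n : ℝ) ^ 2 : ℝ) : ℂ)
          + ((-Real.pi / a * (2 * n * b) : ℝ) : ℂ) * Complex.I := by
      push_cast
      linear_combination (-(Real.pi : ℂ) / a * b ^ 2) * Complex.I_sq
    rw [this, Complex.add_re, Complex.re_ofReal_mul, Complex.ofReal_re]
    simp
  have hleft : ((∑' n : ℤ, Real.exp (-Real.pi * a * (n : ℝ) ^ 2 + 2 * Real.pi * b * n) : ℝ) : ℂ)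
      = ∑' n : ℤ, Complex.exp (-Real.pi * a * (n : ℂ) ^ 2 + 2 * Real.pi * b * n) := by
    push_cast
    rfl
  have hnn : 0 ≤ ∑' n : ℤ, Real.exp (-Real.pi * a * (n : ℝ) ^ 2 + 2 * Real.pi * b * n) :=
    tsum_nonneg fun _ => (Real.exp_pos _).le
  have hnorm : ‖(1 / (a : ℂ) ^ (1 / 2 : ℂ))‖ = 1 / a ^ (1 / 2 : ℝ) := by
    rw [norm_div, norm_one, Complex.norm_cpow_eq_rpow_re_of_pos ha]
    norm_num
  calc _ = ‖((∑' n : ℤ, Real.exp (-Real.pi * a * (n : ℝ) ^ 2 + 2 * Real.pi * b * n) : ℝ) : ℂ)‖ := by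
        rw [Complex.norm_real, Real.norm_eq_abs, abs_of_nonneg hnn]
    _ = 1 / a ^ (1 / 2 : ℝ) *
        ‖∑' n : ℤ, Complex.exp (-Real.pi / a * ((n : ℂ) + Complex.I * (b : ℂ)) ^ 2)‖ := by
        rw [hleft, key, norm_mul, hnorm]
    _ ≤ 1 / a ^ (1 / 2 : ℝ) *
        ∑' n : ℤ, ‖Complex.exp (-Real.pi / a * ((n : ℂ) + Complex.I * (b : ℂ)) ^ 2)‖ := by
        refine mul_le_mul_of_nonneg_left (norm_tsum_le_tsum_norm ?_) (by positivity)
        simp_rw [hterm]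
        exact hS.mul_left _
    _ = _ := by
        simp_rw [hterm]
        rw [tsum_mul_left, Real.tsum_exp_neg_mul_int_sq ha]
        ring

/-- On the dual side, halving `a` multiplies the prefactor by `√2` and only decreases the
exponentials. -/
theorem tsum_gauss_scale_le {a : ℝ} (ha : 0 < a) :
    ∑' n : ℤ, Real.exp (-Real.pi * (a / 2) * (n : ℝ) ^ 2) ≤
      √2 * ∑' n : ℤ, Real.exp (-Real.pi * a * (n : ℝ) ^ 2) := by
  have hS : ∀ c : ℝ, 0 < c → Summable fun n : ℤ => Real.exp (-Real.pi / c * (n : ℝ) ^ 2) := by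
    intro c hc
    have := summable_gauss_lin (a := 1 / c) (by positivity) 0
    refine this.congr fun n => ?_
    congr 1
    ring
  rw [Real.tsum_exp_neg_mul_int_sq ha, Real.tsum_exp_neg_mul_int_sq (half_pos ha)]
  have h2 : (1 : ℝ) / (a / 2) ^ (1 / 2 : ℝ) = √2 * (1 / a ^ (1 / 2 : ℝ)) := by
    rw [← Real.sqrt_eq_rpow, ← Real.sqrt_eq_rpow, Real.sqrt_div ha.le]
    field_simp
  rw [h2, mul_assoc]
  refine mul_le_mul_of_nonneg_left (mul_le_mul_of_nonneg_left ?_ (by positivity)) (by positivity)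
  refine (hS _ (half_pos ha)).tsum_le_tsum (fun n => ?_) (hS _ ha)
  rw [Real.exp_le_exp]
  have : Real.pi / a ≤ Real.pi / (a / 2) := by
    apply div_le_div_of_nonneg_left Real.pi_pos.le (half_pos ha) (by linarith)
  have h3 := mul_le_mul_of_nonneg_right this (sq_nonneg (n : ℝ))
  have e1 : -Real.pi / (a / 2) * (n : ℝ) ^ 2 = -(Real.pi / (a / 2) * (n : ℝ) ^ 2) := by ring
  have e2 : -Real.pi / a * (n : ℝ) ^ 2 = -(Real.pi / a * (n : ℝ) ^ 2) := by ring
  rw [e1, e2]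
  linarith

/-- Passes from unnormalised sums over `ℤ` to expectations by cancelling the normalising constant.
-/
theorem Ex_gauss_le (s : ℝ) (hs : 0 < s) (g : ℤ → ℝ) (c : ℝ) (hc : 0 ≤ c)
    (hsum : Summable fun x : ℤ => Real.exp (-((x : ℝ) ^ 2) / (2 * s ^ 2) + g x))
    (h : ∑' x : ℤ, Real.exp (-((x : ℝ) ^ 2) / (2 * s ^ 2) + g x) ≤
      c * ∑' x : ℤ, Real.exp (-((x : ℝ) ^ 2) / (2 * s ^ 2))) :
    (Ex (gauss s hs) fun x => ENNReal.ofReal (Real.exp (g x))) ≤ ENNReal.ofReal c := by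
  have h0 := gaussWeight_tsum_ne_zero s
  have h1 := gaussWeight_tsum_ne_top hs
  have hW : ∑' x, gaussWeight s x
      = ENNReal.ofReal (∑' x : ℤ, Real.exp (-((x : ℝ) ^ 2) / (2 * s ^ 2))) := by
    rw [ENNReal.ofReal_tsum_of_nonneg (fun _ => (Real.exp_pos _).le)]
    · rfl
    · have := summable_gauss_lin (a := 1 / (2 * Real.pi * s ^ 2)) (by positivity) 0
      refine this.congr fun n => ?_
      congr 1
      field_simp
      ring
  have e : (Ex (gauss s hs) fun x => ENNReal.ofReal (Real.exp (g x)))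
      = (∑' x, gaussWeight s x)⁻¹ *
        ENNReal.ofReal (∑' x : ℤ, Real.exp (-((x : ℝ) ^ 2) / (2 * s ^ 2) + g x)) := by
    unfold Ex gauss
    rw [ENNReal.ofReal_tsum_of_nonneg (fun _ => (Real.exp_pos _).le) hsum, ← ENNReal.tsum_mul_left]
    refine tsum_congr fun x => ?_
    rw [PMF.normalize_apply, Real.exp_add, ENNReal.ofReal_mul (Real.exp_pos _).le]
    unfold gaussWeight
    ring
  rw [e]
  calc _ ≤ (∑' x, gaussWeight s x)⁻¹ * (ENNReal.ofReal c * ∑' x, gaussWeight s x) := by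
        rw [hW, ← ENNReal.ofReal_mul hc]
        exact mul_le_mul_right (ENNReal.ofReal_le_ofReal h) _
    _ = ENNReal.ofReal c := by
        rw [mul_comm (ENNReal.ofReal c), ← mul_assoc, ENNReal.inv_mul_cancel h0 h1, one_mul]

/-- The discrete Gaussian is sub-Gaussian. -/
theorem gauss_mgf (s : ℝ) (hs : 0 < s) (u : ℝ) :
    (Ex (gauss s hs) fun x => ENNReal.ofReal (Real.exp (u * x))) ≤
      ENNReal.ofReal (Real.exp (s ^ 2 * u ^ 2 / 2)) := by
  have ha : 0 < 1 / (2 * Real.pi * s ^ 2) := by positivity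
  have e : ∀ x : ℤ, Real.exp (-((x : ℝ) ^ 2) / (2 * s ^ 2) + u * x) =
      Real.exp (-Real.pi * (1 / (2 * Real.pi * s ^ 2)) * (x : ℝ) ^ 2
        + 2 * Real.pi * (u / (2 * Real.pi)) * x) := by
    intro x; congr 1; field_simp
  have e' : ∀ x : ℤ, Real.exp (-((x : ℝ) ^ 2) / (2 * s ^ 2)) =
      Real.exp (-Real.pi * (1 / (2 * Real.pi * s ^ 2)) * (x : ℝ) ^ 2) := by
    intro x; congr 1; field_simp
  refine Ex_gauss_le s hs _ _ (Real.exp_pos _).le ?_ ?_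
  · simp_rw [e]; exact summable_gauss_lin ha _
  · simp_rw [e, e']
    refine (tsum_gauss_lin_le ha _).trans (le_of_eq ?_)
    congr 2
    field_simp

/-- The tilt `exp(x² / 4s²)` exactly halves the exponent of the Gaussian weight, so the ratio of
sums is that of `tsum_gauss_scale_le`. -/
theorem gauss_exp_sq (s : ℝ) (hs : 0 < s) :
    (Ex (gauss s hs) fun x => ENNReal.ofReal (Real.exp ((x : ℝ) ^ 2 / (4 * s ^ 2)))) ≤
      ENNReal.ofReal √2 := by
  have ha : 0 < 1 / (2 * Real.pi * s ^ 2) := by positivity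
  have e : ∀ x : ℤ, Real.exp (-((x : ℝ) ^ 2) / (2 * s ^ 2) + (x : ℝ) ^ 2 / (4 * s ^ 2)) =
      Real.exp (-Real.pi * (1 / (2 * Real.pi * s ^ 2) / 2) * (x : ℝ) ^ 2) := by
    intro x; congr 1; field_simp; ring
  have e' : ∀ x : ℤ, Real.exp (-((x : ℝ) ^ 2) / (2 * s ^ 2)) =
      Real.exp (-Real.pi * (1 / (2 * Real.pi * s ^ 2)) * (x : ℝ) ^ 2) := by
    intro x; congr 1; field_simp
  refine Ex_gauss_le s hs _ _ (by positivity) ?_ ?_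
  · simp_rw [e]
    have := summable_gauss_lin (half_pos ha) 0
    simpa using this
  · simp_rw [e, e']
    exact tsum_gauss_scale_le ha

/-- Completing the square: `-y² - 2(y + v)v + v² = -(y + v)²`. -/
theorem gauss_mul_exp (s : ℝ) (hs : 0 < s) (y v : ℤ) :
    gauss s hs y * ENNReal.ofReal (Real.exp
      ((-2 * ((y + v : ℤ) : ℝ) * v + (v : ℝ) ^ 2) / (2 * s ^ 2))) = gauss s hs (y + v) := by
  unfold gauss
  rw [PMF.normalize_apply, PMF.normalize_apply, mul_right_comm]
  congr 1
  unfold gaussWeight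
  rw [← ENNReal.ofReal_mul (Real.exp_pos _).le, ← Real.exp_add]
  congr 2
  push_cast
  ring

/-! ### The masking vector -/

namespace Params

variable {pp : Params}

theorem Ex_mask_prod (f : Fin pp.m → Fin pp.d → ℤ → ℝ≥0∞) :
    (Ex pp.mask fun y => ∏ i, ∏ k, f i k (y i k)) =
      ∏ i, ∏ k, Ex (gauss pp.σ pp.σ_pos) (f i k) := by
  unfold mask
  rw [Ex_iid_prod (iid (gauss pp.σ pp.σ_pos) pp.d) pp.m fun i v => ∏ k, f i k (v k)]
  exact Finset.prod_congr rfl fun i _ => Ex_iid_prod _ _ _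

theorem Ex_mask_exp_sum (g : Fin pp.m → Fin pp.d → ℤ → ℝ) :
    (Ex pp.mask fun y => ENNReal.ofReal (Real.exp (∑ i, ∑ k, g i k (y i k)))) =
      ∏ i, ∏ k, Ex (gauss pp.σ pp.σ_pos) fun x => ENNReal.ofReal (Real.exp (g i k x)) := by
  rw [← Ex_mask_prod]
  congr 1; funext y
  rw [Real.exp_sum, ENNReal.ofReal_prod_of_nonneg fun _ _ => (Real.exp_pos _).le]
  refine Finset.prod_congr rfl fun i _ => ?_
  rw [Real.exp_sum, ENNReal.ofReal_prod_of_nonneg fun _ _ => (Real.exp_pos _).le]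

theorem mask_apply (y : Fin pp.m → Fin pp.d → ℤ) :
    pp.mask y = ∏ i, ∏ k, gauss pp.σ pp.σ_pos (y i k) := by
  unfold mask
  rw [iid_apply]
  exact Finset.prod_congr rfl fun i _ => iid_apply _ _ _

theorem mask_mul_exp (y v : Fin pp.m → Fin pp.d → ℤ) :
    pp.mask y * ENNReal.ofReal (Real.exp
      ((-2 * ∑ i, ∑ k, (((y + v) i k : ℤ) : ℝ) * v i k + ∑ i, ∑ k, (v i k : ℝ) ^ 2)
        / (2 * pp.σ ^ 2))) = pp.mask (y + v) := by
  have e : ((-2 * ∑ i, ∑ k, (((y + v) i k : ℤ) : ℝ) * v i k + ∑ i, ∑ k, (v i k : ℝ) ^ 2)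
        / (2 * pp.σ ^ 2)) = ∑ i, ∑ k, ((-2 * ((y i k + v i k : ℤ) : ℝ) * v i k + (v i k : ℝ) ^ 2)
        / (2 * pp.σ ^ 2)) := by
    simp_rw [← Finset.sum_div, Finset.mul_sum, ← Finset.sum_add_distrib]
    congr 1
    refine Finset.sum_congr rfl fun i _ => Finset.sum_congr rfl fun k _ => ?_
    simp only [Pi.add_apply]
    ring
  rw [e, mask_apply, mask_apply, Real.exp_sum,
    ENNReal.ofReal_prod_of_nonneg fun _ _ => (Real.exp_pos _).le, ← Finset.prod_mul_distrib]
  refine Finset.prod_congr rfl fun i _ => ?_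
  rw [Real.exp_sum, ENNReal.ofReal_prod_of_nonneg fun _ _ => (Real.exp_pos _).le,
    ← Finset.prod_mul_distrib]
  exact Finset.prod_congr rfl fun k _ => gauss_mul_exp _ _ _ _

/-- One-sided tail of a linear form of the masking vector. -/
theorem mask_tail_linear (v : Fin pp.m → Fin pp.d → ℤ) (T τ : ℝ) (hT : 0 < T) (hτ : 0 ≤ τ)
    (hv : ∑ i, ∑ k, (v i k : ℝ) ^ 2 ≤ T ^ 2) :
    (Ex pp.mask fun z => ind (τ * T * pp.σ ≤ -∑ i, ∑ k, (z i k : ℝ) * v i k)) ≤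
      ENNReal.ofReal (Real.exp (-τ ^ 2 / 2)) := by
  have hσ := pp.σ_pos
  -- The Chernoff parameter minimising `-θ τ T σ + σ² θ² T² / 2`.
  set θ := τ / (pp.σ * T) with hθ
  have hθ0 : 0 ≤ θ := by positivity
  calc _ ≤ Ex pp.mask fun z => ENNReal.ofReal (Real.exp (-(θ * (τ * T * pp.σ)))) *
        ENNReal.ofReal (Real.exp (∑ i, ∑ k, (-θ * v i k) * (z i k : ℝ))) := by
        refine Ex_mono _ fun z => ?_
        by_cases h : τ * T * pp.σ ≤ -∑ i, ∑ k, (z i k : ℝ) * v i k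
        · rw [ind_of_true h, ← ENNReal.ofReal_mul (Real.exp_pos _).le, ← Real.exp_add,
            ← ENNReal.ofReal_one]
          apply ENNReal.ofReal_le_ofReal
          apply Real.one_le_exp
          have e : ∑ i, ∑ k, (-θ * v i k) * (z i k : ℝ) = θ * -∑ i, ∑ k, (z i k : ℝ) * v i k := by
            rw [← Finset.sum_neg_distrib, Finset.mul_sum]
            refine Finset.sum_congr rfl fun i _ => ?_
            rw [← Finset.sum_neg_distrib, Finset.mul_sum]
            refine Finset.sum_congr rfl fun k _ => ?_
            ring
          rw [e]
          have := mul_le_mul_of_nonneg_left h hθ0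
          linarith
        · rw [ind_of_false h]; exact zero_le
    _ ≤ ENNReal.ofReal (Real.exp (-(θ * (τ * T * pp.σ)))) *
        ∏ i, ∏ k, ENNReal.ofReal (Real.exp (pp.σ ^ 2 * (-θ * v i k) ^ 2 / 2)) := by
        rw [Ex_mul_left, Ex_mask_exp_sum fun i k x => (-θ * v i k) * (x : ℝ)]
        refine mul_le_mul_right (Finset.prod_le_prod' fun i _ => Finset.prod_le_prod' fun k _ => ?_) _
        exact gauss_mgf _ _ _
    _ = ENNReal.ofReal (Real.exp (-(θ * (τ * T * pp.σ)) +
          pp.σ ^ 2 * θ ^ 2 / 2 * ∑ i, ∑ k, (v i k : ℝ) ^ 2)) := by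
        have : ∀ i, ∏ k, ENNReal.ofReal (Real.exp (pp.σ ^ 2 * (-θ * v i k) ^ 2 / 2))
            = ENNReal.ofReal (Real.exp (∑ k, pp.σ ^ 2 * (-θ * v i k) ^ 2 / 2)) := by
          intro i
          rw [Real.exp_sum, ENNReal.ofReal_prod_of_nonneg fun _ _ => (Real.exp_pos _).le]
        simp_rw [this]
        rw [← ENNReal.ofReal_prod_of_nonneg fun _ _ => (Real.exp_pos _).le, ← Real.exp_sum,
          ← ENNReal.ofReal_mul (Real.exp_pos _).le, ← Real.exp_add]
        congr 3
        rw [Finset.mul_sum]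
        refine Finset.sum_congr rfl fun i _ => ?_
        rw [Finset.mul_sum]
        refine Finset.sum_congr rfl fun k _ => ?_
        ring
    _ ≤ _ := by
        apply ENNReal.ofReal_le_ofReal
        rw [Real.exp_le_exp]
        have h1 : θ * (τ * T * pp.σ) = τ ^ 2 := by rw [hθ]; field_simp
        have h2 : pp.σ ^ 2 * θ ^ 2 / 2 * T ^ 2 = τ ^ 2 / 2 := by rw [hθ]; field_simp
        have h3 := mul_le_mul_of_nonneg_left hv (by positivity : 0 ≤ pp.σ ^ 2 * θ ^ 2 / 2)
        rw [h1]
        linarith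

/-- Tail of the Euclidean norm of the masking vector. -/
theorem mask_tail_norm :
    (Ex pp.mask fun z => ind (2 * pp.σ ^ 2 * (pp.m * pp.d) < ∑ i, ∑ k, (z i k : ℝ) ^ 2)) ≤
      ENNReal.ofReal ((√2 * Real.exp (-1 / 2)) ^ (pp.m * pp.d)) := by
  have hσ := pp.σ_pos
  -- Markov's inequality for `exp(‖z‖² / 4σ²)`; at the threshold `2σ² m d` the exponent equals `m d
  -- / 2`, which leaves a factor `√2 exp(-1/2)` per coordinate.
  calc _ ≤ Ex pp.mask fun z => ENNReal.ofReal (Real.exp (-((pp.m * pp.d : ℝ) / 2))) *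
        ENNReal.ofReal (Real.exp (∑ i, ∑ k, (z i k : ℝ) ^ 2 / (4 * pp.σ ^ 2))) := by
        refine Ex_mono _ fun z => ?_
        by_cases h : 2 * pp.σ ^ 2 * (pp.m * pp.d) < ∑ i, ∑ k, (z i k : ℝ) ^ 2
        · rw [ind_of_true h, ← ENNReal.ofReal_mul (Real.exp_pos _).le, ← Real.exp_add,
            ← ENNReal.ofReal_one]
          apply ENNReal.ofReal_le_ofReal
          apply Real.one_le_exp
          simp_rw [← Finset.sum_div]
          have : (pp.m * pp.d : ℝ) / 2 ≤ (∑ i, ∑ k, (z i k : ℝ) ^ 2) / (4 * pp.σ ^ 2) := by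
            rw [le_div_iff₀ (by positivity)]
            linarith
          linarith
        · rw [ind_of_false h]; exact zero_le
    _ ≤ ENNReal.ofReal (Real.exp (-((pp.m * pp.d : ℝ) / 2))) *
        ∏ _i : Fin pp.m, ∏ _k : Fin pp.d, ENNReal.ofReal √2 := by
        rw [Ex_mul_left, Ex_mask_exp_sum fun i k x => (x : ℝ) ^ 2 / (4 * pp.σ ^ 2)]
        refine mul_le_mul_right (Finset.prod_le_prod' fun i _ => Finset.prod_le_prod' fun k _ => ?_) _
        exact gauss_exp_sq _ _
    _ = _ := by
        simp only [Finset.prod_const, Finset.card_univ, Fintype.card_fin]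
        rw [← pow_mul, ← ENNReal.ofReal_pow (by positivity), ← ENNReal.ofReal_mul (Real.exp_pos _).le,
          mul_pow, mul_comm pp.d pp.m, mul_comm, ← Real.exp_nat_mul]
        congr 3
        push_cast
        ring

end Params

end

end PoA

namespace PoA
noncomputable section
namespace Params

/-! ## The ring and its number theoretic transform -/

section ring

variable {pp : Params}

instance : NeZero pp.q := ⟨pp.q_prime.ne_zero⟩

theorem d_pos : 0 < pp.d := by
  obtain ⟨a, ha⟩ := pp.d_two_pow
  rw [ha]; positivity

theorem l_pos : 0 < pp.l := lt_of_lt_of_le (by norm_num) pp.l_ge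

theorem l_mul_n : pp.l * pp.n = pp.d := Nat.mul_div_cancel' pp.l_dvd_d

theorem n_pos : 0 < pp.n := Nat.div_pos (Nat.le_of_dvd d_pos pp.l_dvd_d) l_pos

theorem n_le_d : pp.n ≤ pp.d := Nat.div_le_self _ _

/-- By Fermat, the order `2l` of `ζ` divides `q - 1`. Hence `2l < q`, which makes `l` invertible
modulo `q` and later absorbs a factor `l` in the error. -/
theorem two_l_dvd : 2 * pp.l ∣ pp.q - 1 := by
  rw [← pp.ζ_prim.pow_eq_one_iff_dvd]
  exact ZMod.pow_card_sub_one_eq_one (pp.ζ_prim.ne_zero (by have := l_pos (pp := pp); omega))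

theorem two_l_lt_q : 2 * pp.l < pp.q := by
  have h1 := pp.q_prime.two_le
  have h2 := Nat.le_of_dvd (by omega) (two_l_dvd (pp := pp))
  omega

theorem l_ne_zero : (pp.l : pp.W) ≠ 0 := by
  rw [Ne, ZMod.natCast_eq_zero_iff]
  intro h
  have := Nat.le_of_dvd l_pos h
  have := two_l_lt_q (pp := pp)
  omega

theorem ζ_ne_zero : pp.ζ ≠ 0 := pp.ζ_prim.ne_zero (by have := l_pos (pp := pp); omega)

theorem ζ_pow_l : pp.ζ ^ pp.l = -1 := by
  have h1 : (pp.ζ ^ pp.l) ^ 2 = 1 := by rw [← pow_mul, mul_comm, pp.ζ_prim.pow_eq_one]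
  rcases (sq_eq_sq_iff_eq_or_eq_neg.1 (h1.trans (one_pow 2).symm)) with h | h
  · have := Nat.le_of_dvd l_pos ((pp.ζ_prim.pow_eq_one_iff_dvd _).1 h)
    have := l_pos (pp := pp)
    omega
  · exact h

variable (pp) in
theorem modulus_degree : pp.modulus.degree = pp.d := by
  rw [Polynomial.degree_X_pow_add_C d_pos]

theorem mk_rep (a : pp.Rq) : AdjoinRoot.mk _ (rep a) = a :=
  AdjoinRoot.mk_leftInverse pp.modulus_monic a

theorem rep_degree (a : pp.Rq) : (rep a).degree < (pp.d : WithBot ℕ) := by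
  have h : rep a = rep a %ₘ pp.modulus := by
    conv_lhs => rw [← mk_rep a]
    exact AdjoinRoot.modByMonicHom_mk _ _
  rw [h, ← modulus_degree pp]
  exact Polynomial.degree_modByMonic_lt _ pp.modulus_monic

theorem sum_C_mul_X_pow_degree (v : Fin pp.d → pp.W) :
    (∑ k : Fin pp.d, Polynomial.C (v k) * Polynomial.X ^ (k : ℕ)).degree < (pp.d : WithBot ℕ) := by
  refine (Polynomial.degree_sum_le _ _).trans_lt ?_
  refine (Finset.sup_lt_iff (WithBot.bot_lt_coe pp.d)).2 ?_
  intro k _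
  refine (Polynomial.degree_C_mul_X_pow_le _ _).trans_lt ?_
  exact WithBot.coe_lt_coe.2 k.2

theorem rep_ofCoef (v : Fin pp.d → pp.W) :
    rep (ofCoef v) = ∑ k : Fin pp.d, Polynomial.C (v k) * Polynomial.X ^ (k : ℕ) := by
  unfold rep ofCoef
  rw [AdjoinRoot.modByMonicHom_mk, Polynomial.modByMonic_eq_self_iff pp.modulus_monic,
    modulus_degree]
  exact sum_C_mul_X_pow_degree v

theorem coef_ofCoef (v : Fin pp.d → pp.W) : coef (ofCoef v) = v := by
  funext k
  unfold coef
  rw [rep_ofCoef, Polynomial.finsetSum_coeff]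
  simp only [Polynomial.coeff_C_mul_X_pow]
  rw [Finset.sum_eq_single k]
  · simp
  · intro b _ hb
    rw [if_neg]
    intro h
    exact hb (Fin.ext h.symm)
  · simp

theorem rep_eq_sum (a : pp.Rq) :
    rep a = ∑ k : Fin pp.d, Polynomial.C (coef a k) * Polynomial.X ^ (k : ℕ) := by
  ext i
  rw [Polynomial.finsetSum_coeff]
  simp only [Polynomial.coeff_C_mul_X_pow]
  by_cases hi : i < pp.d
  · rw [Finset.sum_eq_single ⟨i, hi⟩]
    · simp [coef]
    · intro b _ hb
      rw [if_neg]
      intro h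
      exact hb (Fin.ext h.symm)
    · simp
  · rw [Polynomial.coeff_eq_zero_of_degree_lt
      ((rep_degree a).trans_le (by exact_mod_cast not_lt.1 hi)), Finset.sum_eq_zero]
    intro k _
    rw [if_neg]
    have := k.2
    omega

theorem ofCoef_coef (a : pp.Rq) : ofCoef (coef a) = a := by
  conv_rhs => rw [← mk_rep a, rep_eq_sum a]
  rfl

variable (pp) in
/-- Coefficients, as a linear equivalence. -/
def coefEquiv : pp.Rq ≃ₗ[pp.W] (Fin pp.d → pp.W) where
  toFun := coef
  invFun := ofCoef
  left_inv := ofCoef_coef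
  right_inv := coef_ofCoef
  map_add' a b := by
    funext k
    simp [coef, rep]
  map_smul' c a := by
    funext k
    simp [coef, rep]

instance : Fintype pp.Rq := Fintype.ofEquiv _ (coefEquiv pp).symm.toEquiv

theorem coef_add (a b : pp.Rq) : coef (a + b) = coef a + coef b := map_add (coefEquiv pp) a b

theorem coef_sub (a b : pp.Rq) : coef (a - b) = coef a - coef b := map_sub (coefEquiv pp) a b

theorem coef_zero : coef (0 : pp.Rq) = 0 := map_zero (coefEquiv pp)

theorem coef_smul (c : pp.W) (a : pp.Rq) : coef (c • a) = c • coef a :=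
  map_smul (coefEquiv pp) c a

theorem coef_injective : Function.Injective (coef : pp.Rq → _) := (coefEquiv pp).injective

theorem ofCoef_add (v w : Fin pp.d → pp.W) : ofCoef (v + w) = ofCoef v + ofCoef w :=
  map_add (coefEquiv pp).symm v w

theorem ofInt_add (v w : Fin pp.d → ℤ) :
    (ofInt fun k => v k + w k : pp.Rq) = ofInt v + ofInt w := by
  unfold ofInt
  rw [← ofCoef_add]
  congr 1; funext k
  simp

theorem ofInt_lift (a : pp.Rq) : ofInt (lift a) = a := by
  unfold ofInt lift
  simp only [ZMod.coe_valMinAbs]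
  exact ofCoef_coef a

theorem eq_sum_root (a : pp.Rq) :
    a = ∑ k : Fin pp.d, coef a k • AdjoinRoot.root pp.modulus ^ (k : ℕ) := by
  conv_lhs => rw [← ofCoef_coef a]
  unfold ofCoef
  rw [map_sum]
  refine Finset.sum_congr rfl fun k _ => ?_
  rw [map_mul, map_pow, AdjoinRoot.mk_X, AdjoinRoot.mk_C, Algebra.smul_def]
  rfl

variable (pp) in
/-- Positions `i + n s` of coefficients, indexed by `(s, i)`. -/
def posEquiv : Fin pp.l × Fin pp.n ≃ Fin pp.d :=
  finProdFinEquiv.trans (finCongr l_mul_n)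

theorem posEquiv_val (s : Fin pp.l) (i : Fin pp.n) :
    (posEquiv pp (s, i) : ℕ) = i + pp.n * s := rfl

theorem sum_pos {M : Type*} [AddCommMonoid M] (f : Fin pp.d → M) :
    ∑ k, f k = ∑ s, ∑ i, f (posEquiv pp (s, i)) := by
  rw [← (posEquiv pp).sum_comp, Fintype.sum_prod_type]

variable (pp) in
/-- The constants of the slot moduli. -/
def ξ (j : Fin pp.l) : pp.W := pp.ζ ^ (2 * (j : ℕ) + 1)

theorem ξ_ne_zero (j : Fin pp.l) : pp.ξ j ≠ 0 := pow_ne_zero _ ζ_ne_zero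

theorem ξ_pow_l (j : Fin pp.l) : pp.ξ j ^ pp.l = -1 := by
  unfold ξ
  rw [← pow_mul, mul_comm, pow_mul, ζ_pow_l]
  exact Odd.neg_one_pow ⟨j, rfl⟩

variable (pp) in
/-- The modulus of a slot. -/
abbrev slotMod (j : Fin pp.l) : Polynomial (ZMod pp.q) :=
  Polynomial.X ^ pp.n - Polynomial.C (pp.ζ ^ (2 * (j : ℕ) + 1))

instance (j : Fin pp.l) : Fact (Irreducible (pp.slotMod j)) :=
  ⟨pp.slot_irreducible j j.2⟩

theorem slotMod_monic (j : Fin pp.l) : (pp.slotMod j).Monic :=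
  Polynomial.monic_X_pow_sub_C _ n_pos.ne'

variable (pp) in
/-- The field in which a slot lives. -/
abbrev SlotField (j : Fin pp.l) : Type := AdjoinRoot (pp.slotMod j)

theorem slot_root_pow (j : Fin pp.l) :
    AdjoinRoot.root (pp.slotMod j) ^ pp.n = algebraMap pp.W _ (pp.ξ j) := by
  have h : AdjoinRoot.mk (pp.slotMod j) (pp.slotMod j) = 0 := AdjoinRoot.mk_self
  rw [map_sub, map_pow, AdjoinRoot.mk_X, AdjoinRoot.mk_C, sub_eq_zero] at h
  exact h

/-- Reduction to a slot. -/
def slot (j : Fin pp.l) : pp.Rq →ₐ[pp.W] pp.SlotField j :=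
  AdjoinRoot.liftAlgHom pp.modulus (Algebra.ofId _ _) (AdjoinRoot.root (pp.slotMod j)) (by
    -- The map is well defined because the slot root satisfies `X ^ d = ξ_j ^ l = -1`, the exponent
    -- `2j + 1` being odd.
    have h : AdjoinRoot.root (pp.slotMod j) ^ pp.d = -1 := by
      rw [← l_mul_n, mul_comm, pow_mul, slot_root_pow, ← map_pow, ξ_pow_l, map_neg, map_one]
    simp [h])

theorem slot_mk (j : Fin pp.l) (f : Polynomial (ZMod pp.q)) :
    slot j (AdjoinRoot.mk _ f) = AdjoinRoot.mk _ f := by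
  have h : slot j (AdjoinRoot.root pp.modulus) = AdjoinRoot.root _ :=
    AdjoinRoot.liftAlgHom_root _ _ _ _
  rw [← AdjoinRoot.aeval_eq, ← Polynomial.aeval_algHom_apply, h, AdjoinRoot.aeval_eq]

end ring
end Params
end
end PoA

namespace PoA
noncomputable section
namespace Params

/-! ### The NTT as a discrete Fourier transform, units of the ring, and bit vectors -/

section ntt

variable {pp : Params}

/-- Ties the polynomial remainders to an algebra homomorphism into a field, so that multiplicativity
becomes available. -/
theorem ntt_eq_coeff (a : pp.Rq) (j : Fin pp.l) (i : Fin pp.n) :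
    ntt a j i = (AdjoinRoot.modByMonicHom (slotMod_monic j) (slot j a)).coeff i := by
  conv_rhs => rw [← mk_rep a, slot_mk, AdjoinRoot.modByMonicHom_mk]
  rfl

theorem slot_eq_ntt (a : pp.Rq) (j : Fin pp.l) :
    slot j a = ∑ i : Fin pp.n, ntt a j i • AdjoinRoot.root (pp.slotMod j) ^ (i : ℕ) := by
  have hg := slotMod_monic j
  have h : ∑ i : Fin pp.n, Polynomial.monomial (i : ℕ) (ntt a j i) = rep a %ₘ pp.slotMod j := by
    refine Polynomial.sum_modByMonic_coeff hg ?_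
    rw [Polynomial.degree_X_pow_sub_C n_pos]
  have h2 : slot j a = AdjoinRoot.mk _ (rep a %ₘ pp.slotMod j) := by
    conv_lhs => rw [← mk_rep a, slot_mk]
    rw [← AdjoinRoot.modByMonicHom_mk hg]
    exact (AdjoinRoot.mk_leftInverse hg _).symm
  rw [h2, ← h, map_sum]
  refine Finset.sum_congr rfl fun i _ => ?_
  rw [← Polynomial.C_mul_X_pow_eq_monomial, map_mul, map_pow, AdjoinRoot.mk_X, AdjoinRoot.mk_C,
    Algebra.smul_def]
  rfl

theorem slot_eq_coef (a : pp.Rq) (j : Fin pp.l) :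
    slot j a = ∑ i : Fin pp.n, (∑ s : Fin pp.l, coef a (posEquiv pp (s, i)) * pp.ξ j ^ (s : ℕ)) •
      AdjoinRoot.root (pp.slotMod j) ^ (i : ℕ) := by
  conv_lhs => rw [eq_sum_root a, map_sum, sum_pos, Finset.sum_comm]
  refine Finset.sum_congr rfl fun i _ => ?_
  rw [Finset.sum_smul]
  refine Finset.sum_congr rfl fun s _ => ?_
  have h : slot j (AdjoinRoot.root pp.modulus) = AdjoinRoot.root _ :=
    AdjoinRoot.liftAlgHom_root _ _ _ _
  rw [map_smul, map_pow, h, posEquiv_val, pow_add, pow_mul, slot_root_pow, ← map_pow, mul_comm,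
    ← Algebra.smul_def, smul_smul]

theorem coeff_modByMonicHom_sum (j : Fin pp.l) (w : Fin pp.n → pp.W) (i : Fin pp.n) :
    (AdjoinRoot.modByMonicHom (slotMod_monic j)
      (∑ i : Fin pp.n, w i • AdjoinRoot.root (pp.slotMod j) ^ (i : ℕ))).coeff i = w i := by
  have h : ∑ i : Fin pp.n, w i • AdjoinRoot.root (pp.slotMod j) ^ (i : ℕ) =
      AdjoinRoot.mk _ (∑ i : Fin pp.n, Polynomial.C (w i) * Polynomial.X ^ (i : ℕ)) := by
    rw [map_sum]
    refine Finset.sum_congr rfl fun i _ => ?_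
    rw [map_mul, map_pow, AdjoinRoot.mk_X, AdjoinRoot.mk_C, Algebra.smul_def]
    rfl
  have hd : (∑ i : Fin pp.n, Polynomial.C (w i) * Polynomial.X ^ (i : ℕ)).degree
      < (pp.slotMod j).degree := by
    rw [Polynomial.degree_X_pow_sub_C n_pos]
    refine (Polynomial.degree_sum_le _ _).trans_lt ?_
    refine (Finset.sup_lt_iff (WithBot.bot_lt_coe pp.n)).2 ?_
    intro k _
    refine (Polynomial.degree_C_mul_X_pow_le _ _).trans_lt ?_
    exact WithBot.coe_lt_coe.2 k.2
  rw [h, AdjoinRoot.modByMonicHom_mk,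
    (Polynomial.modByMonic_eq_self_iff (slotMod_monic j)).2 hd, Polynomial.finsetSum_coeff]
  simp only [Polynomial.coeff_C_mul_X_pow]
  rw [Finset.sum_eq_single i]
  · simp
  · intro b _ hb
    rw [if_neg]
    intro h
    exact hb (Fin.ext h.symm)
  · simp

/-- Since the slot root to the power `n` is `ξ_j`, the coefficients at positions congruent to `i`
modulo `n` alone determine entry `i` of every slot. The inversion formula and the independence of
the slot entries of a challenge both rest on this. -/
theorem ntt_eq_coef (a : pp.Rq) (j : Fin pp.l) (i : Fin pp.n) :
    ntt a j i = ∑ s : Fin pp.l, coef a (posEquiv pp (s, i)) * pp.ξ j ^ (s : ℕ) := by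
  rw [ntt_eq_coeff, slot_eq_coef, coeff_modByMonicHom_sum]

theorem slot_eq_zero_iff (a : pp.Rq) (j : Fin pp.l) : slot j a = 0 ↔ ntt a j = 0 := by
  constructor
  · intro h
    funext i
    rw [ntt_eq_coeff, h]
    simp
  · intro h
    rw [slot_eq_ntt, h]
    simp

variable (pp) in
/-- The transform as a linear map. -/
def nttL : pp.Rq →ₗ[pp.W] Slots pp where
  toFun := ntt
  map_add' a b := by
    funext j i
    simp [ntt_eq_coeff]
  map_smul' c a := by
    funext j i
    simp [ntt_eq_coeff]

/-- Orthogonality of characters: up to a constant the summand is `w ^ j` with `w = ζ ^ (2(t - s))`,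
an `l`-th root of unity different from `1` when `s ≠ t`, so the geometric sum vanishes. -/
theorem sum_ξ_pow (s t : Fin pp.l) :
    ∑ j : Fin pp.l, (pp.ξ j)⁻¹ ^ (s : ℕ) * pp.ξ j ^ (t : ℕ) = if s = t then (pp.l : pp.W) else 0 := by
  split_ifs with h
  · subst h
    have : ∀ j : Fin pp.l, (pp.ξ j)⁻¹ ^ (s : ℕ) * pp.ξ j ^ (s : ℕ) = 1 := by
      intro j
      rw [← mul_pow, inv_mul_cancel₀ (ξ_ne_zero j), one_pow]
    rw [Finset.sum_congr rfl fun j _ => this j]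
    simp
  · have hζ := ζ_ne_zero (pp := pp)
    set w : pp.W := (pp.ζ⁻¹ ^ (2 * (s : ℕ))) * pp.ζ ^ (2 * (t : ℕ)) with hw
    have e : ∀ j : Fin pp.l, (pp.ξ j)⁻¹ ^ (s : ℕ) * pp.ξ j ^ (t : ℕ) =
        (pp.ζ⁻¹ ^ (s : ℕ) * pp.ζ ^ (t : ℕ)) * w ^ (j : ℕ) := by
      intro j
      rw [hw]
      unfold ξ
      simp only [← inv_pow, ← pow_mul, mul_pow]
      ring
    simp_rw [e, ← Finset.mul_sum]
    rw [Fin.sum_univ_eq_sum_range (fun j => w ^ j)]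
    have hw1 : w ≠ 1 := by
      intro h1
      have h2 : pp.ζ ^ (2 * (t : ℕ)) = pp.ζ ^ (2 * (s : ℕ)) := by
        have h3 : pp.ζ ^ (2 * (s : ℕ)) * w = pp.ζ ^ (2 * (t : ℕ)) := by
          rw [hw, ← mul_assoc, ← mul_pow, mul_inv_cancel₀ hζ, one_pow, one_mul]
        rw [← h3, h1, mul_one]
      have := pp.ζ_prim.pow_inj (by omega) (by omega) h2
      apply h
      apply Fin.ext
      omega
    have hwl : w ^ pp.l = 1 := by
      have hz : ∀ t : ℕ, (pp.ζ ^ (2 * t)) ^ pp.l = 1 := by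
        intro t
        rw [← pow_mul, mul_right_comm, pow_mul, pp.ζ_prim.pow_eq_one, one_pow]
      rw [hw, mul_pow, inv_pow, inv_pow, hz, hz, inv_one, one_mul]
    have := mul_geom_sum w pp.l
    rw [hwl, sub_self] at this
    rcases mul_eq_zero.1 this with h3 | h3
    · exact absurd (sub_eq_zero.1 h3) hw1
    · rw [h3, mul_zero]

theorem sum_ξ_inv_ntt (a : pp.Rq) (s : Fin pp.l) (i : Fin pp.n) :
    ∑ j : Fin pp.l, (pp.ξ j)⁻¹ ^ (s : ℕ) * ntt a j i = pp.l * coef a (posEquiv pp (s, i)) := by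
  simp_rw [ntt_eq_coef, Finset.mul_sum]
  rw [Finset.sum_comm]
  have e : ∀ t : Fin pp.l, ∑ j : Fin pp.l,
      (pp.ξ j)⁻¹ ^ (s : ℕ) * (coef a (posEquiv pp (t, i)) * pp.ξ j ^ (t : ℕ)) =
      coef a (posEquiv pp (t, i)) * if s = t then (pp.l : pp.W) else 0 := by
    intro t
    rw [← sum_ξ_pow, Finset.mul_sum]
    refine Finset.sum_congr rfl fun j _ => ?_
    ring
  simp_rw [e]
  simp [mul_comm]

theorem ntt_injective : Function.Injective (ntt : pp.Rq → Slots pp) := by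
  change Function.Injective (nttL pp)
  rw [injective_iff_map_eq_zero]
  intro a ha
  apply coef_injective
  rw [coef_zero]
  funext k
  obtain ⟨⟨s, i⟩, rfl⟩ := (posEquiv pp).surjective k
  have h := sum_ξ_inv_ntt a s i
  have h0 : ∀ j i, ntt a j i = 0 := fun j i => congrFun (congrFun ha j) i
  simp only [h0, mul_zero, Finset.sum_const_zero] at h
  exact ((mul_eq_zero.1 h.symm).resolve_left l_ne_zero)

/-- `invNtt` is defined through `Function.invFun` and is meaningful only because of this.
Injectivity is the inversion formula; surjectivity follows by counting, as `l n = d`. -/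
theorem ntt_bijective : Function.Bijective (ntt : pp.Rq → Slots pp) := by
  refine (Fintype.bijective_iff_injective_and_card _).2 ⟨ntt_injective, ?_⟩
  rw [Fintype.card_congr (coefEquiv pp).toEquiv]
  simp only [Fintype.card_fun, Fintype.card_fin, ZMod.card]
  rw [← pow_mul, mul_comm, l_mul_n]

theorem ntt_invNtt (v : Slots pp) : ntt (invNtt v) = v :=
  Function.rightInverse_invFun ntt_bijective.2 v

variable (pp) in
/-- The inverse transform as a linear map. -/
def invNttL : Slots pp →ₗ[pp.W] pp.Rq where
  toFun := invNtt
  map_add' v w := ntt_injective (by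
    rw [ntt_invNtt]
    exact (((nttL pp).map_add _ _).trans (congrArg₂ _ (ntt_invNtt v) (ntt_invNtt w))).symm)
  map_smul' c v := ntt_injective (by
    rw [ntt_invNtt]
    exact (((nttL pp).map_smul _ _).trans (congrArg _ (ntt_invNtt v))).symm)

theorem slot_ext {a b : pp.Rq} (h : ∀ j, slot j a = slot j b) : a = b := by
  apply ntt_injective
  funext j i
  rw [ntt_eq_coeff, ntt_eq_coeff, h]

/-- The case `s = 0` of the inversion formula. The head of a ring element is the sum of its slots up
to the unit `l`, so the verifier's check on `h` is a statement about a sum over slots. -/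
theorem sum_ntt (a : pp.Rq) (k : Fin pp.d) (hk : (k : ℕ) < pp.n) :
    ∑ j, ntt a j ⟨k, hk⟩ = pp.l * coef a k := by
  have h := sum_ξ_inv_ntt a ⟨0, l_pos⟩ ⟨k, hk⟩
  simp only [pow_zero, one_mul] at h
  rw [h]
  congr 2

theorem card_slotField (j : Fin pp.l) : Nat.card (pp.SlotField j) = pp.q ^ pp.n := by
  have e := (AdjoinRoot.powerBasis' (slotMod_monic j)).basis.equivFun
  rw [Nat.card_congr e.toEquiv]
  simp

instance (j : Fin pp.l) : Finite (pp.SlotField j) :=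
  Nat.finite_of_card_ne_zero (by
    rw [card_slotField]; exact pow_ne_zero _ pp.q_prime.ne_zero)

/-- An element with nonzero slots has order dividing `q ^ n - 1`. -/
theorem pow_eq_one_of_slots (a : pp.Rq) (h : ∀ j, slot j a ≠ 0) : a ^ (pp.q ^ pp.n - 1) = 1 := by
  apply slot_ext
  intro j
  rw [map_pow, map_one, ← card_slotField j]
  have := Fintype.ofFinite (pp.SlotField j)
  rw [Nat.card_eq_fintype_card]
  exact FiniteField.pow_card_sub_one_eq_one _ (h j)

theorem two_le_q_pow : 2 ≤ pp.q ^ pp.n :=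
  pp.q_prime.two_le.trans (Nat.le_self_pow n_pos.ne' _)

variable (pp) in
/-- The exponent that inverts invertible ring elements. -/
def invExp : ℕ := pp.q ^ pp.n - 2

/-- The inverse is an explicit power, so that a circuit can compute it by repeated squaring. -/
theorem mul_pow_invExp (a : pp.Rq) (h : ∀ j, slot j a ≠ 0) : a * a ^ pp.invExp = 1 := by
  rw [← pow_succ', ← pow_eq_one_of_slots a h]
  congr 1
  have := two_le_q_pow (pp := pp)
  unfold invExp
  omega

theorem isUnit_iff_slots (a : pp.Rq) : IsUnit a ↔ ∀ j, slot j a ≠ 0 := by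
  constructor
  · intro h j
    exact (h.map (slot j)).ne_zero
  · intro h
    exact IsUnit.of_mul_eq_one _ (mul_pow_invExp a h)

/-- Slots of elements whose transform is constant in every slot. -/
theorem slot_of_const (a : pp.Rq) (j : Fin pp.l) (c : pp.W)
    (h : ∀ i, ntt a j i = if (i : ℕ) = 0 then c else 0) : slot j a = algebraMap pp.W _ c := by
  rw [slot_eq_ntt, Finset.sum_eq_single ⟨0, n_pos⟩]
  · rw [h, if_pos rfl, Fin.val_mk, pow_zero, Algebra.algebraMap_eq_smul_one]
  · intro i _ hi
    rw [h, if_neg, zero_smul]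
    intro h0
    exact hi (Fin.ext h0)
  · simp

theorem ntt_mul_const (a b : pp.Rq) (j : Fin pp.l) (c : pp.W)
    (h : slot j b = algebraMap pp.W _ c) (i : Fin pp.n) : ntt (a * b) j i = ntt a j i * c := by
  rw [ntt_eq_coeff, ntt_eq_coeff, map_mul, h, mul_comm, ← Algebra.smul_def, map_smul,
    Polynomial.coeff_smul, smul_eq_mul, mul_comm]

/-! ### Bits -/

/-- The `j`-th bit of an integer, as a word. -/
def bitW (pp : Params) (v j : ℕ) : pp.W := if j < 64 ∧ v.testBit j then 1 else 0

theorem slot_bits (v : ℕ) (j : Fin pp.l) :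
    slot j (bits v : pp.Rq) = algebraMap pp.W _ (bitW pp v j) := by
  apply slot_of_const
  intro i
  unfold bits bitW
  rw [ntt_invNtt]
  by_cases hi : (i : ℕ) = 0 <;> simp [hi]

theorem bits_mul_self (v : ℕ) : (bits v : pp.Rq) * bits v = bits v := by
  apply slot_ext
  intro j
  rw [map_mul, slot_bits, ← map_mul]
  unfold bitW
  split_ifs <;> simp

theorem sum_testBit (v k : ℕ) :
    ∑ j ∈ Finset.range k, (if v.testBit j then 2 ^ j else 0) = v % 2 ^ k := by
  induction k with
  | zero => simp [Nat.mod_one]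
  | succ k ih =>
    rw [Finset.sum_range_succ, ih, Nat.mod_pow_succ, Nat.testBit_eq_decide_div_mod_eq]
    rcases Nat.mod_two_eq_zero_or_one (v / 2 ^ k) with h | h <;> simp [h]

theorem sum_Q_mul (k : Fin pp.l) (b : ℕ → pp.W) :
    ∑ j, Q pp k j * b j = ∑ j ∈ Finset.range 64, 2 ^ j * b j := by
  unfold Q
  rw [Fin.sum_univ_eq_sum_range (fun j => (if j < 64 then (2 : pp.W) ^ j else 0) * b j),
    ← Finset.sum_subset (Finset.range_subset_range.2 pp.l_ge)]
  · refine Finset.sum_congr rfl fun j hj => ?_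
    rw [if_pos (Finset.mem_range.1 hj)]
  · intro j _ hj
    rw [if_neg (by simpa using hj), zero_mul]

theorem sum_Q_bitW (k : Fin pp.l) (v : ℕ) (hv : v < 2 ^ 64) :
    ∑ j, Q pp k j * bitW pp v j = v := by
  have h := congrArg (Nat.cast : ℕ → pp.W) ((sum_testBit v 64).trans (Nat.mod_eq_of_lt hv))
  rw [sum_Q_mul, ← h]
  push_cast
  refine Finset.sum_congr rfl fun j hj => ?_
  unfold bitW
  have := Finset.mem_range.1 hj
  by_cases h : v.testBit j <;> simp [h, this]

/-- The coefficientwise sum of the slots of `Qᵀ φ · b - φ · w`, for slotwise constant `b`. -/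
theorem sum_ntt_QT (φ : Slots pp) (b m : pp.Rq) (c : ℕ → pp.W)
    (hb : ∀ j : Fin pp.l, slot j b = algebraMap pp.W _ (c j)) (i : Fin pp.n) :
    ∑ j, ntt (invNtt (QT φ) * b - invNtt φ * m) j i =
      ∑ k, ntt (invNtt φ * (algebraMap pp.W pp.Rq (∑ j ∈ Finset.range 64, 2 ^ j * c j) - m)) k i := by
  have e1 : ∀ a b : pp.Rq, ntt (a - b) = ntt a - ntt b := (nttL pp).map_sub
  simp_rw [mul_sub, e1, Pi.sub_apply, Finset.sum_sub_distrib]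
  congr 1
  have h1 : ∀ j : Fin pp.l, ntt (invNtt (QT φ) * b) j i = QT φ j i * c j := by
    intro j
    rw [ntt_mul_const _ _ _ _ (hb j), ntt_invNtt]
  have h2 : ∀ k : Fin pp.l, ntt (invNtt φ * algebraMap pp.W pp.Rq
      (∑ j ∈ Finset.range 64, 2 ^ j * c j)) k i = φ k i * ∑ j, Q pp k j * c j := by
    intro k
    rw [ntt_mul_const _ _ _ _ ((slot k).commutes _), ntt_invNtt, sum_Q_mul]
  simp_rw [h1, h2, QT, Finset.sum_mul, Finset.mul_sum]
  -- Exchanging the sums is the adjunction `⟨Qᵀ φ, c⟩ = ⟨φ, Q c⟩`.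
  rw [Finset.sum_comm]
  refine Finset.sum_congr rfl fun j _ => Finset.sum_congr rfl fun k _ => ?_
  ring

/-- Recombining the bits of `v` returns `v` in every slot, so the sum over the slots is zero. This
is what lets the honest `h` inherit the vanishing head of `g`. -/
theorem coef_proof_vanish (φ : Slots pp) (v : ℕ) (hv : v < 2 ^ 64) (k : Fin pp.d)
    (hk : (k : ℕ) < pp.n) :
    coef (invNtt (QT φ) * bits v - invNtt φ * (v : pp.Rq)) k = 0 := by
  have h := sum_ntt_QT φ (bits v) (v : pp.Rq) (bitW pp v) (slot_bits v) ⟨k, hk⟩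
  rw [sum_ntt] at h
  have h2 : algebraMap pp.W pp.Rq (∑ j ∈ Finset.range 64, 2 ^ j * bitW pp v j) - (v : pp.Rq) = 0 := by
    rw [← sum_Q_mul ⟨0, l_pos⟩, sum_Q_bitW _ v hv, map_natCast, sub_self]
  rw [h2, mul_zero] at h
  have h0 : ∀ k i, ntt (0 : pp.Rq) k i = 0 := by
    intro k i
    exact congrFun (congrFun (map_zero (nttL pp)) k) i
  simp only [h0, Finset.sum_const_zero] at h
  exact (mul_eq_zero.1 h).resolve_left l_ne_zero

end ntt
end Params
end
end PoA

namespace PoA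
noncomputable section
namespace Params

/-! ## Norms -/

section norms

variable {pp : Params}

/-- The centred representative has least absolute value in its residue class. Coefficient bounds
thereby reduce to exhibiting some integer representative. -/
theorem abs_lift_le {a : pp.Rq} {k : Fin pp.d} {x : ℤ} (h : (x : pp.W) = coef a k) :
    |lift a k| ≤ |x| := by
  rw [Int.abs_eq_natAbs, Int.abs_eq_natAbs]
  have := ZMod.natAbs_min_of_le_div_two pp.q (lift a k) x
    (by rw [h]; exact ZMod.coe_valMinAbs _) (ZMod.natAbs_valMinAbs_le _)
  exact_mod_cast this

theorem abs_lift_ofInt_le (v : Fin pp.d → ℤ) (k : Fin pp.d) : |lift (ofInt v : pp.Rq) k| ≤ |v k| :=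
  abs_lift_le (by unfold ofInt; rw [coef_ofCoef])

theorem coe_lift (a : pp.Rq) (k : Fin pp.d) : (lift a k : pp.W) = coef a k :=
  ZMod.coe_valMinAbs _

theorem abs_lift_add_le (a b : pp.Rq) (k : Fin pp.d) :
    |lift (a + b) k| ≤ |lift a k| + |lift b k| := by
  refine (abs_lift_le (x := lift a k + lift b k) ?_).trans (abs_add_le _ _)
  push_cast
  rw [coe_lift, coe_lift, coef_add]
  rfl

theorem abs_lift_sub_le (a b : pp.Rq) (k : Fin pp.d) :
    |lift (a - b) k| ≤ |lift a k| + |lift b k| := by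
  refine (abs_lift_le (x := lift a k - lift b k) ?_).trans (abs_sub _ _)
  push_cast
  rw [coe_lift, coe_lift, coef_sub]
  rfl

theorem abs_lift_zsmul_le (z : ℤ) (a : pp.Rq) (k : Fin pp.d) :
    |lift (z • a) k| ≤ |z| * |lift a k| := by
  rw [← abs_mul]
  refine abs_lift_le ?_
  push_cast
  rw [coe_lift, ← Int.cast_smul_eq_zsmul pp.W, coef_smul]
  rfl

/-- Provides access to Minkowski's inequality in a Euclidean space; absolute values are taken
entrywise because centred lifts are only subadditive in absolute value. -/
theorem norm2_eq {r : ℕ} (a : Fin r → pp.Rq) :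
    norm2 a = ‖WithLp.toLp 2 fun p : Fin r × Fin pp.d => |(lift (a p.1) p.2 : ℝ)|‖ := by
  rw [EuclideanSpace.norm_eq, Fintype.sum_prod_type]
  simp [norm2]

theorem norm2_nonneg {r : ℕ} (a : Fin r → pp.Rq) : 0 ≤ norm2 a := Real.sqrt_nonneg _

theorem norm2_le_sqrt {r : ℕ} (a : Fin r → pp.Rq) (g : Fin r → Fin pp.d → ℝ)
    (h : ∀ i k, |(lift (a i) k : ℝ)| ≤ |g i k|) : norm2 a ≤ √(∑ i, ∑ k, g i k ^ 2) :=
  Real.sqrt_le_sqrt (Finset.sum_le_sum fun i _ => Finset.sum_le_sum fun k _ =>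
    sq_le_sq.2 (h i k))

theorem norm2_le_add {r : ℕ} (a b c : Fin r → pp.Rq)
    (h : ∀ i k, |lift (c i) k| ≤ |lift (a i) k| + |lift (b i) k|) :
    norm2 c ≤ norm2 a + norm2 b := by
  rw [norm2_eq a, norm2_eq b]
  refine le_trans ?_ (norm_add_le _ _)
  rw [EuclideanSpace.norm_eq, Fintype.sum_prod_type]
  refine (norm2_le_sqrt c (fun i k => |(lift (a i) k : ℝ)| + |(lift (b i) k : ℝ)|)
    fun i k => ?_).trans (le_of_eq ?_)
  · have := h i k
    rw [abs_of_nonneg (by positivity : 0 ≤ |(lift (a i) k : ℝ)| + |(lift (b i) k : ℝ)|)]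
    exact_mod_cast this
  · simp

theorem norm2_add_le {r : ℕ} (a b : Fin r → pp.Rq) :
    norm2 (fun i => a i + b i) ≤ norm2 a + norm2 b :=
  norm2_le_add _ _ _ fun _ _ => abs_lift_add_le _ _ _

theorem norm2_sub_le {r : ℕ} (a b : Fin r → pp.Rq) :
    norm2 (fun i => a i - b i) ≤ norm2 a + norm2 b :=
  norm2_le_add _ _ _ fun _ _ => abs_lift_sub_le _ _ _

theorem lift_zero (k : Fin pp.d) : lift (0 : pp.Rq) k = 0 := by
  unfold lift
  rw [coef_zero]
  exact ZMod.valMinAbs_zero _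

theorem norm2_zero {r : ℕ} : norm2 (fun _ : Fin r => (0 : pp.Rq)) = 0 := by
  simp [norm2, lift_zero]

theorem norm2_pos {r : ℕ} {a : Fin r → pp.Rq} (h : a ≠ 0) : 0 < norm2 a := by
  rw [norm2, Real.sqrt_pos]
  by_contra hcon
  apply h
  have h0 : ∑ i, ∑ k, (lift (a i) k : ℝ) ^ 2 = 0 :=
    le_antisymm (not_lt.1 hcon) (Finset.sum_nonneg fun i _ => Finset.sum_nonneg fun k _ => sq_nonneg _)
  funext i
  apply coef_injective
  funext k
  have h1 := (Finset.sum_eq_zero_iff_of_nonneg fun i _ =>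
    Finset.sum_nonneg fun k _ => sq_nonneg (lift (a i) k : ℝ)).1 h0 i (Finset.mem_univ i)
  have h2 := (Finset.sum_eq_zero_iff_of_nonneg fun k _ =>
    sq_nonneg (lift (a i) k : ℝ)).1 h1 k (Finset.mem_univ k)
  have h3 : lift (a i) k = 0 := by exact_mod_cast pow_eq_zero_iff (two_ne_zero) |>.1 h2
  rw [← coe_lift, h3, Pi.zero_apply, coef_zero]
  simp

theorem norm2_sum_le {r : ℕ} {ι : Type*} (s : Finset ι) (a : ι → Fin r → pp.Rq) :
    norm2 (fun i => ∑ t ∈ s, a t i) ≤ ∑ t ∈ s, norm2 (a t) := by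
  classical
  induction s using Finset.induction_on with
  | empty => simp [norm2_zero]
  | insert t s ht ih =>
    simp_rw [Finset.sum_insert ht]
    exact (norm2_add_le _ _).trans (by gcongr)

theorem norm2_zsmul_le {r : ℕ} (z : ℤ) (a : Fin r → pp.Rq) :
    norm2 (fun i => z • a i) ≤ |z| * norm2 a := by
  refine (norm2_le_sqrt _ (fun i k => (z : ℝ) * lift (a i) k) fun i k => ?_).trans ?_
  · rw [abs_mul]
    exact_mod_cast abs_lift_zsmul_le z (a i) k
  · simp_rw [mul_pow, ← Finset.mul_sum]
    rw [Real.sqrt_mul (sq_nonneg _), Real.sqrt_sq_eq_abs, norm2]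
    push_cast
    exact le_rfl

/-- Multiplication by `X` shifts the coefficients; the top one wraps around through a multiple of `X
^ d + 1`. -/
theorem rep_root_mul (a : pp.Rq) :
    rep (AdjoinRoot.root pp.modulus * a) =
      Polynomial.X * rep a - Polynomial.C ((rep a).coeff (pp.d - 1)) * pp.modulus := by
  have hd := d_pos (pp := pp)
  set c := (rep a).coeff (pp.d - 1) with hc
  have hdeg : (Polynomial.X * rep a - Polynomial.C c * pp.modulus).degree
      < (pp.d : WithBot ℕ) := by
    rw [Polynomial.degree_lt_iff_coeff_zero]
    intro m hm
    obtain ⟨m, rfl⟩ : ∃ m', m = m' + 1 := ⟨m - 1, by omega⟩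
    rw [Polynomial.coeff_sub, Polynomial.coeff_X_mul, Polynomial.coeff_C_mul,
      Polynomial.coeff_add, Polynomial.coeff_X_pow, Polynomial.coeff_C_succ, add_zero]
    by_cases h : m + 1 = pp.d
    · rw [if_pos h, hc, ← h]; simp
    · rw [if_neg h, mul_zero, sub_zero]
      apply Polynomial.coeff_eq_zero_of_degree_lt
      refine (rep_degree a).trans_le ?_
      exact_mod_cast (by omega : pp.d ≤ m)
  have h1 : AdjoinRoot.root pp.modulus * a = AdjoinRoot.mk _
      (Polynomial.X * rep a - Polynomial.C c * pp.modulus) := by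
    rw [map_sub, map_mul, map_mul, AdjoinRoot.mk_X, mk_rep, AdjoinRoot.mk_self, mul_zero, sub_zero]
  conv_lhs => rw [h1]
  unfold rep
  rw [AdjoinRoot.modByMonicHom_mk, Polynomial.modByMonic_eq_self_iff pp.modulus_monic,
    modulus_degree]
  exact hdeg

/-- A negacyclic shift permutes coefficients up to sign, and negation preserves the absolute value
of the centred representative. -/
theorem sum_sq_lift_root_mul (a : pp.Rq) :
    ∑ k, (lift (AdjoinRoot.root pp.modulus * a) k : ℝ) ^ 2 = ∑ k, (lift a k : ℝ) ^ 2 := by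
  have hd := d_pos (pp := pp)
  set G : pp.Rq → ℕ → ℝ := fun b k => (((rep b).coeff k).valMinAbs : ℝ) ^ 2 with hG
  have e : ∀ b : pp.Rq, ∑ k, (lift b k : ℝ) ^ 2 = ∑ k ∈ Finset.range pp.d, G b k := by
    intro b
    rw [← Fin.sum_univ_eq_sum_range]
    rfl
  rw [e, e]
  obtain ⟨d', hd'⟩ : ∃ d', pp.d = d' + 1 := ⟨pp.d - 1, by omega⟩
  rw [hd', Finset.sum_range_succ', Finset.sum_range_succ]
  have h0 : G (AdjoinRoot.root pp.modulus * a) 0 = G a d' := by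
    simp only [hG]
    rw [rep_root_mul]
    have : (Polynomial.X * rep a - Polynomial.C ((rep a).coeff (pp.d - 1)) * pp.modulus).coeff 0
        = -(rep a).coeff d' := by
      rw [Polynomial.coeff_sub, Polynomial.coeff_X_mul_zero, Polynomial.coeff_C_mul,
        Polynomial.coeff_add, Polynomial.coeff_X_pow, if_neg hd.ne, Polynomial.coeff_C_zero, hd']
      simp
    rw [this, ← sq_abs, ← sq_abs (((rep a).coeff d').valMinAbs : ℝ)]
    congr 1
    have := ZMod.natAbs_valMinAbs_neg ((rep a).coeff d')
    rw [← Int.cast_abs, ← Int.cast_abs, Int.abs_eq_natAbs, Int.abs_eq_natAbs, this]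
  have h1 : ∀ k ∈ Finset.range d', G (AdjoinRoot.root pp.modulus * a) (k + 1) = G a k := by
    intro k hk
    have hk := Finset.mem_range.1 hk
    simp only [hG]
    rw [rep_root_mul]
    congr 3
    rw [Polynomial.coeff_sub, Polynomial.coeff_X_mul, Polynomial.coeff_C_mul,
      Polynomial.coeff_add, Polynomial.coeff_X_pow, if_neg (by omega), Polynomial.coeff_C_succ]
    simp
  rw [h0, Finset.sum_congr rfl h1]

theorem norm2_root_pow_mul {r : ℕ} (a : Fin r → pp.Rq) (k : ℕ) :
    norm2 (fun i => AdjoinRoot.root pp.modulus ^ k * a i) = norm2 a := by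
  induction k with
  | zero => simp
  | succ k ih =>
    rw [← ih]
    unfold norm2
    congr 1
    refine Finset.sum_congr rfl fun i _ => ?_
    have h : AdjoinRoot.root pp.modulus ^ (k + 1) * a i =
        AdjoinRoot.root pp.modulus * (AdjoinRoot.root pp.modulus ^ k * a i) := by
      rw [pow_succ', mul_assoc]
    simp only [h]
    exact sum_sq_lift_root_mul _

/-- Multiplication by a ring element scales Euclidean norms by at most its `ℓ₁` norm. -/
theorem norm2_mul_le {r : ℕ} (c : pp.Rq) (a : Fin r → pp.Rq) :
    norm2 (fun i => c * a i) ≤ norm1 c * norm2 a := by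
  -- Monomials act as isometries, so expanding `c` with integer coefficients and applying the
  -- triangle inequality produces the `ℓ₁` norm.
  have e : ∀ i, c * a i = ∑ k : Fin pp.d,
      lift c k • (AdjoinRoot.root pp.modulus ^ (k : ℕ) * a i) := by
    intro i
    conv_lhs => rw [eq_sum_root c, Finset.sum_mul]
    refine Finset.sum_congr rfl fun k _ => ?_
    rw [← coe_lift, Int.cast_smul_eq_zsmul, smul_mul_assoc]
  simp_rw [e]
  refine (norm2_sum_le _ _).trans ?_
  unfold norm1
  push_cast
  rw [Finset.sum_mul]
  refine Finset.sum_le_sum fun k _ => (norm2_zsmul_le _ _).trans ?_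
  rw [norm2_root_pow_mul]
  push_cast
  exact le_rfl

theorem norm2_ofInt_le {r : ℕ} (v : Fin r → Fin pp.d → ℤ) :
    norm2 (fun i => (ofInt (v i) : pp.Rq)) ≤ √(∑ i, ∑ k, (v i k : ℝ) ^ 2) :=
  norm2_le_sqrt _ _ fun i k => by exact_mod_cast abs_lift_ofInt_le (v i) k

theorem norm1_le_of_abs_le {a : pp.Rq} (B : ℤ) (h : ∀ k, |lift a k| ≤ B) :
    norm1 a ≤ pp.d * B := by
  refine (Finset.sum_le_sum fun k _ => h k).trans ?_
  simp

theorem norm2_le_of_abs_le_one {r : ℕ} (a : Fin r → pp.Rq) (h : ∀ i k, |lift (a i) k| ≤ 1) :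
    norm2 a ≤ √(r * pp.d) := by
  refine (norm2_le_sqrt a (fun _ _ => 1) fun i k => ?_).trans (le_of_eq ?_)
  · rw [abs_one]; exact_mod_cast h i k
  · simp

theorem chal_support {c : pp.Rq} (hc : c ∈ pp.chal.support) (k : Fin pp.d) : |lift c k| ≤ 1 := by
  unfold chal at hc
  rw [PMF.mem_support_map_iff] at hc
  obtain ⟨v, hv, rfl⟩ := hc
  refine (abs_lift_ofInt_le v k).trans ?_
  have := iid_support _ _ _ hv k
  unfold ternary at this
  rw [PMF.mem_support_bind_iff] at this
  obtain ⟨b, -, hb⟩ := this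
  cases b
  · simp only [Bool.false_eq_true, if_false, PMF.mem_support_map_iff] at hb
    obtain ⟨b', -, hb'⟩ := hb
    rw [← hb']
    cases b' <;> simp
  · simp only [if_true, PMF.mem_support_pure_iff] at hb
    rw [hb]; simp

theorem smallR_support {a : pp.Rq} (ha : a ∈ pp.smallR.support) (k : Fin pp.d) :
    |lift a k| ≤ 1 := by
  unfold smallR at ha
  rw [PMF.mem_support_map_iff] at ha
  obtain ⟨v, hv, rfl⟩ := ha
  refine (abs_lift_ofInt_le v k).trans ?_
  rcases pp.χ_ternary _ (iid_support _ _ _ hv k) with h | h | h <;> rw [h] <;> simp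

theorem norm1_chal_le {c : pp.Rq} (hc : c ∈ pp.chal.support) : norm1 c ≤ pp.ω := by
  refine (norm1_le_of_abs_le 1 (chal_support hc)).trans ?_
  rw [mul_one]
  exact_mod_cast pp.d_le_ω

theorem norm1_sub_le (a b : pp.Rq) : norm1 (a - b) ≤ norm1 a + norm1 b := by
  unfold norm1
  rw [← Finset.sum_add_distrib]
  exact Finset.sum_le_sum fun k _ => abs_lift_sub_le _ _ _

theorem norm1_chal_sub_le {c c' : pp.Rq} (hc : c ∈ pp.chal.support) (hc' : c' ∈ pp.chal.support) :
    norm1 (c - c') ≤ 2 * pp.ω :=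
  (norm1_sub_le _ _).trans (by linarith [norm1_chal_le hc, norm1_chal_le hc'])

end norms

/-! ## The honest prover -/

section honest

variable {pp : Params}

/-- Apart from the norm bound every check is a polynomial identity in the honest data. The `c²` term
of the quadratic check disappears because bit vectors are idempotent, and the head of `h` vanishes
by `coef_proof_vanish`. -/
theorem accepts_of_norm {x : Stmt pp} {w : Wit pp} (hx : honestRel x w) (y : Fin pp.m → pp.Rq)
    (g : pp.Rq) (hg : ∀ k : Fin pp.d, (k : ℕ) < pp.n → coef g k = 0) (φ : Slots pp) (c : pp.Rq)
    (z : Fin pp.m → pp.Rq) (hz : z = y + c • w.r) (hn : norm2 z ≤ pp.bound) :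
    accepts x ⟨prove1 x w y g, φ, prove2 x w y g φ, c, z⟩ := by
  obtain ⟨hv, -, h0, h1, h2, h3⟩ := hx
  subst hz
  refine ⟨hn, ?_, ?_, ?_, ?_⟩
  · simp only [prove1, h0, Matrix.mulVec_add, Matrix.mulVec_smul]
  · simp only [prove1, dotProduct_add, dotProduct_smul, smul_eq_mul]
    linear_combination (c ^ 2) * (bits_mul_self (pp := pp) w.v)
  · simp only [prove1, prove2, h1, dotProduct_add, dotProduct_smul, smul_eq_mul]
    ring
  · intro k hk
    have := coef_proof_vanish φ w.v hv k hk
    simp only [prove2]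
    rw [add_sub_assoc, coef_add, Pi.add_apply, hg k hk, this, add_zero]

theorem unifG_support {g : pp.Rq} (hg : g ∈ pp.unifG.support) (k : Fin pp.d)
    (hk : (k : ℕ) < pp.n) : coef g k = 0 := by
  unfold unifG at hg
  rw [PMF.mem_support_map_iff] at hg
  obtain ⟨v, -, rfl⟩ := hg
  rw [coef_ofCoef, if_pos hk]

/-- The transcript of the honest prover whose response is `z`. -/
def responseTranscript (x : Stmt pp) (w : Wit pp) (z : Fin pp.m → pp.Rq) (g : pp.Rq)
    (φ : Slots pp) (c : pp.Rq) : Transcript pp :=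
  ⟨prove1 x w (z - c • w.r) g, φ, prove2 x w (z - c • w.r) g φ, c, z⟩

/-- The honest transcript with a Gaussian response that is independent of the witness. -/
def idealRun (x : Stmt pp) (w : Wit pp) : PMF (Transcript pp) :=
  pp.unifG.bind fun g => pp.unifSlots.bind fun φ => pp.chal.bind fun c =>
    pp.mask.map fun z => responseTranscript x w (fun i => ofInt (z i)) g φ c

/-- The integer shift `c r` of the response. -/
def shiftZ (w : Wit pp) (c : pp.Rq) : Fin pp.m → Fin pp.d → ℤ := fun i => lift (c * w.r i)

/-- Parametrises accepted runs by the response: with `y = z - c r`, the coin and the transcript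
depend on the mask only through the shifted vector, as the change of variables in `Ex_mask_shift`
requires. -/
theorem Ex_honestRun_flag (x : Stmt pp) (w : Wit pp) (f : Transcript pp → ℝ≥0∞) :
    (Ex (honestRun x w) fun a => ind (a.2 = true) * f a.1) =
      Ex pp.unifG fun g => Ex pp.unifSlots fun φ => Ex pp.chal fun c => Ex pp.mask fun y =>
        coin (rejProb (y + shiftZ w c) (shiftZ w c)) true *
          f (responseTranscript x w (fun i => ofInt ((y + shiftZ w c) i)) g φ c) := by
  unfold honestRun
  simp only [Ex_bind, Ex_map]
  rw [Ex_comm]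
  congr 1; funext g
  rw [Ex_comm]
  congr 1; funext φ
  rw [Ex_comm]
  congr 1; funext c; congr 1; funext y
  rw [Ex_fintype]
  simp only [Fintype.sum_bool, ind]
  simp only [if_true, one_mul, Bool.false_eq_true, if_false, zero_mul, mul_zero, add_zero]
  congr 2
  unfold responseTranscript
  have e : ∀ i, (ofInt (fun k => y i k + lift (c * w.r i) k) : pp.Rq)
      = ofInt (y i) + c * w.r i := by
    intro i
    rw [ofInt_add, ofInt_lift]
  have e1 : (fun i => (ofInt ((y + shiftZ w c) i) : pp.Rq)) - c • w.r = fun i => ofInt (y i) := by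
    funext i
    have : (y + shiftZ w c) i = fun k => y i k + lift (c * w.r i) k := rfl
    rw [Pi.sub_apply, this, e, Pi.smul_apply, smul_eq_mul, add_sub_cancel_right]
  rw [e1]
  rfl

/-- Untruncated, `3 * rejProb` is the density of the unshifted mask law relative to the law of `y +
v`. -/
theorem Ex_mask_shift (v : Fin pp.m → Fin pp.d → ℤ)
    (F : (Fin pp.m → Fin pp.d → ℤ) → ℝ≥0∞) :
    (Ex pp.mask fun y => ENNReal.ofReal (3 * rejProb (y + v) v) * F (y + v)) = Ex pp.mask F := by
  unfold Ex
  rw [← (Equiv.addRight v).tsum_eq fun z => pp.mask z * F z]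
  refine tsum_congr fun y => ?_
  rw [← mul_assoc, Equiv.coe_addRight, ← mask_mul_exp]
  congr 3
  unfold rejProb
  ring

theorem three_mul_coin_le (r : ℝ) (hr : 0 ≤ r) :
    3 * coin r true ≤ ENNReal.ofReal (3 * r) := by
  rw [coin_apply_true, ENNReal.ofReal_mul (by norm_num)]
  gcongr
  · simp
  · exact (min_le_right _ _).trans (max_le hr le_rfl)

theorem rejProb_nonneg (z v : Fin pp.m → Fin pp.d → ℤ) : 0 ≤ rejProb z v := by
  unfold rejProb; positivity

/-- Without truncation this would be an equality; truncating the acceptance probability at `1` only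
removes mass. -/
theorem honestRun_dominated (x : Stmt pp) (w : Wit pp) (f : Transcript pp → ℝ≥0∞) :
    3 * (Ex (honestRun x w) fun a => ind (a.2 = true) * f a.1) ≤ Ex (idealRun x w) f := by
  rw [Ex_honestRun_flag]
  unfold idealRun
  simp only [Ex_bind, Ex_map, ← Ex_mul_left]
  refine Ex_mono _ fun g => Ex_mono _ fun φ => Ex_mono _ fun c => ?_
  refine (Ex_mono _ fun y => ?_).trans (Ex_mask_shift (shiftZ w c) fun z =>
    f (responseTranscript x w (fun i => ofInt (z i)) g φ c)).le
  rw [← mul_assoc]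
  exact mul_le_mul_left (three_mul_coin_le _ (rejProb_nonneg _ _)) _

theorem shift_pos : 0 < pp.shift := by
  have h1 := d_pos (pp := pp)
  have h2 : 0 < pp.ω := h1.trans_le pp.d_le_ω
  have h3 : 0 < pp.m := by simp [m]
  unfold shift
  positivity

theorem sum_sq_shiftZ_le (w : Wit pp) (hw : ∀ i k, |lift (w.r i) k| ≤ 1) {c : pp.Rq}
    (hc : c ∈ pp.chal.support) :
    ∑ i, ∑ k, (shiftZ w c i k : ℝ) ^ 2 ≤ pp.shift ^ 2 := by
  have h : norm2 (fun i => c * w.r i) ≤ pp.shift := by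
    refine (norm2_mul_le c w.r).trans ?_
    unfold shift
    have h1 : (norm1 c : ℝ) ≤ pp.ω := by exact_mod_cast norm1_chal_le hc
    have h2 := norm2_le_of_abs_le_one w.r hw
    exact mul_le_mul h1 h2 (norm2_nonneg _) (by positivity)
  have h' := pow_le_pow_left₀ (norm2_nonneg _) h 2
  unfold norm2 at h'
  rwa [Real.sq_sqrt (by positivity)] at h'

/-- Mass is lost only where the density ratio exceeds `3`. There the width condition and `‖v‖ ≤ T`
force `-⟨z, v⟩ ≥ τ T 𝔰`, an event that the sub-Gaussian tail bounds by `2 ^ (-η)`. -/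
theorem honestRun_mass (η : ℕ)
    (hrej : Real.exp (√(2 * η * Real.log 2) * pp.shift / pp.σ
      + pp.shift ^ 2 / (2 * pp.σ ^ 2)) ≤ 3)
    (x : Stmt pp) (w : Wit pp) (hw : ∀ i k, |lift (w.r i) k| ≤ 1) :
    ENNReal.ofReal ((1 - (1 / 2) ^ η) / 3) ≤ Ex (honestRun x w) fun a => ind (a.2 = true) := by
  have h1 := Ex_honestRun_flag x w fun _ => 1
  simp only [mul_one] at h1
  rw [h1]
  rw [← Ex_const pp.unifG (ENNReal.ofReal _)]
  refine Ex_mono _ fun g => ?_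
  rw [← Ex_const pp.unifSlots (ENNReal.ofReal _)]
  refine Ex_mono _ fun φ => ?_
  rw [← Ex_const pp.chal (ENNReal.ofReal _)]
  refine Ex_mono' _ fun c hc => ?_
  set v := shiftZ w c with hv
  have hσ := pp.σ_pos
  set τ := √(2 * η * Real.log 2) with hτ
  have hV := sum_sq_shiftZ_le w hw hc
  rw [← hv] at hV
  have hlog : 0 ≤ 2 * (η : ℝ) * Real.log 2 := by
    have := Real.log_nonneg (by norm_num : (1 : ℝ) ≤ 2)
    positivity
  have hbad : ∀ z : Fin pp.m → Fin pp.d → ℤ, ¬ 3 * rejProb z v ≤ 3 →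
      τ * pp.shift * pp.σ ≤ -∑ i, ∑ k, (z i k : ℝ) * v i k := by
    intro z hz
    rw [not_le] at hz
    have h2 : Real.exp (τ * pp.shift / pp.σ + pp.shift ^ 2 / (2 * pp.σ ^ 2)) <
        Real.exp ((-2 * ∑ i, ∑ k, (z i k : ℝ) * v i k + ∑ i, ∑ k, (v i k : ℝ) ^ 2)
          / (2 * pp.σ ^ 2)) := by
      refine hrej.trans_lt (hz.trans_le (le_of_eq ?_))
      unfold rejProb
      ring
    rw [Real.exp_lt_exp] at h2
    have e : τ * pp.shift / pp.σ + pp.shift ^ 2 / (2 * pp.σ ^ 2) =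
        (2 * (τ * pp.shift * pp.σ) + pp.shift ^ 2) / (2 * pp.σ ^ 2) := by
      field_simp
    rw [e, div_lt_div_iff_of_pos_right (by positivity)] at h2
    linarith
  have htail := mask_tail_linear v pp.shift τ shift_pos (Real.sqrt_nonneg _) hV
  -- `τ = √(2 η ln 2)` was chosen for this.
  have hexp : Real.exp (-τ ^ 2 / 2) = (1 / 2) ^ η := by
    rw [hτ, Real.sq_sqrt hlog]
    rw [show -(2 * (η : ℝ) * Real.log 2) / 2 = η * (-Real.log 2) by ring, Real.exp_nat_mul,
      Real.exp_neg, Real.exp_log (by norm_num), one_div]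
  rw [hexp] at htail
  have hgood : ENNReal.ofReal (1 - (1 / 2) ^ η) ≤ Ex pp.mask fun z => ind (3 * rejProb z v ≤ 3) := by
    have h3 : (1 : ℝ≥0∞) ≤ (Ex pp.mask fun z => ind (3 * rejProb z v ≤ 3)) +
        ENNReal.ofReal ((1 / 2) ^ η) := by
      refine le_trans ?_ (add_le_add_right htail _)
      rw [← Ex_add, ← Ex_const pp.mask 1]
      refine Ex_mono _ fun z => ?_
      by_cases hz : 3 * rejProb z v ≤ 3
      · rw [ind_of_true hz]; exact le_self_add
      · rw [ind_of_true (hbad z hz)]; exact le_add_self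
    rw [ENNReal.ofReal_sub _ (by positivity), ENNReal.ofReal_one]
    exact tsub_le_iff_right.2 h3
  -- The good event was measured for a Gaussian response `z`; the density ratio carries it back to
  -- the actual mask `y`.
  rw [← Ex_mask_shift v] at hgood
  have h3 : ENNReal.ofReal ((1 - (1 / 2) ^ η) / 3) = 3⁻¹ * ENNReal.ofReal (1 - (1 / 2) ^ η) := by
    rw [div_eq_inv_mul, ENNReal.ofReal_mul (by norm_num), ENNReal.ofReal_inv_of_pos (by norm_num)]
    simp
  rw [h3]
  refine (mul_le_mul_right hgood _).trans ?_
  rw [← Ex_mul_left]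
  refine Ex_mono _ fun y => ?_
  by_cases hz : 3 * rejProb (y + v) v ≤ 3
  · rw [ind_of_true hz, mul_one, coin_apply_true, ENNReal.ofReal_mul (by norm_num), ← mul_assoc]
    rw [max_eq_right (rejProb_nonneg _ _), min_eq_right (by linarith)]
    simp only [ENNReal.ofReal_ofNat]
    rw [ENNReal.inv_mul_cancel (by norm_num) (by norm_num), one_mul]
  · rw [ind_of_false hz, mul_zero, mul_zero]; exact zero_le

theorem honestRun_close (η : ℕ)
    (hrej : Real.exp (√(2 * η * Real.log 2) * pp.shift / pp.σ
      + pp.shift ^ 2 / (2 * pp.σ ^ 2)) ≤ 3)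
    (x : Stmt pp) (w : Wit pp) (hw : ∀ i k, |lift (w.r i) k| ≤ 1)
    (f : Transcript pp → ℝ≥0∞) (hf : ∀ a, f a ≤ 1) :
    |(Ex (condFlag (honestRun x w)) f).toReal - (Ex (idealRun x w) f).toReal| ≤ (1 / 2) ^ η :=
  condFlag_close _ _ _ (honestRun_dominated x w) (honestRun_mass η hrej x w hw) (by positivity) f hf

/-- In the ideal run the response is Gaussian, so the norm tail is the only source of rejection. -/
theorem idealRun_accepts {x : Stmt pp} {w : Wit pp} (hx : honestRel x w) :
    1 ≤ (Ex (idealRun x w) fun t => ind (accepts x t)) +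
      ENNReal.ofReal ((√2 * Real.exp (-1 / 2)) ^ (pp.m * pp.d)) := by
  have hσ := pp.σ_pos
  refine le_trans ?_ (add_le_add_right mask_tail_norm _)
  have e : (Ex pp.mask fun z => ind (2 * pp.σ ^ 2 * (pp.m * pp.d) < ∑ i, ∑ k, (z i k : ℝ) ^ 2)) =
      Ex pp.unifG fun _ => Ex pp.unifSlots fun _ => Ex pp.chal fun _ => Ex pp.mask fun z =>
        ind (2 * pp.σ ^ 2 * (pp.m * pp.d) < ∑ i, ∑ k, (z i k : ℝ) ^ 2) := by
    simp only [Ex_const]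
  rw [e]
  unfold idealRun
  simp only [Ex_bind, Ex_map, ← Ex_add]
  rw [← Ex_const pp.unifG 1]
  refine Ex_mono' _ fun g hg => ?_
  rw [← Ex_const pp.unifSlots 1]
  refine Ex_mono _ fun φ => ?_
  rw [← Ex_const pp.chal 1]
  refine Ex_mono _ fun c => ?_
  rw [← Ex_const pp.mask 1]
  refine Ex_mono _ fun z => ?_
  by_cases hz : 2 * pp.σ ^ 2 * (pp.m * pp.d) < ∑ i, ∑ k, (z i k : ℝ) ^ 2
  · rw [ind_of_true hz]; exact le_add_self
  · refine le_trans (le_of_eq ?_) le_self_add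
    refine (ind_of_true ?_).symm
    refine accepts_of_norm hx _ g (fun k hk => unifG_support hg k hk) φ c _ ?_ ?_
    · rw [sub_add_cancel]
    · refine (norm2_ofInt_le z).trans ?_
      unfold bound
      rw [← Real.sqrt_sq hσ.le, ← Real.sqrt_mul (sq_nonneg _)]
      apply Real.sqrt_le_sqrt
      rw [not_lt] at hz
      linarith

end honest
end Params
end
end PoA

namespace PoA
noncomputable section

/-! ## Completeness -/

theorem negligible_pow {r : ℝ} (h0 : 0 ≤ r) (h1 : r < 1) : Negligible fun η => r ^ η := by
  intro n
  exact tendsto_pow_const_mul_const_pow_of_abs_lt_one n (by rwa [abs_of_nonneg h0])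

theorem Negligible.add {f g : ℕ → ℝ} (hf : Negligible f) (hg : Negligible g) :
    Negligible fun η => f η + g η :=
  Asymptotics.SuperpolynomialDecay.add hf hg

theorem Negligible.of_abs_le {f g : ℕ → ℝ} (hf : Negligible f) (h : ∀ η, |g η| ≤ f η) :
    Negligible g :=
  Asymptotics.SuperpolynomialDecay.trans_abs_le hf fun η => (h η).trans (le_abs_self _)

/-- The square is `2 / e`. -/
theorem sqrt_two_mul_exp_lt_one : √2 * Real.exp (-1 / 2) < 1 := by
  have h1 : (√2 * Real.exp (-1 / 2)) ^ 2 < 1 := by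
    rw [mul_pow, Real.sq_sqrt (by norm_num), ← Real.exp_nat_mul]
    have : Real.exp ((2 : ℕ) * (-1 / 2)) = (Real.exp 1)⁻¹ := by
      rw [← Real.exp_neg]; norm_num
    rw [this, ← div_eq_mul_inv, div_lt_one (Real.exp_pos _)]
    exact Real.exp_one_gt_two
  have h0 : 0 ≤ √2 * Real.exp (-1 / 2) := by positivity
  nlinarith

theorem complete_of_admissible {pp : ℕ → Params} (h : Admissible pp) : Complete pp := by
  set ρ := √2 * Real.exp (-1 / 2) with hρ
  have hρ0 : 0 ≤ ρ := by positivity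
  have hρ1 : ρ < 1 := sqrt_two_mul_exp_lt_one
  -- The first term is the rejection-sampling error; the second bounds the norm error `ρ ^ (m d)`,
  -- using `m d ≥ η`.
  refine ⟨fun η => (1 / 2) ^ η + ρ ^ η,
    (negligible_pow (by norm_num) (by norm_num)).add (negligible_pow hρ0 hρ1), ?_⟩
  intro η x w hx
  have hr := h.rejection η
  have hρη : 0 ≤ ρ ^ η := pow_nonneg hρ0 η
  constructor
  · have := Params.honestRun_mass η hr x w hx.2.1
    rw [ENNReal.ofReal_le_iff_le_toReal (Ex_ind_ne_top _ _)] at this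
    rw [prob_eq]
    have h2 : (1 - ((1 / 2 : ℝ) ^ η + ρ ^ η)) / 3 ≤ (1 - (1 / 2) ^ η) / 3 := by linarith
    exact h2.trans this
  · have h1 := Params.honestRun_close η hr x w hx.2.1 (fun t => ind (Params.accepts x t))
      fun t => ind_le_one _
    have h2 := Params.idealRun_accepts hx
    have h3 : 1 ≤ (Ex (Params.idealRun x w) fun t => ind (Params.accepts x t)).toReal +
        ρ ^ ((pp η).m * (pp η).d) := by
      have := ENNReal.toReal_mono (ENNReal.add_ne_top.2 ⟨Ex_ind_ne_top _ _, ENNReal.ofReal_ne_top⟩) h2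
      rwa [ENNReal.toReal_add (Ex_ind_ne_top _ _) ENNReal.ofReal_ne_top, ENNReal.toReal_one,
        ENNReal.toReal_ofReal (by positivity)] at this
    have h4 : ρ ^ ((pp η).m * (pp η).d) ≤ ρ ^ η :=
      pow_le_pow_of_le_one hρ0 hρ1.le (h.dim η)
    rw [prob_eq]
    have := (abs_le.1 h1).1
    linarith

/-! ## Distribution of challenges -/

namespace Params

variable {pp : Params}

variable (pp) in
/-- Law of the coefficients of a challenge, as words. -/
def chalW : PMF pp.W := (ternary pp.p).map fun a : ℤ => (a : pp.W)

variable (pp) in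
theorem chal_eq : pp.chal = (iid pp.chalW pp.d).map ofCoef := by
  unfold chal chalW
  rw [iid_map, PMF.map_comp]
  rfl

open ZMod in
-- The Fourier transform of the ternary law is real because the law is symmetric: the two
-- exponentials at `±1` combine to a cosine.
theorem sum_chalW_char (t : pp.W) :
    ∑ w, ((pp.chalW w).toReal : ℂ) * stdAddChar (t * w) =
      ((pp.p + (1 - pp.p) * Real.cos (2 * Real.pi * t.val / pp.q) : ℝ) : ℂ) := by
  have hE : ∀ f : pp.W → ℂ, ∑ w, ((pp.chalW w).toReal : ℂ) * f w =
      pp.p * f 0 + (1 - pp.p) * (1 / 2 * f 1 + 1 / 2 * f (-1)) := by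
    intro f
    have hp0 := pp.p_nonneg
    have hp1 := pp.p_le_one
    have hc : ∀ w, ((pp.chalW w).toReal : ℂ) =
        pp.p * (if w = 0 then 1 else 0) + (1 - pp.p) * (1 / 2 * (if w = 1 then 1 else 0)
          + 1 / 2 * (if w = -1 then 1 else 0)) := by
      intro w
      have : pp.chalW w = ENNReal.ofReal pp.p * (if w = 0 then 1 else 0) +
          ENNReal.ofReal (1 - pp.p) * (ENNReal.ofReal (1 / 2) * (if w = 1 then 1 else 0)
            + ENNReal.ofReal (1 / 2) * (if w = -1 then 1 else 0)) := by
        have h := Ex_map (ternary pp.p) (fun a : ℤ => (a : pp.W)) fun b => if b = w then 1 else 0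
        have e : Ex ((ternary pp.p).map fun a : ℤ => (a : pp.W)) (fun b => if b = w then 1 else 0)
            = pp.chalW w := by simp [Ex, chalW]
        rw [← e, h]
        unfold ternary
        rw [Ex_bind, Ex_fintype, Fintype.sum_bool]
        simp only [if_true, Bool.false_eq_true, if_false, Ex_pure, Ex_map]
        rw [Ex_fintype, Fintype.sum_bool]
        simp only [if_true, Bool.false_eq_true, if_false, eq_comm (b := w)]
        have c1 : coin pp.p true = ENNReal.ofReal pp.p := by
          rw [coin_apply_true, max_eq_right hp0, min_eq_right hp1]
        have c2 : coin pp.p false = ENNReal.ofReal (1 - pp.p) := by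
          change ENNReal.ofReal (1 - min 1 (max 0 pp.p)) = _
          rw [max_eq_right hp0, min_eq_right hp1]
        have c3 : coin (1 / 2) true = ENNReal.ofReal (1 / 2) := by
          rw [coin_apply_true]; norm_num
        have c4 : coin (1 / 2) false = ENNReal.ofReal (1 / 2) := by
          change ENNReal.ofReal (1 - min 1 (max 0 (1 / 2))) = _
          norm_num
        rw [c1, c2, c3, c4]
        push_cast
        rfl
      rw [this]
      have h1p : 0 ≤ 1 - pp.p := by linarith
      have ht : ∀ P : Prop, [Decidable P] → (if P then (1 : ℝ≥0∞) else 0) ≠ ∞ := by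
        intro P _; split_ifs <;> simp
      have hti : ∀ P : Prop, [Decidable P] →
          (((if P then (1 : ℝ≥0∞) else 0).toReal : ℝ) : ℂ) = if P then 1 else 0 := by
        intro P _; split_ifs <;> simp
      rw [ENNReal.toReal_add (by finiteness [ht]) (by finiteness [ht]), ENNReal.toReal_mul,
        ENNReal.toReal_mul, ENNReal.toReal_add (by finiteness [ht]) (by finiteness [ht]),
        ENNReal.toReal_mul, ENNReal.toReal_mul, ENNReal.toReal_ofReal hp0,
        ENNReal.toReal_ofReal h1p, ENNReal.toReal_ofReal (by norm_num)]
      push_cast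
      rw [hti, hti, hti]
    simp_rw [hc, add_mul, Finset.sum_add_distrib, mul_assoc, ← Finset.mul_sum, add_mul,
      Finset.sum_add_distrib, mul_assoc, ← Finset.mul_sum]
    simp
  rw [hE]
  have h1 : stdAddChar t = Complex.exp ((2 * Real.pi * t.val / pp.q : ℝ) * Complex.I) := by
    have := ZMod.stdAddChar_coe (N := pp.q) (t.val : ℤ)
    simp only [Int.cast_natCast, ZMod.natCast_zmod_val] at this
    rw [this]
    congr 1
    push_cast
    ring
  have h2 : stdAddChar (-t) = Complex.exp (-(2 * Real.pi * t.val / pp.q : ℝ) * Complex.I) := by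
    rw [AddChar.map_neg_eq_inv, h1, ← Complex.exp_neg]
    congr 1
    ring
  simp only [mul_zero, mul_one, mul_neg, AddChar.map_zero_eq_one]
  rw [h1, h2]
  push_cast
  rw [Complex.cos]
  ring

theorem abs_cos_neg_val (p : ℝ) (t : pp.W) :
    |p + (1 - p) * Real.cos (2 * Real.pi * (-t).val / pp.q)| =
      |p + (1 - p) * Real.cos (2 * Real.pi * t.val / pp.q)| := by
  by_cases h : t = 0
  · simp [h]
  · have : NeZero t := ⟨h⟩
    rw [ZMod.val_neg_of_ne_zero, Nat.cast_sub (ZMod.val_lt t).le]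
    have hq : (pp.q : ℝ) ≠ 0 := by exact_mod_cast pp.q_prime.ne_zero
    rw [show 2 * Real.pi * ((pp.q : ℝ) - t.val) / pp.q = 2 * Real.pi - 2 * Real.pi * t.val / pp.q by
      field_simp, Real.cos_two_pi_sub]

variable (pp) in
/-- Absolute value of the characteristic function of a challenge coefficient. -/
def charAbs (t : pp.W) : ℝ := |pp.p + (1 - pp.p) * Real.cos (2 * Real.pi * t.val / pp.q)|

theorem charAbs_neg (t : pp.W) : pp.charAbs (-t) = pp.charAbs t := abs_cos_neg_val _ _

theorem charAbs_zero : pp.charAbs 0 = 1 := by simp [charAbs]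

/-- The odd powers `ξ_j ^ s` are, up to sign, the powers `ζ ^ k` with `k < l`. -/
theorem prod_charAbs_ξ (t : pp.W) (j : Fin pp.l) :
    ∏ s : Fin pp.l, pp.charAbs (t * pp.ξ j ^ (s : ℕ)) =
      ∏ k ∈ Finset.range pp.l, pp.charAbs (t * pp.ζ ^ k) := by
  have hl := l_pos (pp := pp)
  -- Exponents matter only modulo `l`, since `ζ ^ l = -1` and the absolute characteristic function
  -- is even.
  have hred : ∀ N : ℕ, pp.charAbs (t * pp.ζ ^ N) = pp.charAbs (t * pp.ζ ^ (N % pp.l)) := by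
    intro N
    conv_lhs => rw [← Nat.mod_add_div N pp.l, pow_add, pow_mul, ζ_pow_l]
    rcases neg_one_pow_eq_or pp.W (N / pp.l) with h | h
    · rw [h, mul_one]
    · rw [h, mul_neg_one, mul_neg, charAbs_neg]
  have e : ∀ s : Fin pp.l, pp.charAbs (t * pp.ξ j ^ (s : ℕ)) =
      pp.charAbs (t * pp.ζ ^ (((2 * (j : ℕ) + 1) * s) % pp.l)) := by
    intro s
    unfold ξ
    rw [← pow_mul, hred]
  simp_rw [e]
  rw [← Fin.prod_univ_eq_prod_range (fun k => pp.charAbs (t * pp.ζ ^ k))]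
  -- `l` divides a power of two, so multiplication by the odd number `2j + 1` permutes the residues
  -- modulo `l`.
  have hcop : ∀ j : ℕ, Nat.Coprime pp.l (2 * j + 1) := by
    intro j
    obtain ⟨a, ha⟩ := pp.d_two_pow
    obtain ⟨b, -, hb⟩ := (Nat.dvd_prime_pow Nat.prime_two).1 (ha ▸ pp.l_dvd_d)
    rw [hb]
    exact Nat.Coprime.pow_left _ (Nat.coprime_two_left.2 ⟨j, rfl⟩)
  let F : Fin pp.l → Fin pp.l := fun s => ⟨((2 * (j : ℕ) + 1) * s) % pp.l, Nat.mod_lt _ hl⟩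
  have hF : Function.Bijective F := by
    refine (Finite.injective_iff_bijective).1 fun s s' h => ?_
    have h1 : ((2 * (j : ℕ) + 1) * s) ≡ ((2 * (j : ℕ) + 1) * s') [MOD pp.l] :=
      congrArg Fin.val h
    have h2 := Nat.ModEq.cancel_left_of_coprime (hcop j) h1
    apply Fin.ext
    rwa [Nat.ModEq, Nat.mod_eq_of_lt s.2, Nat.mod_eq_of_lt s'.2] at h2
  exact Function.Bijective.prod_comp hF fun s : Fin pp.l => pp.charAbs (t * pp.ζ ^ (s : ℕ))

/-- The trivial frequency contributes `1`, the others make up `q ε`. In particular the value is the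
same for every slot. -/
theorem sum_prod_charAbs (j : Fin pp.l) :
    ∑ t : pp.W, ∏ s : Fin pp.l, pp.charAbs (t * pp.ξ j ^ (s : ℕ)) = 1 + pp.q * pp.ε := by
  have hq : (pp.q : ℝ) ≠ 0 := by exact_mod_cast pp.q_prime.ne_zero
  simp_rw [prod_charAbs_ξ]
  rw [Fintype.sum_eq_add_sum_subtype_ne _ (0 : pp.W)]
  congr 1
  · simp [charAbs_zero]
  · unfold ε
    rw [← mul_assoc, mul_one_div_cancel hq, one_mul]
    rw [← (unitsEquivNeZero (G₀ := pp.W)).sum_comp]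
    rfl

end Params
end
end PoA

/-! ### Fourier bound for slots of challenges and its consequences -/

namespace PoA
noncomputable section
namespace Params

variable {pp : Params}

theorem ε_nonneg : 0 ≤ pp.ε := by
  unfold ε
  exact mul_nonneg (by positivity) (Finset.sum_nonneg fun _ _ => Finset.prod_nonneg fun _ _ => abs_nonneg _)

theorem addChar_sum {A M ι : Type*} [AddCommMonoid A] [CommMonoid M] (ψ : AddChar A M)
    (s : Finset ι) (f : ι → A) : ψ (∑ i ∈ s, f i) = ∏ i ∈ s, ψ (f i) := by
  classical
  induction s using Finset.induction_on with
  | empty => simp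
  | insert i s hi ih => rw [Finset.sum_insert hi, Finset.prod_insert hi, AddChar.map_add_eq_mul, ih]

open ZMod in
theorem sum_char_eq_ite (x : pp.W) :
    ∑ t : pp.W, stdAddChar (t * x) = if x = 0 then (pp.q : ℂ) else 0 := by
  have := AddChar.sum_mulShift x (ZMod.isPrimitive_stdAddChar pp.q)
  rw [this, ZMod.card]
  push_cast
  rfl

open ZMod in
/-- One coefficient of a slot of a challenge is nearly uniform. -/
theorem sum_slot_coeff_le (j : Fin pp.l) (w : pp.W) :
    ∑ u : Fin pp.l → pp.W, (∏ s, pp.chalW (u s)) * ind (∑ s, u s * pp.ξ j ^ (s : ℕ) = w) ≤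
      ENNReal.ofReal (1 / pp.q + pp.ε) := by
  classical
  have hq : (0 : ℝ) < pp.q := by exact_mod_cast pp.q_prime.pos
  have hqc : (pp.q : ℂ) ≠ 0 := by exact_mod_cast pp.q_prime.ne_zero
  set P : pp.W → ℝ := fun a => (pp.chalW a).toReal with hP
  have hne : ∀ a, pp.chalW a ≠ ∞ := fun a => PMF.apply_ne_top _ _
  set S : ℝ := ∑ u : Fin pp.l → pp.W, (∏ s, P (u s)) *
    (if ∑ s, u s * pp.ξ j ^ (s : ℕ) = w then 1 else 0) with hS
  have hS0 : 0 ≤ S := Finset.sum_nonneg fun u _ => mul_nonneg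
    (Finset.prod_nonneg fun _ _ => ENNReal.toReal_nonneg) (by split_ifs <;> norm_num)
  have e1 : ∑ u : Fin pp.l → pp.W, (∏ s, pp.chalW (u s)) *
      ind (∑ s, u s * pp.ξ j ^ (s : ℕ) = w) = ENNReal.ofReal S := by
    rw [hS, ENNReal.ofReal_sum_of_nonneg]
    · refine Finset.sum_congr rfl fun u _ => ?_
      rw [ENNReal.ofReal_mul (Finset.prod_nonneg fun _ _ => ENNReal.toReal_nonneg),
        ENNReal.ofReal_prod_of_nonneg fun _ _ => ENNReal.toReal_nonneg]
      congr 1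
      · exact Finset.prod_congr rfl fun s _ => (ENNReal.ofReal_toReal (hne _)).symm
      · unfold ind; split_ifs <;> simp
    · intro u _
      exact mul_nonneg (Finset.prod_nonneg fun _ _ => ENNReal.toReal_nonneg) (by split_ifs <;> norm_num)
  rw [e1]
  apply ENNReal.ofReal_le_ofReal
  -- Fourier inversion: the indicator of the linear equation is an average of additive characters,
  -- and independence factors the expectation of each.
  have key : (pp.q : ℂ) * S = ∑ t : pp.W, stdAddChar (t * -w) *
      ∏ s : Fin pp.l, ∑ a, ((pp.chalW a).toReal : ℂ) * stdAddChar ((t * pp.ξ j ^ (s : ℕ)) * a) := by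
    have h1 : ∀ u : Fin pp.l → pp.W, ((pp.q : ℂ) *
        (((if ∑ s, u s * pp.ξ j ^ (s : ℕ) = w then 1 else 0 : ℝ)) : ℂ)) =
        ∑ t : pp.W, stdAddChar (t * -w) * ∏ s : Fin pp.l, stdAddChar ((t * pp.ξ j ^ (s : ℕ)) * u s) := by
      intro u
      have h2 := sum_char_eq_ite (∑ s, u s * pp.ξ j ^ (s : ℕ) - w)
      have h3 : ∀ t : pp.W, stdAddChar (t * -w) * ∏ s : Fin pp.l, stdAddChar ((t * pp.ξ j ^ (s : ℕ)) * u s)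
          = stdAddChar (t * (∑ s, u s * pp.ξ j ^ (s : ℕ) - w)) := by
        intro t
        rw [← addChar_sum, ← AddChar.map_add_eq_mul]
        congr 1
        rw [mul_sub, Finset.mul_sum, mul_neg, add_comm, sub_eq_add_neg]
        congr 1
        refine Finset.sum_congr rfl fun s _ => ?_
        ring
      simp_rw [h3, h2, sub_eq_zero]
      split_ifs <;> simp
    rw [hS]
    push_cast
    rw [Finset.mul_sum]
    simp_rw [Finset.prod_univ_sum, Fintype.piFinset_univ, Finset.mul_sum]
    rw [Finset.sum_comm]
    refine Finset.sum_congr rfl fun u _ => ?_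
    have h1' := h1 u
    rw [mul_left_comm, h1', Finset.mul_sum]
    refine Finset.sum_congr rfl fun t _ => ?_
    rw [Finset.prod_mul_distrib, mul_left_comm]
  -- The triangle inequality removes the dependence on `w`, leaving the sum of absolute
  -- characteristic functions.
  have hnorm : (pp.q : ℝ) * S ≤ 1 + pp.q * pp.ε := by
    have h1 : (pp.q : ℝ) * S = ‖(pp.q : ℂ) * S‖ := by
      rw [norm_mul, Complex.norm_natCast, Complex.norm_real, Real.norm_eq_abs, abs_of_nonneg hS0]
    rw [h1, key, ← sum_prod_charAbs j]
    refine (norm_sum_le _ _).trans (Finset.sum_le_sum fun t _ => ?_)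
    rw [norm_mul, norm_prod]
    have h2 : ‖stdAddChar (t * -w)‖ = 1 := by
      rw [stdAddChar_apply]; exact Circle.norm_coe _
    rw [h2, one_mul]
    refine Finset.prod_le_prod (fun _ _ => norm_nonneg _) fun s _ => ?_
    rw [sum_chalW_char, Complex.norm_real, Real.norm_eq_abs]
    exact le_rfl
  have : S ≤ (1 + pp.q * pp.ε) / pp.q := by
    rw [le_div_iff₀ hq]; linarith
  refine this.trans (le_of_eq ?_)
  field_simp

variable (pp) in
/-- Coefficient vectors, arranged in blocks belonging to the same slot coefficient. -/
def blockEquiv : (Fin pp.d → pp.W) ≃ (Fin pp.n → Fin pp.l → pp.W) where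
  toFun v i s := v (posEquiv pp (s, i))
  invFun u k := u ((posEquiv pp).symm k).2 ((posEquiv pp).symm k).1
  left_inv v := by funext k; simp
  right_inv u := by funext i s; simp

variable (pp) in
/-- Bound on the probability of a given value of a slot of a challenge. -/
def slotBound : ℝ := (1 / pp.q + pp.ε) ^ pp.n

theorem slotBound_nonneg : 0 ≤ pp.slotBound := by
  have := ε_nonneg (pp := pp)
  unfold slotBound; positivity

/-- By `ntt_eq_coef` the `n` entries of a slot are functions of disjoint blocks of independent
coefficients, so the one-coefficient bounds multiply. -/
theorem Ex_chal_slot_le (j : Fin pp.l) (b : pp.SlotField j) :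
    (Ex pp.chal fun c => ind (slot j c = b)) ≤ ENNReal.ofReal pp.slotBound := by
  have hε := ε_nonneg (pp := pp)
  set w : Fin pp.n → pp.W := fun i => (AdjoinRoot.modByMonicHom (slotMod_monic j) b).coeff i
  calc _ ≤ Ex (iid pp.chalW pp.d) fun v => ∏ i : Fin pp.n,
        ind (∑ s, v (posEquiv pp (s, i)) * pp.ξ j ^ (s : ℕ) = w i) := by
        rw [chal_eq, Ex_map]
        refine Ex_mono _ fun v => ?_
        by_cases h : slot j (ofCoef v) = b
        · rw [ind_of_true h]
          apply le_of_eq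
          symm
          apply Finset.prod_eq_one
          intro i _
          apply ind_of_true
          have := ntt_eq_coef (ofCoef v) j i
          rw [coef_ofCoef] at this
          rw [← this, ntt_eq_coeff, h]
        · rw [ind_of_false h]; exact zero_le
    _ = ∏ i : Fin pp.n, ∑ u : Fin pp.l → pp.W,
        (∏ s, pp.chalW (u s)) * ind (∑ s, u s * pp.ξ j ^ (s : ℕ) = w i) := by
        rw [Ex_fintype, Finset.prod_univ_sum, Fintype.piFinset_univ, ← (blockEquiv pp).symm.sum_comp]
        refine Finset.sum_congr rfl fun u _ => ?_
        rw [iid_apply, Finset.prod_mul_distrib]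
        congr 1
        · rw [← (posEquiv pp).prod_comp, Fintype.prod_prod_type, Finset.prod_comm]
          simp [blockEquiv]
        · simp [blockEquiv]
    _ ≤ ∏ _i : Fin pp.n, ENNReal.ofReal (1 / pp.q + pp.ε) :=
        Finset.prod_le_prod' fun i _ => sum_slot_coeff_le j (w i)
    _ = _ := by
        rw [Finset.prod_const, Finset.card_univ, Fintype.card_fin, slotBound,
          ENNReal.ofReal_pow (by positivity)]

/-- Differences of challenges are invertible except with small probability. -/
theorem Ex_chal_not_unit_le (c₁ : pp.Rq) :
    (Ex pp.chal fun c => ind (¬ IsUnit (c₁ - c))) ≤ ENNReal.ofReal (pp.l * pp.slotBound) := by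
  calc _ ≤ Ex pp.chal fun c => ∑ j, ind (slot j c = slot j c₁) := by
        refine Ex_mono _ fun c => ?_
        by_cases h : IsUnit (c₁ - c)
        · rw [ind_of_false (not_not.2 h)]; exact zero_le
        · rw [isUnit_iff_slots] at h
          push Not at h
          obtain ⟨j, hj⟩ := h
          rw [map_sub, sub_eq_zero] at hj
          refine (ind_le_one _).trans ?_
          rw [← ind_of_true hj.symm]
          exact Finset.single_le_sum (f := fun j => ind (slot j c = slot j c₁))
            (fun _ _ => zero_le) (Finset.mem_univ j)
    _ ≤ ∑ _j : Fin pp.l, ENNReal.ofReal pp.slotBound := by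
        rw [Ex_finset_sum]
        exact Finset.sum_le_sum fun j _ => Ex_chal_slot_le j _
    _ = _ := by
        rw [Finset.sum_const, Finset.card_univ, Fintype.card_fin, nsmul_eq_mul,
          ENNReal.ofReal_mul (Nat.cast_nonneg _), ENNReal.ofReal_natCast]

/-- A nonzero quadratic equation in a slot is rarely satisfied by a challenge. -/
theorem Ex_chal_quadratic_le (j : Fin pp.l) (a b e : pp.SlotField j) (ha : a ≠ 0) :
    (Ex pp.chal fun c => ind (a * (slot j c) ^ 2 + b * slot j c + e = 0)) ≤
      2 * ENNReal.ofReal pp.slotBound := by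
  by_cases h : ∃ t₁ : pp.SlotField j, a * t₁ ^ 2 + b * t₁ + e = 0
  · obtain ⟨t₁, h₁⟩ := h
    -- The second root by Vieta; it may coincide with the first.
    set t₂ := -b / a - t₁ with ht₂
    have : ∀ t : pp.SlotField j, a * t ^ 2 + b * t + e = 0 → t = t₁ ∨ t = t₂ := by
      intro t ht
      have h2 : (t - t₁) * (a * (t - t₂)) = 0 := by
        rw [ht₂]
        field_simp
        linear_combination ht - h₁
      rcases mul_eq_zero.1 h2 with h3 | h3
      · exact Or.inl (sub_eq_zero.1 h3)
      · exact Or.inr (sub_eq_zero.1 ((mul_eq_zero.1 h3).resolve_left ha))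
    refine (Ex_mono _ fun c => (ind_mono (this (slot j c))).trans (ind_or_le _ _)).trans ?_
    rw [Ex_add, two_mul]
    exact add_le_add (Ex_chal_slot_le j _) (Ex_chal_slot_le j _)
  · push Not at h
    have : (Ex pp.chal fun c => ind (a * (slot j c) ^ 2 + b * slot j c + e = 0)) = Ex pp.chal fun _ => 0 := by
      congr 1; funext c
      exact ind_of_false (h _)
    rw [this, Ex_const]
    exact zero_le

/-- One slot where `a` is nonzero suffices: the equation prescribes the value of the challenge
there. -/
theorem Ex_chal_linear_le (a e : pp.Rq) (ha : a ≠ 0) :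
    (Ex pp.chal fun c => ind (c * a + e = 0)) ≤ ENNReal.ofReal pp.slotBound := by
  have : ∃ j, slot j a ≠ 0 := by
    by_contra hcon
    push Not at hcon
    exact ha (slot_ext fun j => by rw [hcon j, map_zero])
  obtain ⟨j, hj⟩ := this
  refine (Ex_mono _ fun c => ind_mono fun h => ?_).trans (Ex_chal_slot_le j (-slot j e / slot j a))
  have h2 := congrArg (slot j) h
  rw [map_add, map_mul, map_zero] at h2
  rw [eq_div_iff hj]
  linear_combination h2

/-- With `x = q ε ≤ 1` the bound is `l (1 + x) ^ n / q ^ n`. For `n = 1` use `1 + x ≤ 2`. For `n ≥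
2`, convexity gives `(1 + x) ^ n ≤ 1 + 2 ^ n x`, and the second term contributes at most `2 ε`
because `2l ≤ q` and `2 ≤ q`. -/
theorem slotBound_le (h : pp.q * pp.ε ≤ 1) :
    pp.l * pp.slotBound ≤ 2 * (pp.l / (pp.q : ℝ) ^ pp.n) + 2 * pp.ε := by
  have hε := ε_nonneg (pp := pp)
  have hq : (0 : ℝ) < pp.q := by exact_mod_cast pp.q_prime.pos
  have hl : (0 : ℝ) < pp.l := by exact_mod_cast l_pos (pp := pp)
  have hlq : 2 * (pp.l : ℝ) ≤ pp.q := by exact_mod_cast (two_l_lt_q (pp := pp)).le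
  set x := pp.q * pp.ε with hx
  have hx0 : 0 ≤ x := by positivity
  have e : pp.slotBound = (1 + x) ^ pp.n / (pp.q : ℝ) ^ pp.n := by
    rw [slotBound, ← div_pow]
    congr 1
    rw [hx]; field_simp
  rw [e]
  obtain ⟨k, hk⟩ : ∃ k, pp.n = k + 1 := ⟨pp.n - 1, by have := n_pos (pp := pp); omega⟩
  rcases Nat.eq_zero_or_pos k with h0 | h0
  · rw [hk, h0]
    have h1 : pp.l * ((1 + x) ^ (0 + 1) / (pp.q : ℝ) ^ (0 + 1)) ≤ 2 * (pp.l / (pp.q : ℝ) ^ (0 + 1)) := by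
      rw [zero_add, pow_one, pow_one, mul_div_assoc', ← mul_div_assoc]
      apply div_le_div_of_nonneg_right _ hq.le
      nlinarith
    linarith
  · obtain ⟨k', rfl⟩ : ∃ k', k = k' + 1 := ⟨k - 1, by omega⟩
    have hpow : ∀ N : ℕ, (1 + x) ^ N ≤ 1 + (2 ^ N - 1) * x := by
      intro N
      induction N with
      | zero => simp
      | succ N ih =>
        have h2 : (1 : ℝ) ≤ 2 ^ N := one_le_pow₀ (by norm_num)
        rw [pow_succ, pow_succ]
        have h3 := mul_le_mul_of_nonneg_right ih (by linarith : 0 ≤ 1 + x)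
        have h4 : (2 ^ N - 1) * x * x ≤ ((2 : ℝ) ^ N - 1) * x * 1 :=
          mul_le_mul_of_nonneg_left h (mul_nonneg (by linarith) hx0)
        nlinarith
    have h5 : (1 + x) ^ pp.n ≤ 1 + 2 ^ pp.n * x := (hpow pp.n).trans (by linarith)
    have h6 : (2 : ℝ) ^ k' ≤ (pp.q : ℝ) ^ k' := by
      apply pow_le_pow_left₀ (by norm_num)
      exact_mod_cast pp.q_prime.two_le
    have hqn : 0 < (pp.q : ℝ) ^ pp.n := by positivity
    have h7 : pp.l * (2 ^ pp.n * x) / (pp.q : ℝ) ^ pp.n ≤ 2 * pp.ε := by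
      rw [div_le_iff₀ hqn, hk, hx]
      have h8 : 2 * (pp.l : ℝ) * 2 ^ k' ≤ pp.q * pp.q ^ k' :=
        mul_le_mul hlq h6 (by positivity) hq.le
      have h9 := mul_le_mul_of_nonneg_left h8 (by positivity : 0 ≤ 2 * (pp.ε * pp.q))
      calc _ = 2 * (pp.ε * pp.q) * (2 * (pp.l : ℝ) * 2 ^ k') := by ring
        _ ≤ _ := h9
        _ = _ := by ring
    have h8 : 0 ≤ pp.l / (pp.q : ℝ) ^ pp.n := by positivity
    calc pp.l * ((1 + x) ^ pp.n / (pp.q : ℝ) ^ pp.n) ≤ pp.l * ((1 + 2 ^ pp.n * x) / (pp.q : ℝ) ^ pp.n) := by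
          gcongr
      _ = pp.l / (pp.q : ℝ) ^ pp.n + pp.l * (2 ^ pp.n * x) / (pp.q : ℝ) ^ pp.n := by ring
      _ ≤ _ := by linarith

end Params
end
end PoA

namespace PoA
noncomputable section

/-! ## Extraction -/

/-- Fibres of a surjective homomorphism are translates of each other, hence of equal size. -/
theorem Ex_uniform_fiber_le {G H : Type*} [AddCommGroup G] [Fintype G] [AddCommGroup H] [Fintype H]
    (L : G →+ H) (hL : Function.Surjective L) (h : H) :
    (Ex (PMF.uniformOfFintype G) fun g => ind (L g = h)) ≤ (Fintype.card H : ℝ≥0∞)⁻¹ := by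
  classical
  have hc : ∀ h' : H, (Finset.univ.filter fun g => L g = h').card =
      (Finset.univ.filter fun g => L g = h).card := by
    intro h'
    obtain ⟨g, rfl⟩ := hL h
    obtain ⟨g', rfl⟩ := hL h'
    refine Finset.card_bij (fun a _ => a + (g - g')) ?_ ?_ ?_
    · intro a ha
      simp only [Finset.mem_filter, Finset.mem_univ, true_and] at ha ⊢
      rw [map_add, map_sub, ha]; abel
    · intro a _ b _ hab
      exact add_right_cancel hab
    · intro b hb
      simp only [Finset.mem_filter, Finset.mem_univ, true_and] at hb
      refine ⟨b - (g - g'), ?_, by abel⟩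
      simp only [Finset.mem_filter, Finset.mem_univ, true_and]
      rw [map_sub, map_sub, hb]; abel
  have hsum : Fintype.card G = Fintype.card H * (Finset.univ.filter fun g => L g = h).card := by
    rw [← Finset.card_univ, Finset.card_eq_sum_card_fiberwise (f := L) (t := Finset.univ)
      (fun _ _ => Finset.mem_univ _), Finset.sum_congr rfl fun h' _ => hc h', Finset.sum_const,
      Finset.card_univ, smul_eq_mul]
  rw [Ex_uniform]
  have e : ∑ g, ind (L g = h) = ((Finset.univ.filter fun g => L g = h).card : ℝ≥0∞) := by
    unfold ind
    rw [Finset.sum_ite, Finset.sum_const_zero, add_zero, Finset.sum_const, nsmul_eq_mul, mul_one]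
  rw [e, hsum]
  have hH : (Fintype.card H : ℝ≥0∞) ≠ 0 := by exact_mod_cast Fintype.card_ne_zero
  have hF : ((Finset.univ.filter fun g => L g = h).card : ℝ≥0∞) ≠ 0 := by
    have : Fintype.card G ≠ 0 := Fintype.card_ne_zero
    rw [hsum] at this
    exact_mod_cast right_ne_zero_of_mul this
  push_cast
  rw [ENNReal.mul_inv (Or.inl hH) (Or.inl (ENNReal.natCast_ne_top _)), mul_assoc,
    ENNReal.inv_mul_cancel hF (ENNReal.natCast_ne_top _), mul_one]

namespace Params

variable {pp : Params}

/-- The opening computed from two responses. -/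
def extractOpening (x : Stmt pp) (c₁ c₂ : pp.Rq) (z₁ z₂ : Fin pp.m → pp.Rq) : Opening pp :=
  let r : Fin pp.m → pp.Rq := ((c₁ - c₂) ^ pp.invExp) • (z₁ - z₂)
  ⟨c₁ - c₂, r, ![x.com1 - x.pk1 ⬝ᵥ r, x.com2 - x.pk2 ⬝ᵥ r, x.com3 - x.b ⬝ᵥ r]⟩

/-- The module-SIS candidate computed from three responses. -/
def extractSIS (c₁ c₂ c₃ : pp.Rq) (z₁ z₂ z₃ : Fin pp.m → pp.Rq) : Fin pp.m → pp.Rq :=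
  (c₁ - c₂) • (z₃ - z₁) - (c₃ - c₁) • (z₁ - z₂)

/-- The transcript of a strategy for given challenges. -/
def stratTranscript (S : Strategy pp) (t : Slots pp × pp.Rq) : Transcript pp :=
  ⟨S.first, t.1, S.second t.1, t.2, S.third t.1 t.2⟩

variable (pp) in
/-- The verifier's challenges. -/
def challenges : PMF (Slots pp × pp.Rq) :=
  pp.unifSlots.bind fun φ => pp.chal.map fun c => (φ, c)

theorem runStrategy_eq (S : Strategy pp) : runStrategy S = pp.challenges.map (stratTranscript S) := by
  unfold runStrategy challenges
  rw [PMF.map_bind]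
  congr 1; funext φ
  rw [PMF.map_comp]
  rfl

theorem Ex_challenges (f : Slots pp × pp.Rq → ℝ≥0∞) :
    Ex pp.challenges f = Ex pp.unifSlots fun φ => Ex pp.chal fun c => f (φ, c) := by
  unfold challenges
  simp only [Ex_bind, Ex_map]

theorem challenges_support {t : Slots pp × pp.Rq} (h : t ∈ pp.challenges.support) :
    t.2 ∈ pp.chal.support := by
  unfold challenges at h
  rw [PMF.mem_support_bind_iff] at h
  obtain ⟨φ, -, h⟩ := h
  rw [PMF.mem_support_map_iff] at h
  obtain ⟨c, hc, rfl⟩ := h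
  exact hc

theorem pow_invExp_mul {c : pp.Rq} (hc : IsUnit c) : c ^ pp.invExp * c = 1 := by
  rw [mul_comm]
  exact mul_pow_invExp c ((isUnit_iff_slots c).1 hc)

theorem bound_nonneg : 0 ≤ pp.bound := mul_nonneg pp.σ_pos.le (Real.sqrt_nonneg _)

/-- Two accepting transcripts with the same first message determine an opening, except possibly
for the shape of the first message. -/
theorem rel_extractOpening {x : Stmt pp} {S : Strategy pp} {t₁ t₂ : Slots pp × pp.Rq}
    (h₁ : accepts x (stratTranscript S t₁)) (h₂ : accepts x (stratTranscript S t₂))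
    (hc₁ : t₁.2 ∈ pp.chal.support) (hc₂ : t₂.2 ∈ pp.chal.support) (hu : IsUnit (t₁.2 - t₂.2))
    (hv : ∃ v : ℕ, v < 2 ^ 64 ∧ (extractOpening x t₁.2 t₂.2 (S.third t₁.1 t₁.2)
      (S.third t₂.1 t₂.2)).msg 0 = (v : pp.Rq)) :
    rel x (extractOpening x t₁.2 t₂.2 (S.third t₁.1 t₁.2) (S.third t₂.1 t₂.2)) := by
  have hz : ∀ i, (t₁.2 - t₂.2) * (((t₁.2 - t₂.2) ^ pp.invExp) •
      (S.third t₁.1 t₁.2 - S.third t₂.1 t₂.2)) i = S.third t₁.1 t₁.2 i - S.third t₂.1 t₂.2 i := by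
    intro i
    rw [Pi.smul_apply, smul_eq_mul, ← mul_assoc, mul_comm (t₁.2 - t₂.2), pow_invExp_mul hu, one_mul]
    rfl
  refine ⟨hu, norm1_chal_sub_le hc₁ hc₂, ?_, ?_, ?_, ?_, ?_, hv⟩
  · change norm2 (fun i => (t₁.2 - t₂.2) * (((t₁.2 - t₂.2) ^ pp.invExp) •
      (S.third t₁.1 t₁.2 - S.third t₂.1 t₂.2)) i) ≤ _
    simp only [hz]
    refine (norm2_sub_le _ _).trans ?_
    have e1 : norm2 (S.third t₁.1 t₁.2) ≤ pp.bound := h₁.1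
    have e2 : norm2 (S.third t₂.1 t₂.2) ≤ pp.bound := h₂.1
    linarith
  · change x.com0 = x.A *ᵥ (((t₁.2 - t₂.2) ^ pp.invExp) • (S.third t₁.1 t₁.2 - S.third t₂.1 t₂.2))
    have e1 : x.A *ᵥ S.third t₁.1 t₁.2 = S.first.w + t₁.2 • x.com0 := h₁.2.1
    have e2 : x.A *ᵥ S.third t₂.1 t₂.2 = S.first.w + t₂.2 • x.com0 := h₂.2.1
    rw [Matrix.mulVec_smul, Matrix.mulVec_sub, e1, e2, add_sub_add_left_eq_sub, ← sub_smul,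
      smul_smul, pow_invExp_mul hu, one_smul]
  · simp [extractOpening]
  · simp [extractOpening]
  · simp [extractOpening]

/-- A third accepting transcript is consistent with the opening or yields a SIS solution. -/
theorem third_consistent {x : Stmt pp} {S : Strategy pp} {t₁ t₂ t₃ : Slots pp × pp.Rq}
    (h₁ : accepts x (stratTranscript S t₁)) (h₂ : accepts x (stratTranscript S t₂))
    (h₃ : accepts x (stratTranscript S t₃))
    (hc₁ : t₁.2 ∈ pp.chal.support) (hc₂ : t₂.2 ∈ pp.chal.support) (hc₃ : t₃.2 ∈ pp.chal.support)
    (hu : IsUnit (t₁.2 - t₂.2))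
    (hs : ¬ solvesMSIS x.A (8 * pp.ω * pp.bound) (extractSIS t₁.2 t₂.2 t₃.2
      (S.third t₁.1 t₁.2) (S.third t₂.1 t₂.2) (S.third t₃.1 t₃.2))) :
    S.third t₃.1 t₃.2 = (S.third t₁.1 t₁.2 - t₁.2 • (extractOpening x t₁.2 t₂.2 (S.third t₁.1 t₁.2)
      (S.third t₂.1 t₂.2)).r) + t₃.2 • (extractOpening x t₁.2 t₂.2 (S.third t₁.1 t₁.2)
      (S.third t₂.1 t₂.2)).r := by
  have e1 : x.A *ᵥ S.third t₁.1 t₁.2 = S.first.w + t₁.2 • x.com0 := h₁.2.1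
  have e2 : x.A *ᵥ S.third t₂.1 t₂.2 = S.first.w + t₂.2 • x.com0 := h₂.2.1
  have e3 : x.A *ᵥ S.third t₃.1 t₃.2 = S.first.w + t₃.2 • x.com0 := h₃.2.1
  have n1 : norm2 (S.third t₁.1 t₁.2) ≤ pp.bound := h₁.1
  have n2 : norm2 (S.third t₂.1 t₂.2) ≤ pp.bound := h₂.1
  have n3 : norm2 (S.third t₃.1 t₃.2) ≤ pp.bound := h₃.1
  change _ = _ - t₁.2 • (((t₁.2 - t₂.2) ^ pp.invExp) • _) + t₃.2 • (((t₁.2 - t₂.2) ^ pp.invExp) • _)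
  generalize S.third t₁.1 t₁.2 = z₁ at *
  generalize S.third t₂.1 t₂.2 = z₂ at *
  generalize S.third t₃.1 t₃.2 = z₃ at *
  generalize t₁.2 = c₁ at *
  generalize t₂.2 = c₂ at *
  generalize t₃.2 = c₃ at *
  -- Each `A (zᵢ - zⱼ)` is `(cᵢ - cⱼ) com₀`, so the cross-multiplied difference is in the kernel.
  -- Its two terms have norm at most `2ω · 2B` each, which gives `8ωB`. Being no SIS solution, it
  -- must vanish, and dividing by `c₁ - c₂` puts `z₃` on the line.
  have hs0 : extractSIS c₁ c₂ c₃ z₁ z₂ z₃ = 0 := by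
    by_contra hne
    apply hs
    refine ⟨?_, norm2_pos hne, ?_⟩
    · unfold extractSIS
      rw [Matrix.mulVec_sub, Matrix.mulVec_smul, Matrix.mulVec_smul, Matrix.mulVec_sub,
        Matrix.mulVec_sub, e1, e2, e3, add_sub_add_left_eq_sub, add_sub_add_left_eq_sub, ← sub_smul,
        ← sub_smul, smul_smul, smul_smul, mul_comm, sub_self]
    · have hB := bound_nonneg (pp := pp)
      have hm : ∀ (c c' : pp.Rq) (z z' : Fin pp.m → pp.Rq), c ∈ pp.chal.support →
          c' ∈ pp.chal.support → norm2 z ≤ pp.bound → norm2 z' ≤ pp.bound →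
          norm2 (fun i => (c - c') * (z i - z' i)) ≤ 4 * pp.ω * pp.bound := by
        intro c c' z z' hc hc' hz hz'
        refine (norm2_mul_le _ _).trans ?_
        have h1 : (norm1 (c - c') : ℝ) ≤ 2 * pp.ω := by exact_mod_cast norm1_chal_sub_le hc hc'
        have h2 : norm2 (fun i => z i - z' i) ≤ 2 * pp.bound := by
          have := norm2_sub_le z z'
          linarith
        calc _ ≤ (2 * pp.ω : ℝ) * (2 * pp.bound) :=
              mul_le_mul h1 h2 (norm2_nonneg _) (by positivity)
          _ = _ := by ring
      have h1 := hm c₁ c₂ z₃ z₁ hc₁ hc₂ n3 n1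
      have h2 := hm c₃ c₁ z₁ z₂ hc₃ hc₁ n1 n2
      refine (norm2_sub_le (fun i => (c₁ - c₂) * (z₃ i - z₁ i))
        (fun i => (c₃ - c₁) * (z₁ i - z₂ i))).trans ?_
      linarith
  funext i
  have hi := congrFun hs0 i
  simp only [extractSIS, Pi.sub_apply, Pi.smul_apply, smul_eq_mul, Pi.zero_apply] at hi
  simp only [Pi.add_apply, Pi.sub_apply, Pi.smul_apply, smul_eq_mul]
  have hinv := pow_invExp_mul hu
  generalize (c₁ - c₂) ^ pp.invExp = b at *
  linear_combination b * hi - (z₃ i - z₁ i) * hinv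

/-- Chinese remaindering: slots can be prescribed independently. -/
theorem slot_surjective_single (k : Fin pp.l) (u : pp.SlotField k) :
    ∃ φ : Slots pp, slot k (invNtt φ) = u ∧ ∀ j, j ≠ k → slot j (invNtt φ) = 0 := by
  classical
  obtain ⟨a, ha⟩ : ∃ a : pp.Rq, slot k a = u := by
    obtain ⟨f, hf⟩ := AdjoinRoot.mk_surjective u
    exact ⟨AdjoinRoot.mk _ f, by rw [slot_mk, hf]⟩
  refine ⟨Function.update 0 k (ntt a k), ?_, ?_⟩
  · rw [slot_eq_ntt, ntt_invNtt, Function.update_self, ← ha, slot_eq_ntt]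
  · intro j hj
    rw [slot_eq_zero_iff, ntt_invNtt, Function.update_of_ne hj]
    rfl

/-- The coefficientwise sum of the slots of a product with a fixed nonzero element is uniform. -/
theorem Ex_unifSlots_sum_le (e : pp.Rq) (he : e ≠ 0) (u : Fin pp.n → pp.W) :
    (Ex pp.unifSlots fun φ => ind ((fun i => ∑ k, ntt (invNtt φ * e) k i) = u)) ≤
      ENNReal.ofReal (1 / (pp.q : ℝ) ^ pp.n) := by
  classical
  let L : Slots pp →+ (Fin pp.n → pp.W) :=
    { toFun := fun φ i => ∑ k, ntt (invNtt φ * e) k i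
      map_zero' := by
        funext i
        have h1 : invNtt (0 : Slots pp) = 0 := map_zero (invNttL pp)
        have h2 : ntt (0 : pp.Rq) = 0 := map_zero (nttL pp)
        rw [h1, zero_mul, h2]
        simp
      map_add' := by
        intro φ ψ
        funext i
        have h1 : invNtt (φ + ψ) = invNtt φ + invNtt ψ := map_add (invNttL pp) φ ψ
        have h2 : ∀ a b : pp.Rq, ntt (a + b) = ntt a + ntt b := map_add (nttL pp)
        rw [h1, add_mul, h2]
        simp [Finset.sum_add_distrib] }
  have hL : Function.Surjective L := by
    intro u
    have : ∃ k, slot k e ≠ 0 := by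
      by_contra hcon
      push Not at hcon
      exact he (slot_ext fun j => by rw [hcon j, map_zero])
    obtain ⟨k, hk⟩ := this
    -- A challenge supported on one slot where `e` is invertible already reaches every target.
    obtain ⟨φ, h1, h2⟩ := slot_surjective_single k
      ((∑ i : Fin pp.n, u i • AdjoinRoot.root (pp.slotMod k) ^ (i : ℕ)) * (slot k e)⁻¹)
    refine ⟨φ, ?_⟩
    funext i
    change ∑ k, ntt (invNtt φ * e) k i = u i
    rw [Finset.sum_eq_single k]
    · rw [ntt_eq_coeff, map_mul, h1, inv_mul_cancel_right₀ hk, coeff_modByMonicHom_sum]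
    · intro j _ hj
      rw [ntt_eq_coeff, map_mul, h2 j hj, zero_mul]
      simp
    · simp
  have := Ex_uniform_fiber_le L hL u
  refine le_trans this (le_of_eq ?_)
  have hq : (0 : ℝ) < pp.q := by exact_mod_cast pp.q_prime.pos
  rw [one_div, ENNReal.ofReal_inv_of_pos (by positivity)]
  congr 1
  rw [ENNReal.ofReal_pow hq.le, ENNReal.ofReal_natCast]
  simp

/-- Consistent transcripts whose bit vector is not binary. -/
theorem Ex_consistent_not_binary_le (x : Stmt pp) (S : Strategy pp) (y r : Fin pp.m → pp.Rq)
    (φ : Slots pp) (b : pp.Rq) (hb : b = S.first.f - x.aBin ⬝ᵥ r) (hbb : b * b ≠ b) :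
    (Ex pp.chal fun c => ind (accepts x (stratTranscript S (φ, c)) ∧ S.third φ c = y + c • r)) ≤
      2 * ENNReal.ofReal pp.slotBound := by
  have : ∃ j, slot j (b * b - b) ≠ 0 := by
    by_contra hcon
    push Not at hcon
    exact hbb (sub_eq_zero.1 (slot_ext fun j => by rw [hcon j, map_zero]))
  obtain ⟨j, hj⟩ := this
  refine (Ex_mono _ fun c => ind_mono ?_).trans (Ex_chal_quadratic_le j (slot j (b * b - b))
    (slot j (x.aBin ⬝ᵥ y - 2 * (x.aBin ⬝ᵥ y) * b + x.aBin' ⬝ᵥ r - S.first.u1))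
    (slot j ((x.aBin ⬝ᵥ y) ^ 2 + x.aBin' ⬝ᵥ y - S.first.u3)) hj)
  rintro ⟨h, hz⟩
  have h3 := h.2.2.1
  simp only [stratTranscript, hz, dotProduct_add, dotProduct_smul, smul_eq_mul] at h3
  rw [← map_pow, ← map_mul, ← map_mul, ← map_add, ← map_add]
  -- On the line, `a_bin·z - c f = a_bin·y - c b`; expanding the quadratic check in `c` leaves
  -- leading coefficient `b² - b`.
  have : (b * b - b) * c ^ 2 + (x.aBin ⬝ᵥ y - 2 * (x.aBin ⬝ᵥ y) * b + x.aBin' ⬝ᵥ r - S.first.u1) * c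
      + ((x.aBin ⬝ᵥ y) ^ 2 + x.aBin' ⬝ᵥ y - S.first.u3) = 0 := by
    subst hb
    linear_combination h3
  rw [this, map_zero]

/-- Consistent transcripts violate the linear equation unless the second message is determined. -/
theorem Ex_consistent_linear_le (x : Stmt pp) (S : Strategy pp) (y r : Fin pp.m → pp.Rq)
    (φ : Slots pp) (D : pp.Rq) (hD : D = invNtt (QT φ) * (S.first.f - x.aBin ⬝ᵥ r)
      - invNtt φ * (x.com1 - x.pk1 ⬝ᵥ r) + (S.first.u2 - x.aG ⬝ᵥ r) - (S.second φ).h)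
    (hD0 : D ≠ 0) :
    (Ex pp.chal fun c => ind (accepts x (stratTranscript S (φ, c)) ∧ S.third φ c = y + c • r)) ≤
      ENNReal.ofReal pp.slotBound := by
  -- On the line, the second verification equation is affine in `c` with slope `D`.
  refine (Ex_mono _ fun c => ind_mono ?_).trans (Ex_chal_linear_le D
    ((S.second φ).u4 - (x.aG ⬝ᵥ y + (x.aBin ⬝ᵥ y) * invNtt (QT φ)
      - (x.pk1 ⬝ᵥ y) * invNtt φ)) hD0)
  rintro ⟨h, hz⟩
  have h4 := h.2.2.2.1
  simp only [stratTranscript, hz, dotProduct_add, dotProduct_smul, smul_eq_mul] at h4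
  subst hD
  linear_combination h4

/-- A binary element has slots given by natural numbers that are `0` or `1`. -/
theorem exists_bits_of_mul_self (b : pp.Rq) (hbb : b * b = b) :
    ∃ β : ℕ → ℕ, (∀ j, β j ≤ 1) ∧
      ∀ j : Fin pp.l, slot j b = algebraMap pp.W _ ((β j : ℕ) : pp.W) := by
  classical
  have hslot : ∀ j : Fin pp.l, slot j b = 0 ∨ slot j b = 1 := by
    intro j
    have := congrArg (slot j) hbb
    rw [map_mul] at this
    by_cases h0 : slot j b = 0
    · exact Or.inl h0
    · exact Or.inr (mul_left_cancel₀ h0 (this.trans (mul_one _).symm))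
  -- The value `0` for indices from `l` on is a filler: only the first `64 ≤ l` bits are used later.
  refine ⟨fun j => if h : j < pp.l then (if slot ⟨j, h⟩ b = 0 then 0 else 1) else 0, ?_, ?_⟩
  · intro j
    dsimp only
    split_ifs <;> omega
  · intro j
    simp only [j.2, dif_pos]
    rcases hslot j with h | h
    · rw [if_pos h, h]; simp
    · rw [if_neg (by rw [h]; exact one_ne_zero), h]; simp

theorem sum_two_pow_mul_lt (β : ℕ → ℕ) (hβ : ∀ j, β j ≤ 1) (k : ℕ) :
    ∑ j ∈ Finset.range k, 2 ^ j * β j < 2 ^ k := by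
  induction k with
  | zero => simp
  | succ k ih =>
    rw [Finset.sum_range_succ, pow_succ]
    have := Nat.mul_le_mul_left (2 ^ k) (hβ k)
    omega

/-- Consistent transcripts of a prover whose opening is not a 64-bit integer. -/
theorem Ex_consistent_le (x : Stmt pp) (S : Strategy pp) (y r : Fin pp.m → pp.Rq)
    (hr : ¬ ∃ v : ℕ, v < 2 ^ 64 ∧ x.com1 - x.pk1 ⬝ᵥ r = (v : pp.Rq)) :
    (Ex pp.challenges fun t => ind (accepts x (stratTranscript S t) ∧
      S.third t.1 t.2 = y + t.2 • r)) ≤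
      2 * ENNReal.ofReal pp.slotBound + ENNReal.ofReal (1 / (pp.q : ℝ) ^ pp.n) := by
  rw [Ex_challenges]
  obtain ⟨b, hb⟩ : ∃ b, b = S.first.f - x.aBin ⬝ᵥ r := ⟨_, rfl⟩
  by_cases hbb : b * b = b
  · obtain ⟨β, hβ1, hβ⟩ := exists_bits_of_mul_self b hbb
    obtain ⟨v, hv⟩ : ∃ v, v = ∑ j ∈ Finset.range 64, 2 ^ j * β j := ⟨_, rfl⟩
    have hvlt : v < 2 ^ 64 := hv ▸ sum_two_pow_mul_lt β hβ1 64
    obtain ⟨m₁, hm₁⟩ : ∃ m₁, m₁ = x.com1 - x.pk1 ⬝ᵥ r := ⟨_, rfl⟩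
    obtain ⟨g, hg⟩ : ∃ g, g = S.first.u2 - x.aG ⬝ᵥ r := ⟨_, rfl⟩
    -- The integer `v` encoded by the bits is below `2 ^ 64`, and the opened message is assumed not
    -- to be such an integer.
    have he0 : (v : pp.Rq) - m₁ ≠ 0 := by
      intro h
      exact hr ⟨v, hvlt, by rw [← hm₁, ← sub_eq_zero.1 h]⟩
    have hv2 : algebraMap pp.W pp.Rq (∑ j ∈ Finset.range 64, 2 ^ j * ((β j : ℕ) : pp.W)) = (v : pp.Rq) := by
      rw [← map_natCast (algebraMap pp.W pp.Rq), hv]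
      push_cast
      rfl
    -- If the slope `D` is nonzero, few challenges `c` satisfy the linear equation. If `D = 0`, then
    -- `h` is determined, and its vanishing head becomes, through slot sums, an affine equation in
    -- `φ` with linear part multiplication by `v - m₁`. The elements `b`, `m₁`, `g` do not depend on
    -- `φ`, since the first message and `r` are fixed beforehand.
    have hstep : ∀ φ : Slots pp, (Ex pp.chal fun c => ind (accepts x (stratTranscript S (φ, c)) ∧
        S.third φ c = y + c • r)) ≤ ENNReal.ofReal pp.slotBound +
        ind ((fun i => ∑ k, ntt (invNtt φ * ((v : pp.Rq) - m₁)) k i) = fun i : Fin pp.n =>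
          -(pp.l * coef g (Fin.castLE n_le_d i))) := by
      intro φ
      obtain ⟨D, hD⟩ : ∃ D, D = invNtt (QT φ) * b - invNtt φ * m₁ + g - (S.second φ).h := ⟨_, rfl⟩
      by_cases hD0 : D = 0
      · by_cases hh : ∀ k : Fin pp.d, (k : ℕ) < pp.n → coef (S.second φ).h k = 0
        · refine le_trans ?_ le_add_self
          refine (Ex_ind_le_one _ _).trans (le_of_eq (ind_of_true ?_).symm)
          funext i
          have h1 := sum_ntt_QT φ b m₁ (fun j => ((β j : ℕ) : pp.W)) hβ i
          rw [hv2] at h1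
          rw [← h1]
          have h3 : invNtt (QT φ) * b - invNtt φ * m₁ = (S.second φ).h - g := by
            linear_combination hD0 - hD
          have h4 := sum_ntt ((S.second φ).h - g) (Fin.castLE n_le_d i) i.2
          rw [h3]
          refine h4.trans ?_
          rw [coef_sub, Pi.sub_apply, hh _ i.2]
          ring
        · have : (Ex pp.chal fun c => ind (accepts x (stratTranscript S (φ, c)) ∧
              S.third φ c = y + c • r)) = Ex pp.chal fun _ => 0 := by
            congr 1; funext c
            apply ind_of_false
            rintro ⟨h, -⟩
            exact hh h.2.2.2.2
          rw [this, Ex_const]; exact zero_le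
      · subst hb hm₁ hg
        exact (Ex_consistent_linear_le x S y r φ D hD hD0).trans le_self_add
    refine (Ex_mono _ hstep).trans ?_
    rw [Ex_add, Ex_const, two_mul]
    exact add_le_add le_self_add (Ex_unifSlots_sum_le _ he0 _)
  · refine le_trans ?_ le_self_add
    rw [← Ex_const pp.unifSlots (2 * ENNReal.ofReal pp.slotBound)]
    exact Ex_mono _ fun φ => Ex_consistent_not_binary_le x S y r φ b hb hbb

end Params
end
end PoA

/-! ### Success probability of the three-run extraction -/

namespace PoA
noncomputable section
namespace Params

variable {pp : Params}

/-- Success of the extraction from three runs. -/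
def extractionGood (x : Stmt pp) (S : Strategy pp) (t₁ t₂ t₃ : Slots pp × pp.Rq) : Prop :=
  rel x (extractOpening x t₁.2 t₂.2 (S.third t₁.1 t₁.2) (S.third t₂.1 t₂.2)) ∨
    solvesMSIS x.A (8 * pp.ω * pp.bound) (extractSIS t₁.2 t₂.2 t₃.2
      (S.third t₁.1 t₁.2) (S.third t₂.1 t₂.2) (S.third t₃.1 t₃.2))

/-- Probability of acceptance of a deterministic prover. -/
def acceptProb (x : Stmt pp) (S : Strategy pp) : ℝ≥0∞ :=
  Ex pp.challenges fun t => ind (accepts x (stratTranscript S t))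

variable (pp) in
/-- Error of the final extraction step. -/
def consistentError : ℝ≥0∞ :=
  2 * ENNReal.ofReal pp.slotBound + ENNReal.ofReal (1 / (pp.q : ℝ) ^ pp.n)

/-- The candidate opening, and the line on which a consistent response must lie, are fixed before
the third run. If the opening fails, only because its message is no 64-bit integer, an accepting
third run is either a SIS solution or one of the rare consistent ones. -/
theorem third_run_le {x : Stmt pp} {S : Strategy pp} {t₁ t₂ : Slots pp × pp.Rq}
    (h₁ : accepts x (stratTranscript S t₁)) (h₂ : accepts x (stratTranscript S t₂))
    (hc₁ : t₁.2 ∈ pp.chal.support) (hc₂ : t₂.2 ∈ pp.chal.support) (hu : IsUnit (t₁.2 - t₂.2)) :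
    acceptProb x S - pp.consistentError ≤
      Ex pp.challenges fun t₃ => ind (extractionGood x S t₁ t₂ t₃) := by
  by_cases hrel : rel x (extractOpening x t₁.2 t₂.2 (S.third t₁.1 t₁.2) (S.third t₂.1 t₂.2))
  · have : (Ex pp.challenges fun t₃ => ind (extractionGood x S t₁ t₂ t₃)) = 1 := by
      rw [← Ex_const pp.challenges 1]
      congr 1; funext t₃
      exact ind_of_true (Or.inl hrel)
    rw [this]
    exact tsub_le_self.trans (Ex_ind_le_one _ _)
  · rw [tsub_le_iff_right]
    set r := (extractOpening x t₁.2 t₂.2 (S.third t₁.1 t₁.2) (S.third t₂.1 t₂.2)).r with hr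
    have hno : ¬ ∃ v : ℕ, v < 2 ^ 64 ∧ x.com1 - x.pk1 ⬝ᵥ r = (v : pp.Rq) := fun hv =>
      hrel (rel_extractOpening h₁ h₂ hc₁ hc₂ hu hv)
    refine le_trans ?_ (add_le_add_right
      (Ex_consistent_le x S (S.third t₁.1 t₁.2 - t₁.2 • r) r hno) _)
    rw [← Ex_add]
    refine Ex_mono' _ fun t₃ ht₃ => ?_
    by_cases h₃ : accepts x (stratTranscript S t₃)
    · by_cases hs : solvesMSIS x.A (8 * pp.ω * pp.bound) (extractSIS t₁.2 t₂.2 t₃.2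
        (S.third t₁.1 t₁.2) (S.third t₂.1 t₂.2) (S.third t₃.1 t₃.2))
      · rw [ind_of_true (show extractionGood x S t₁ t₂ t₃ from Or.inr hs)]
        exact (ind_le_one _).trans le_self_add
      · have := third_consistent h₁ h₂ h₃ hc₁ hc₂ (challenges_support ht₃) hu hs
        refine le_trans ?_ le_add_self
        exact ind_mono fun h => ⟨h, this⟩
    · rw [ind_of_false h₃]; exact zero_le

theorem second_run_le (x : Stmt pp) (S : Strategy pp) (c₁ : pp.Rq) :
    acceptProb x S - ENNReal.ofReal (pp.l * pp.slotBound) ≤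
      Ex pp.challenges fun t => ind (accepts x (stratTranscript S t) ∧ IsUnit (c₁ - t.2)) := by
  rw [tsub_le_iff_right]
  have h : (Ex pp.challenges fun t => ind (¬ IsUnit (c₁ - t.2))) ≤
      ENNReal.ofReal (pp.l * pp.slotBound) := by
    rw [Ex_challenges, ← Ex_const pp.unifSlots (ENNReal.ofReal _)]
    exact Ex_mono _ fun φ => Ex_chal_not_unit_le c₁
  refine le_trans ?_ (add_le_add_right h _)
  rw [← Ex_add]
  refine Ex_mono _ fun t => ?_
  refine le_trans (ind_mono fun h => ?_) (ind_or_le _ _)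
  by_cases hu : IsUnit (c₁ - t.2)
  · exact Or.inl ⟨h, hu⟩
  · exact Or.inr hu

/-- The three runs draw fresh challenges for both rounds, so the three factors come from independent
draws and no forking lemma is needed. -/
theorem extraction_prob (x : Stmt pp) (S : Strategy pp) :
    (acceptProb x S - pp.consistentError) *
      ((acceptProb x S - ENNReal.ofReal (pp.l * pp.slotBound)) * acceptProb x S) ≤
    Ex pp.challenges fun t₁ => Ex pp.challenges fun t₂ => Ex pp.challenges fun t₃ =>
      ind (extractionGood x S t₁ t₂ t₃) := by
  set a := acceptProb x S with ha
  have e : (a - pp.consistentError) * ((a - ENNReal.ofReal (pp.l * pp.slotBound)) * a) =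
      Ex pp.challenges fun t₁ => (a - pp.consistentError) *
        ((a - ENNReal.ofReal (pp.l * pp.slotBound)) * ind (accepts x (stratTranscript S t₁))) := by
    rw [Ex_mul_left, Ex_mul_left]
    rfl
  rw [e]
  refine Ex_mono' _ fun t₁ ht₁ => ?_
  by_cases h₁ : accepts x (stratTranscript S t₁)
  · rw [ind_of_true h₁, mul_one]
    refine (mul_le_mul_right (second_run_le x S t₁.2) _).trans ?_
    rw [← Ex_mul_left]
    refine Ex_mono' _ fun t₂ ht₂ => ?_
    by_cases h₂ : accepts x (stratTranscript S t₂) ∧ IsUnit (t₁.2 - t₂.2)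
    · rw [ind_of_true h₂, mul_one]
      exact third_run_le h₁ h₂.1 (challenges_support ht₁) (challenges_support ht₂) h₂.2
    · rw [ind_of_false h₂, mul_zero]; exact zero_le
  · rw [ind_of_false h₁, mul_zero, mul_zero]; exact zero_le

variable (pp) in
/-- The knowledge error. -/
def knowledgeError : ℝ := 2 * ((pp.l + 3) / (pp.q : ℝ) ^ (pp.d / pp.l)) + 2 * pp.ε

/-- The summand `3` in `l + 3` leaves room for the term `q ^ (-n)` of the final step; its `2 *
slotBound` is below `l * slotBound`. -/
theorem error_bounds (h : pp.q * pp.ε ≤ 1) :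
    ENNReal.ofReal (pp.l * pp.slotBound) ≤ ENNReal.ofReal pp.knowledgeError ∧
    pp.consistentError ≤ ENNReal.ofReal pp.knowledgeError := by
  have h1 := slotBound_le h
  have hM := slotBound_nonneg (pp := pp)
  have hε := ε_nonneg (pp := pp)
  have hq : (0 : ℝ) < pp.q := by exact_mod_cast pp.q_prime.pos
  have hl : (64 : ℝ) ≤ pp.l := by exact_mod_cast pp.l_ge
  have e : pp.knowledgeError = 2 * (pp.l / (pp.q : ℝ) ^ pp.n) + 6 * (1 / (pp.q : ℝ) ^ pp.n)
      + 2 * pp.ε := by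
    unfold knowledgeError; ring
  have hqn : 0 ≤ 1 / (pp.q : ℝ) ^ pp.n := by positivity
  constructor
  · apply ENNReal.ofReal_le_ofReal
    rw [e]; linarith
  · unfold consistentError
    rw [show (2 : ℝ≥0∞) = ENNReal.ofReal 2 by simp, ← ENNReal.ofReal_mul (by norm_num),
      ← ENNReal.ofReal_add (by positivity) hqn]
    apply ENNReal.ofReal_le_ofReal
    rw [e]
    nlinarith

theorem knowledgeError_nonneg : 0 ≤ pp.knowledgeError := by
  have hε := ε_nonneg (pp := pp)
  unfold knowledgeError
  positivity

/-- The extraction succeeds with at least the cube of the advantage, linearised. -/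
theorem extraction_tangent (h : pp.q * pp.ε ≤ 1) (x : Stmt pp) (S : Strategy pp) (μ : ℝ)
    (hμ : 0 ≤ μ) :
    ENNReal.ofReal (3 * μ ^ 2) * acceptProb x S ≤
    (Ex pp.challenges fun t₁ => Ex pp.challenges fun t₂ => Ex pp.challenges fun t₃ =>
      ind (extractionGood x S t₁ t₂ t₃)) +
      ENNReal.ofReal (3 * μ ^ 2 * pp.knowledgeError + 2 * μ ^ 3) := by
  obtain ⟨h1, h2⟩ := error_bounds h
  have hE := knowledgeError_nonneg (pp := pp)
  refine le_trans ?_ (add_le_add_left (extraction_prob x S) _)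
  have ha : acceptProb x S ≠ ∞ := Ex_ind_ne_top _ _
  obtain ⟨a, ha0, hae⟩ : ∃ a : ℝ, 0 ≤ a ∧ acceptProb x S = ENNReal.ofReal a :=
    ⟨_, ENNReal.toReal_nonneg, (ENNReal.ofReal_toReal ha).symm⟩
  rw [hae]
  have h3 : ENNReal.ofReal (a - pp.knowledgeError) ≤ ENNReal.ofReal a - pp.consistentError := by
    rw [ENNReal.ofReal_sub _ hE]; exact tsub_le_tsub_left h2 _
  have h4 : ENNReal.ofReal (a - pp.knowledgeError) ≤
      ENNReal.ofReal a - ENNReal.ofReal (pp.l * pp.slotBound) := by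
    rw [ENNReal.ofReal_sub _ hE]; exact tsub_le_tsub_left h1 _
  have h5 : ENNReal.ofReal (a - pp.knowledgeError) ≤ ENNReal.ofReal a :=
    ENNReal.ofReal_le_ofReal (by linarith)
  refine le_trans ?_ (add_le_add_left (mul_le_mul' h3 (mul_le_mul' h4 h5)) _)
  set E := pp.knowledgeError
  rcases le_or_gt E a with hle | hlt
  · have ht : 0 ≤ a - E := by linarith
    rw [← ENNReal.ofReal_mul ht, ← ENNReal.ofReal_mul ht, ← ENNReal.ofReal_mul (by positivity),
      ← ENNReal.ofReal_add (by positivity) (by positivity)]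
    apply ENNReal.ofReal_le_ofReal
    set t := a - E with htd
    have : a = t + E := by rw [htd]; ring
    rw [this]
    -- `t³ - 3μ²t + 2μ³ = (t - μ)²(t + 2μ)`: the cube lies above its tangent at `μ`.
    nlinarith [mul_nonneg (sq_nonneg (t - μ)) (by linarith : 0 ≤ t + 2 * μ)]
  -- Below the knowledge error the left side is at most `3μ²E`, so the additive term alone suffices.
  · refine le_trans ?_ le_add_self
    rw [← ENNReal.ofReal_mul (by positivity)]
    apply ENNReal.ofReal_le_ofReal
    have := mul_le_mul_of_nonneg_left hlt.le (by positivity : 0 ≤ 3 * μ ^ 2)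
    have h6 : 0 ≤ 2 * μ ^ 3 := by positivity
    linarith

/-- Extraction from a randomized prover. -/
theorem extraction_cube (h : pp.q * pp.ε ≤ 1) (x : Stmt pp) (Ps : PMF (Strategy pp))
    (ha : pp.knowledgeError < prob (Ps.bind runStrategy) (accepts x)) :
    (prob (Ps.bind runStrategy) (accepts x) - pp.knowledgeError) ^ 3 ≤
    (Ex Ps fun S => Ex pp.challenges fun t₁ => Ex pp.challenges fun t₂ => Ex pp.challenges fun t₃ =>
      ind (extractionGood x S t₁ t₂ t₃)).toReal := by
  have hE := knowledgeError_nonneg (pp := pp)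
  have hacc : (Ex (Ps.bind runStrategy) fun t => ind (accepts x t)) = Ex Ps (acceptProb x) := by
    rw [Ex_bind]
    congr 1; funext S
    rw [runStrategy_eq, Ex_map]
    rfl
  have hA : Ex Ps (acceptProb x) ≠ ∞ := by
    rw [← hacc]; exact Ex_ind_ne_top _ _
  rw [prob_eq, hacc] at ha ⊢
  set a := (Ex Ps (acceptProb x)).toReal with had
  set μ := a - pp.knowledgeError with hμd
  have hμ : 0 ≤ μ := by linarith
  set p := Ex Ps fun S => Ex pp.challenges fun t₁ => Ex pp.challenges fun t₂ =>
    Ex pp.challenges fun t₃ => ind (extractionGood x S t₁ t₂ t₃) with hp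
  have hp1 : p ≠ ∞ := by
    refine ne_top_of_le_ne_top ENNReal.one_ne_top ?_
    exact Ex_le_one _ fun _ => Ex_le_one _ fun _ => Ex_le_one _ fun _ => Ex_ind_le_one _ _
  -- Jensen's inequality by hand: the tangent is taken at the mean advantage `μ`, and an affine
  -- lower bound can be averaged over the coins of the prover.
  have key := Ex_mono Ps fun S => extraction_tangent h x S μ hμ
  rw [Ex_mul_left, Ex_add, Ex_const, ← hp] at key
  have key' := ENNReal.toReal_mono (ENNReal.add_ne_top.2 ⟨hp1, ENNReal.ofReal_ne_top⟩) key
  rw [ENNReal.toReal_mul, ENNReal.toReal_add hp1 ENNReal.ofReal_ne_top,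
    ENNReal.toReal_ofReal (by positivity), ENNReal.toReal_ofReal (by positivity), ← had] at key'
  have : a = μ + pp.knowledgeError := by rw [hμd]; ring
  rw [this] at key'
  nlinarith

end Params
end
end PoA

namespace PoA
noncomputable section

/-! ## Functions computed by small circuits: wires -/

/-- Answers of the oracles of a signature. -/
abbrev Answers (pp : Params) (S : OracleSig) : Type :=
  ∀ s : S.Call, (S.In s → pp.W) → (S.Out s → pp.W)

/-- Renaming of the wires of a gate. -/
def Gate.rename {q : ℕ} {ι ι' : Type} (f : ι → ι') : Gate q ι → Gate q ι'
  | .const a => .const a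
  | .add i j => .add (f i) (f j)
  | .mul i j => .mul (f i) (f j)
  | .bit k i => .bit k (f i)
  | .ite i j k => .ite (f i) (f j) (f k)
  | .unif => .unif
  | .drawSecret => .drawSecret
  | .drawChallenge => .drawChallenge
  | .drawGauss => .drawGauss

theorem Gate.run_rename (pp : Params) {ι ι' : Type} (f : ι → ι') (g : Gate pp.q ι)
    (x : ι' → pp.W) : (g.rename f).run pp x = g.run pp fun i => x (f i) := by
  cases g <;> rfl

/-- A circuit acting on some of the wires. -/
def Circuit.frame {q : ℕ} {S : OracleSig} (c : Type) :
    {a b : Type} → Circuit q S a b → Circuit q S (a ⊕ c) (b ⊕ c)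
  | _, _, .wire σ => .wire (Sum.map σ id)
  | _, _, .gate g => .seq (.gate (g.rename Sum.inl)) (.wire fun i => match i with
      | .inl none => none
      | .inl (some i) => some (.inl i)
      | .inr k => some (.inr k))
  | _, _, .call s σ => .seq (.call s fun i => .inl (σ i)) (.wire fun i => match i with
      | .inl (.inl i) => .inl (.inl i)
      | .inl (.inr i) => .inr i
      | .inr k => .inl (.inr k))
  | _, _, .seq C D => .seq (C.frame c) (D.frame c)

theorem Circuit.size_frame {q : ℕ} {S : OracleSig} (c : Type) {a b : Type} (C : Circuit q S a b) :
    (C.frame c).size = C.size := by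
  induction C with
  | wire σ => rfl
  | gate g => rfl
  | call s σ => rfl
  | seq C D hC hD => simp [frame, size, hC, hD]

theorem Circuit.run_frame (pp : Params) {S : OracleSig} (O : Answers pp S) (c : Type) {a b : Type}
    (C : Circuit pp.q S a b) (x : a → pp.W) (y : c → pp.W) :
    (C.frame c).run pp O (Sum.elim x y) = (C.run pp O x).map fun z => Sum.elim z y := by
  induction C with
  | wire σ =>
    simp only [frame, run, PMF.pure_map]
    congr 1; funext i
    cases i <;> rfl
  | gate g =>
    simp only [frame, run, Gate.run_rename, Sum.elim_inl]
    rw [PMF.bind_map, PMF.map_comp, ← PMF.bind_pure_comp]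
    congr 1; funext w
    simp only [Function.comp]
    congr 1; funext i
    rcases i with (_ | i) | k <;> rfl
  | call s σ =>
    simp only [frame, run, PMF.pure_map, PMF.pure_bind, Sum.elim_inl]
    congr 1; funext i
    rcases i with (i | i) | k <;> rfl
  | seq C D hC hD =>
    simp only [frame, run]
    rw [hC, PMF.map_bind, PMF.bind_map]
    congr 1; funext z
    exact hD z

section raw

variable (pp : Params) {S : OracleSig} {Ω : Type*} (O : Ω → Answers pp S)

/-- `F` is computed by a circuit of size at most `N`. -/
def RComp {a b : Type} (N : ℕ) (F : Ω → (a → pp.W) → PMF (b → pp.W)) : Prop :=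
  ∃ C : Circuit pp.q S a b, C.size ≤ N ∧ ∀ o x, C.run pp (O o) x = F o x

variable {pp O}

theorem RComp.wire {a b : Type} (σ : b → a) :
    RComp pp O 0 fun _ (x : a → pp.W) => PMF.pure fun i => x (σ i) :=
  ⟨.wire σ, le_rfl, fun _ _ => rfl⟩

theorem RComp.mono {a b : Type} {N M : ℕ} {F : Ω → (a → pp.W) → PMF (b → pp.W)}
    (h : RComp pp O N F) (hNM : N ≤ M) : RComp pp O M F := by
  obtain ⟨C, hC, hF⟩ := h
  exact ⟨C, hC.trans hNM, hF⟩

theorem RComp.congr {a b : Type} {N : ℕ} {F G : Ω → (a → pp.W) → PMF (b → pp.W)}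
    (h : RComp pp O N F) (hFG : ∀ o x, F o x = G o x) : RComp pp O N G := by
  obtain ⟨C, hC, hF⟩ := h
  exact ⟨C, hC, fun o x => (hF o x).trans (hFG o x)⟩

theorem RComp.seq {a b c : Type} {N M : ℕ} {F : Ω → (a → pp.W) → PMF (b → pp.W)}
    {G : Ω → (b → pp.W) → PMF (c → pp.W)} (hF : RComp pp O N F) (hG : RComp pp O M G) :
    RComp pp O (N + M) fun o x => (F o x).bind (G o) := by
  obtain ⟨C, hC, hF⟩ := hF
  obtain ⟨D, hD, hG⟩ := hG
  refine ⟨.seq C D, Nat.add_le_add hC hD, fun o x => ?_⟩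
  simp only [Circuit.run]
  rw [hF]
  congr 1; funext y
  exact hG o y

/-- Renaming before and after. -/
theorem RComp.rewire {a a' b b' : Type} {N : ℕ} {F : Ω → (a → pp.W) → PMF (b → pp.W)}
    (h : RComp pp O N F) (σ : a → a') (τ : b' → b) :
    RComp pp O N fun o (x : a' → pp.W) => (F o fun i => x (σ i)).map fun y i => y (τ i) := by
  refine (((RComp.wire σ).seq h).seq (RComp.wire τ)).mono (by omega) |>.congr fun o x => ?_
  rw [PMF.pure_bind]
  rfl

theorem RComp.frame {a b : Type} (c : Type) {N : ℕ} {F : Ω → (a → pp.W) → PMF (b → pp.W)}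
    (h : RComp pp O N F) :
    RComp pp O N fun o (x : a ⊕ c → pp.W) =>
      (F o fun i => x (.inl i)).map fun y => Sum.elim y fun i => x (.inr i) := by
  obtain ⟨C, hC, hF⟩ := h
  refine ⟨C.frame c, (C.size_frame c).le.trans hC, fun o x => ?_⟩
  have hx : x = Sum.elim (fun i => x (.inl i)) (fun i => x (.inr i)) := by
    funext i; cases i <;> rfl
  conv_lhs => rw [hx, Circuit.run_frame, hF]

/-- Keeping the inputs. -/
theorem RComp.keep {a b : Type} {N : ℕ} {F : Ω → (a → pp.W) → PMF (b → pp.W)}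
    (h : RComp pp O N F) :
    RComp pp O N fun o (x : a → pp.W) => (F o x).map fun y => Sum.elim x y := by
  refine ((h.frame a).rewire (a' := a) (b' := a ⊕ b) (Sum.elim id id) Sum.swap).congr fun o x => ?_
  rw [PMF.map_comp]
  congr 1; funext y i
  cases i <;> rfl

theorem RComp.gate {a : Type} (g : Gate pp.q a) :
    RComp pp O 1 fun _ x => (g.run pp x).map fun w (_ : Unit) => w := by
  refine ⟨.seq (.gate g) (.wire fun _ => none), le_rfl, fun o x => ?_⟩
  simp only [Circuit.run]
  rw [PMF.bind_map, ← PMF.bind_pure_comp]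
  rfl

variable (pp O) in
/-- A scalar function of the wires computed by a deterministic circuit. -/
def Sc {a : Type} (N : ℕ) (f : (a → pp.W) → pp.W) : Prop :=
  RComp pp O N fun _ x => PMF.pure fun _ : Unit => f x

theorem Sc.mono {a : Type} {N M : ℕ} {f : (a → pp.W) → pp.W} (h : Sc pp O N f) (hNM : N ≤ M) :
    Sc pp O M f := RComp.mono h hNM

theorem Sc.var {a : Type} (i : a) : Sc pp O 0 fun x => x i := RComp.wire fun _ => i

theorem Sc.const {a : Type} (c : pp.W) : Sc pp O 1 fun _ : a → pp.W => c :=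
  (RComp.gate (.const c)).congr fun o x => by simp only [Gate.run, PMF.pure_map]

theorem RComp.detPair {a b c : Type} {N M : ℕ} {f : (a → pp.W) → (b → pp.W)}
    {g : (a → pp.W) → (c → pp.W)} (hf : RComp pp O N fun _ x => PMF.pure (f x))
    (hg : RComp pp O M fun _ x => PMF.pure (g x)) :
    RComp pp O (N + M) fun _ x => PMF.pure (Sum.elim (f x) (g x)) := by
  refine (hf.keep.seq ((hg.frame b).rewire id Sum.swap)).congr fun o x => ?_
  simp only [PMF.pure_map, PMF.pure_bind]
  congr 1; funext i
  cases i <;> rfl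

theorem Sc.binop {a : Type} {N M : ℕ} {f g : (a → pp.W) → pp.W} (hf : Sc pp O N f)
    (hg : Sc pp O M g) (op : pp.W → pp.W → pp.W) (gt : Gate pp.q (Unit ⊕ Unit))
    (h : ∀ x, gt.run pp x = PMF.pure (op (x (.inl ())) (x (.inr ())))) :
    Sc pp O (N + M + 1) fun x => op (f x) (g x) := by
  refine ((RComp.detPair hf hg).seq (RComp.gate gt)).congr fun o x => ?_
  rw [PMF.pure_bind, h, PMF.pure_map]
  rfl

theorem Sc.add {a : Type} {N M : ℕ} {f g : (a → pp.W) → pp.W} (hf : Sc pp O N f)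
    (hg : Sc pp O M g) : Sc pp O (N + M + 1) fun x => f x + g x :=
  hf.binop hg (· + ·) (.add (.inl ()) (.inr ())) fun _ => rfl

theorem Sc.mul {a : Type} {N M : ℕ} {f g : (a → pp.W) → pp.W} (hf : Sc pp O N f)
    (hg : Sc pp O M g) : Sc pp O (N + M + 1) fun x => f x * g x :=
  hf.binop hg (· * ·) (.mul (.inl ()) (.inr ())) fun _ => rfl

theorem Sc.sum {a ι : Type} {N : ℕ} (s : Finset ι) {f : ι → (a → pp.W) → pp.W}
    (h : ∀ i, Sc pp O N (f i)) : Sc pp O (s.card * (N + 1) + 1) fun x => ∑ i ∈ s, f i x := by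
  classical
  induction s using Finset.induction_on with
  | empty => simpa using Sc.const 0
  | insert i s hi ih =>
    simp_rw [Finset.sum_insert hi]
    refine ((h i).add ih).mono ?_
    rw [Finset.card_insert_of_notMem hi]
    linarith

theorem RComp.pi {a b : Type} [Fintype b] {N : ℕ} {f : b → (a → pp.W) → pp.W}
    (h : ∀ j, Sc pp O N (f j)) :
    RComp pp O (Fintype.card b * N + 1) fun _ x => PMF.pure fun j => f j x := by
  classical
  -- Outputs are filled in one at a time with the inputs kept alive; unfilled ones are copies of a
  -- single zero gate, whence the `+ 1`.
  have key : ∀ s : Finset b, RComp pp O (s.card * N + 1) fun _ x =>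
      PMF.pure (Sum.elim x fun j => if j ∈ s then f j x else 0) := by
    intro s
    induction s using Finset.induction_on with
    | empty =>
      have h0 : Sc pp O 1 fun _ : a → pp.W => 0 := Sc.const 0
      refine ((RComp.keep h0).rewire (b' := a ⊕ b) id (Sum.map id fun _ => ())).mono (by simp)
        |>.congr fun o x => ?_
      rw [PMF.pure_map, PMF.pure_map]
      congr 1; funext i
      cases i <;> simp
    | insert j s hj ih =>
      have h1 : RComp pp O N fun _ (x : a ⊕ b → pp.W) =>
          PMF.pure fun _ : Unit => f j fun i => x (.inl i) :=
        (RComp.rewire (h j) (Sum.inl : a → a ⊕ b) id).congr fun o x => by rw [PMF.pure_map]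
      have h2 := h1.keep.rewire (b' := a ⊕ b) id
        (Sum.elim (fun i => .inl (.inl i)) fun j' => if j' = j then .inr () else .inl (.inr j'))
      refine (ih.seq h2).mono ?_ |>.congr fun o x => ?_
      · rw [Finset.card_insert_of_notMem hj]; linarith
      · rw [PMF.pure_bind, PMF.pure_map, PMF.pure_map]
        congr 1; funext i
        rcases i with i | j'
        · rfl
        · by_cases hjj : j' = j
          · subst hjj; simp
          · simp [hjj]
  refine ((key Finset.univ).rewire id Sum.inr).congr fun o x => ?_
  rw [PMF.pure_map]
  congr 1; funext j
  simp

/-- Linear maps are computed by circuits of quadratic size. -/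
theorem RComp.linear {a b : Type} [Fintype a] [Fintype b] (L : (a → pp.W) →ₗ[pp.W] (b → pp.W)) :
    RComp pp O (Fintype.card b * (Fintype.card a * 3 + 1) + 1) fun _ x => PMF.pure (L x) := by
  classical
  refine (RComp.pi (f := fun j x => ∑ i, x i * L (Pi.single i 1) j) fun j => ?_).congr fun o x => ?_
  · refine (Sc.sum (N := 2) Finset.univ fun i => ?_)
    exact ((Sc.var i).mul (Sc.const _))
  · congr 1; funext j
    have := LinearMap.pi_apply_eq_sum_univ L x
    rw [this, Finset.sum_apply]
    refine Finset.sum_congr rfl fun i _ => ?_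
    rw [Pi.smul_apply, smul_eq_mul]
    have e : (Pi.single i 1 : a → pp.W) = fun k => if i = k then 1 else 0 := by
      funext k
      simp [Pi.single_apply, eq_comm]
    rw [e]

/-! ### Sampling -/

variable (pp O) in
/-- A distribution sampled by a circuit. -/
def RSamp {b : Type} (N : ℕ) (μ : PMF (b → pp.W)) : Prop :=
  RComp pp O N fun _ (_ : Empty → pp.W) => μ

theorem RSamp.gate {g : Gate pp.q Empty} {μ : PMF pp.W} (h : ∀ x, g.run pp x = μ) :
    RSamp pp O 1 (μ.map fun w (_ : Unit) => w) :=
  (RComp.gate g).congr fun o x => by rw [h]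

theorem RSamp.comp {a b : Type} {N : ℕ} {μ : PMF (b → pp.W)} (h : RSamp pp O N μ) :
    RComp pp O N fun _ (_ : a → pp.W) => μ := by
  refine (RComp.rewire h (fun e : Empty => e.elim) id).congr fun o x => ?_
  exact PMF.map_id _

theorem RSamp.iid {b : Type} {N : ℕ} {μ : PMF (b → pp.W)} (h : RSamp pp O N μ) (r : ℕ) :
    RSamp pp O (r * N) ((iid μ r).map fun v (p : Fin r × b) => v p.1 p.2) := by
  induction r with
  | zero =>
    refine ((RComp.wire fun p : Fin 0 × b => p.1.elim0).mono (by simp)).congr fun o x => ?_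
    simp only [PoA.iid, PMF.pure_map]
    congr 1; funext p
    exact p.1.elim0
  | succ r ih =>
    have h1 := (RSamp.comp (a := b) ih).keep.rewire (b' := Fin (r + 1) × b) id
      (fun p => Fin.cases (motive := fun _ => b ⊕ (Fin r × b)) (.inl p.2) (fun i => .inr (i, p.2)) p.1)
    refine ((RComp.seq h h1).mono (by linarith)).congr fun o x => ?_
    simp only [PoA.iid]
    rw [PMF.map_bind]
    congr 1; funext w
    rw [PMF.map_comp, PMF.map_comp, PMF.map_comp]
    congr 1; funext v p
    rcases p with ⟨i, j⟩
    refine Fin.cases ?_ (fun i => ?_) i <;> rfl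

end raw

end

end PoA

namespace PoA
noncomputable section

open Params

/-! ## Functions computed by small circuits: encoded data -/

/-- Encodings for which words and data correspond bijectively. -/
class LawfulEnc {q : outParam ℕ} (α : Type) [WordEnc q α] : Prop where
  dec_enc : ∀ a : α, WordEnc.dec (WordEnc.enc a) = a
  enc_dec : ∀ w : Wire α → ZMod q, WordEnc.enc (WordEnc.dec w : α) = w

section lawful

variable {pp : Params}

instance : LawfulEnc pp.Rq := ⟨ofCoef_coef, coef_ofCoef⟩

instance : LawfulEnc (Slots pp) := ⟨fun _ => rfl, fun _ => rfl⟩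

instance {q : ℕ} {α : Type} [WordEnc q α] [LawfulEnc α] {r : ℕ} : LawfulEnc (Fin r → α) where
  dec_enc a := by funext j; exact LawfulEnc.dec_enc (a j)
  enc_dec w := by
    funext ⟨j, i⟩
    exact congrFun (LawfulEnc.enc_dec (α := α) fun i => w (j, i)) i

instance {q : ℕ} {α : Type} [WordEnc q α] [LawfulEnc α] {r s : ℕ} :
    LawfulEnc (Matrix (Fin r) (Fin s) α) where
  dec_enc a := by funext j k; exact LawfulEnc.dec_enc (a j k)
  enc_dec w := by
    funext ⟨⟨j, k⟩, i⟩
    exact congrFun (LawfulEnc.enc_dec (α := α) fun i => w ((j, k), i)) i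

instance {q : ℕ} {α β : Type} [WordEnc q α] [WordEnc q β] [LawfulEnc α] [LawfulEnc β] :
    LawfulEnc (α × β) where
  dec_enc a := Prod.ext (LawfulEnc.dec_enc a.1) (LawfulEnc.dec_enc a.2)
  enc_dec w := by
    funext i
    rcases i with i | i
    · exact congrFun (LawfulEnc.enc_dec (α := α) fun i => w (.inl i)) i
    · exact congrFun (LawfulEnc.enc_dec (α := β) fun i => w (.inr i)) i

/-- The fields of a statement. -/
abbrev StmtTuple (pp : Params) : Type :=
  Matrix (Fin pp.κ) (Fin pp.m) pp.Rq × (Fin pp.m → pp.Rq) × (Fin pp.m → pp.Rq) ×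
    (Fin pp.m → pp.Rq) × (Fin pp.m → pp.Rq) × (Fin pp.m → pp.Rq) × (Fin pp.m → pp.Rq) ×
    (Fin pp.κ → pp.Rq) × pp.Rq × pp.Rq × pp.Rq

/-- A statement as a tuple. -/
def Params.Stmt.tuple (x : Stmt pp) : StmtTuple pp :=
  (x.A, x.pk1, x.pk2, x.b, x.aBin, x.aBin', x.aG, x.com0, x.com1, x.com2, x.com3)

/-- A statement from its fields. -/
def Params.Stmt.ofTuple (t : StmtTuple pp) : Stmt pp :=
  ⟨t.1, t.2.1, t.2.2.1, t.2.2.2.1, t.2.2.2.2.1, t.2.2.2.2.2.1, t.2.2.2.2.2.2.1,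
    t.2.2.2.2.2.2.2.1, t.2.2.2.2.2.2.2.2.1, t.2.2.2.2.2.2.2.2.2.1, t.2.2.2.2.2.2.2.2.2.2⟩

instance : LawfulEnc (Stmt pp) where
  dec_enc x := congrArg Stmt.ofTuple (LawfulEnc.dec_enc x.tuple)
  enc_dec w := LawfulEnc.enc_dec (α := StmtTuple pp) w

instance : LawfulEnc (Opening pp) where
  dec_enc x := congrArg (fun t : pp.Rq × (Fin pp.m → pp.Rq) × (Fin 3 → pp.Rq) =>
    (⟨t.1, t.2.1, t.2.2⟩ : Opening pp)) (LawfulEnc.dec_enc (x.cbar, x.r, x.msg))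
  enc_dec w := LawfulEnc.enc_dec (α := pp.Rq × (Fin pp.m → pp.Rq) × (Fin 3 → pp.Rq)) w

instance : LawfulEnc (Msg1 pp) where
  dec_enc x := congrArg (fun t : pp.Rq × pp.Rq × pp.Rq × pp.Rq × (Fin pp.κ → pp.Rq) =>
    (⟨t.1, t.2.1, t.2.2.1, t.2.2.2.1, t.2.2.2.2⟩ : Msg1 pp))
    (LawfulEnc.dec_enc (x.f, x.u1, x.u2, x.u3, x.w))
  enc_dec w := LawfulEnc.enc_dec (α := pp.Rq × pp.Rq × pp.Rq × pp.Rq × (Fin pp.κ → pp.Rq)) w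

instance : LawfulEnc (Msg2 pp) where
  dec_enc x := congrArg (fun t : pp.Rq × pp.Rq => (⟨t.1, t.2⟩ : Msg2 pp))
    (LawfulEnc.dec_enc (x.h, x.u4))
  enc_dec w := LawfulEnc.enc_dec (α := pp.Rq × pp.Rq) w

instance : LawfulEnc (Transcript pp) where
  dec_enc x := congrArg
    (fun t : Msg1 pp × Slots pp × Msg2 pp × pp.Rq × (Fin pp.m → pp.Rq) =>
      (⟨t.1, t.2.1, t.2.2.1, t.2.2.2.1, t.2.2.2.2⟩ : Transcript pp))
    (LawfulEnc.dec_enc (x.msg1, x.φ, x.msg2, x.c, x.z))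
  enc_dec w := LawfulEnc.enc_dec
    (α := Msg1 pp × Slots pp × Msg2 pp × pp.Rq × (Fin pp.m → pp.Rq)) w

end lawful

section typed

variable (pp : Params) {S : OracleSig} {Ω : Type*} (O : Ω → Answers pp S)
variable {α β γ : Type} [WordEnc pp.q α] [WordEnc pp.q β] [WordEnc pp.q γ]

/-- A random map of encoded data computed by a circuit of size at most `N`. -/
def Comp (N : ℕ) (F : Ω → α → PMF β) : Prop :=
  RComp pp O N fun o (x : Wire α → pp.W) => (F o (WordEnc.dec x)).map WordEnc.enc

/-- A deterministic map of encoded data computed by a circuit of size at most `N`. -/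
def Det (N : ℕ) (f : α → β) : Prop := Comp pp O N fun _ a => PMF.pure (f a)

/-- A distribution of encoded data sampled by a circuit of size at most `N`. -/
def Samp (N : ℕ) (μ : PMF α) : Prop := RSamp pp O N (μ.map WordEnc.enc)

variable {pp O}

theorem Comp.mono {N M : ℕ} {F : Ω → α → PMF β} (h : Comp pp O N F) (hNM : N ≤ M) :
    Comp pp O M F := RComp.mono h hNM

theorem Comp.seq [LawfulEnc β] {N M : ℕ} {F : Ω → α → PMF β} {G : Ω → β → PMF γ}
    (hF : Comp pp O N F) (hG : Comp pp O M G) :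
    Comp pp O (N + M) fun o a => (F o a).bind (G o) := by
  refine (RComp.seq hF hG).congr fun o x => ?_
  rw [PMF.bind_map, PMF.map_bind]
  congr 1; funext b
  simp only [Function.comp, LawfulEnc.dec_enc]

theorem Comp.keep [LawfulEnc α] {N : ℕ} {F : Ω → α → PMF β} (hF : Comp pp O N F) :
    Comp pp O N fun o a => (F o a).map fun b => (a, b) := by
  refine (RComp.keep hF).congr fun o x => ?_
  rw [PMF.map_comp, PMF.map_comp]
  congr 1; funext b
  simp only [Function.comp]
  conv_lhs => rw [← LawfulEnc.enc_dec (α := α) x]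
  rfl

/-- Monadic composition in which the second stage still sees the input. Samplers are then assembled
by nesting, with the context accumulating as a tuple. -/
theorem Comp.bind [LawfulEnc α] [LawfulEnc β] {N M : ℕ} {F : Ω → α → PMF β}
    {G : Ω → α × β → PMF γ} (hF : Comp pp O N F) (hG : Comp pp O M G) :
    Comp pp O (N + M) fun o a => (F o a).bind fun b => G o (a, b) := by
  have := hF.keep.seq hG
  simpa only [PMF.bind_map, Function.comp_def] using this

theorem Comp.map [LawfulEnc β] {N M : ℕ} {F : Ω → α → PMF β} {g : β → γ}
    (hF : Comp pp O N F) (hg : Det pp O M g) : Comp pp O (N + M) fun o a => (F o a).map g :=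
  hF.seq hg

theorem Comp.bindMap [LawfulEnc α] [LawfulEnc β] {N M : ℕ} {F : Ω → α → PMF β}
    {g : α × β → γ} (hF : Comp pp O N F) (hg : Det pp O M g) :
    Comp pp O (N + M) fun o a => (F o a).map fun b => g (a, b) := by
  have := hF.keep.map hg
  simpa only [PMF.map_comp, Function.comp_def] using this

theorem Det.mono {N M : ℕ} {f : α → β} (h : Det pp O N f) (hNM : N ≤ M) : Det pp O M f :=
  RComp.mono h hNM

theorem Det.comp [LawfulEnc β] {N M : ℕ} {g : β → γ} {f : α → β}
    (hg : Det pp O M g) (hf : Det pp O N f) : Det pp O (N + M) fun a => g (f a) := by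
  have := Comp.seq hf hg
  simp only [PMF.pure_bind] at this
  exact this

/-- Random maps after deterministic preprocessing. -/
theorem Comp.pre [LawfulEnc β] {N M : ℕ} {G : Ω → β → PMF γ} {f : α → β}
    (hG : Comp pp O M G) (hf : Det pp O N f) : Comp pp O (N + M) fun o a => G o (f a) := by
  have := Comp.seq hf hG
  simp only [PMF.pure_bind] at this
  exact this

theorem Det.of_raw {N : ℕ} {f : α → β}
    (h : RComp pp O N fun _ (x : Wire α → pp.W) =>
      PMF.pure (WordEnc.enc (f (WordEnc.dec x)) : Wire β → pp.W)) : Det pp O N f :=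
  h.congr fun _ _ => (PMF.pure_map _ _).symm

/-- Projections, tupling, transposition and changes of record format only move wires and cost no
gates. -/
theorem Det.of_wire [LawfulEnc α] {f : α → β} (σ : Wire β → Wire α)
    (h : ∀ a j, (WordEnc.enc (f a) j : pp.W) = WordEnc.enc a (σ j)) : Det pp O 0 f := by
  refine Det.of_raw ((RComp.wire σ).congr fun o x => ?_)
  congr 1; funext j
  rw [h, LawfulEnc.enc_dec]

theorem Det.of_sc [Fintype (Wire β)] {N : ℕ} {f : α → β}
    (h : ∀ j : Wire β, Sc pp O N fun x : Wire α → pp.W => WordEnc.enc (f (WordEnc.dec x)) j) :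
    Det pp O (Fintype.card (Wire β) * N + 1) f :=
  Det.of_raw (RComp.pi h)

theorem Det.id [LawfulEnc α] : Det pp O 0 fun a : α => a := Det.of_wire (fun j => j) fun _ _ => rfl

theorem Det.fst [LawfulEnc α] [LawfulEnc β] : Det pp O 0 (Prod.fst : α × β → α) :=
  Det.of_wire (β := α) Sum.inl fun _ _ => rfl

theorem Det.snd [LawfulEnc α] [LawfulEnc β] : Det pp O 0 (Prod.snd : α × β → β) :=
  Det.of_wire (β := β) Sum.inr fun _ _ => rfl

theorem Det.pair [LawfulEnc α] {N M : ℕ} {f : α → β} {g : α → γ} (hf : Det pp O N f)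
    (hg : Det pp O M g) : Det pp O (N + M) fun a => (f a, g a) := by
  have h1 : RComp pp O N fun _ (x : Wire α → pp.W) =>
      PMF.pure (WordEnc.enc (f (WordEnc.dec x)) : Wire β → pp.W) :=
    RComp.congr hf fun _ _ => PMF.pure_map _ _
  have h2 : RComp pp O M fun _ (x : Wire α → pp.W) =>
      PMF.pure (WordEnc.enc (g (WordEnc.dec x)) : Wire γ → pp.W) :=
    RComp.congr hg fun _ _ => PMF.pure_map _ _
  exact Det.of_raw (RComp.detPair h1 h2)

theorem Det.fst' [LawfulEnc α] [LawfulEnc β] [LawfulEnc γ] {N : ℕ} {f : α → β × γ}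
    (h : Det pp O N f) : Det pp O N fun a => (f a).1 :=
  (Det.fst.comp h).mono (by simp)

theorem Det.snd' [LawfulEnc α] [LawfulEnc β] [LawfulEnc γ] {N : ℕ} {f : α → β × γ}
    (h : Det pp O N f) : Det pp O N fun a => (f a).2 :=
  (Det.snd.comp h).mono (by simp)

theorem Det.proj [LawfulEnc α] [LawfulEnc β] {r N : ℕ} {f : α → Fin r → β} (h : Det pp O N f)
    (i : Fin r) : Det pp O N fun a => f a i := by
  have h1 : Det pp O 0 fun v : Fin r → β => v i := Det.of_wire (β := β) (fun j => (i, j)) fun _ _ => rfl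
  exact (h1.comp h).mono (by simp)

theorem Det.row [LawfulEnc α] [LawfulEnc β] {r s N : ℕ} {f : α → Matrix (Fin r) (Fin s) β}
    (h : Det pp O N f) (i : Fin r) : Det pp O N fun a => (fun k => f a i k : Fin s → β) := by
  have h1 : Det pp O 0 fun v : Matrix (Fin r) (Fin s) β => (fun k => v i k : Fin s → β) :=
    Det.of_wire (β := Fin s → β) (fun j => ((i, j.1), j.2)) fun _ _ => rfl
  exact (h1.comp h).mono (by simp)

theorem Det.cons [LawfulEnc α] [LawfulEnc β] {r N M : ℕ} {f : α → β} {g : α → Fin r → β}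
    (hf : Det pp O N f) (hg : Det pp O M g) :
    Det pp O (N + M) fun a => (Fin.cons (α := fun _ => β) (f a) (g a) : Fin (r + 1) → β) := by
  have h : Det pp O 0 fun p : β × (Fin r → β) => (Fin.cons p.1 p.2 : Fin (r + 1) → β) := by
    refine Det.of_wire (β := Fin (r + 1) → β) (α := β × (Fin r → β))
      (fun j => Fin.cases (motive := fun _ => Wire β ⊕ (Fin r × Wire β)) (.inl j.2)
        (fun i => .inr (i, j.2)) j.1) fun a j => ?_
    rcases j with ⟨i, j⟩
    refine Fin.cases ?_ (fun i => ?_) i <;> rfl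
  exact (h.comp (hf.pair hg)).mono (by simp)

theorem Det.vec [LawfulEnc α] [LawfulEnc β] {r N : ℕ} {f : Fin r → α → β}
    (h : ∀ i, Det pp O N (f i)) : Det pp O (r * N) fun a i => f i a := by
  induction r with
  | zero =>
    refine (Det.of_wire (β := Fin 0 → β) (fun j : Wire (Fin 0 → β) => j.1.elim0) fun a j => ?_).mono
      (by simp)
    exact j.1.elim0
  | succ r ih =>
    have h3 := ((h 0).cons (ih fun i => h i.succ)).mono (M := (r + 1) * N) (by linarith)
    convert h3 using 3 with a i
    refine Fin.cases ?_ (fun i => ?_) i <;> rfl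

theorem Det.ofRows [LawfulEnc α] [LawfulEnc β] {r s N : ℕ} {f : α → Fin r → Fin s → β}
    (h : Det pp O N f) : Det pp O N fun a => Matrix.of (f a) := by
  have h1 : Det pp O 0 fun v : Fin r → Fin s → β => Matrix.of v :=
    Det.of_wire (β := Matrix (Fin r) (Fin s) β) (fun j => (j.1.1, (j.1.2, j.2))) fun _ _ => rfl
  exact (h1.comp h).mono (by simp)

theorem Det.transpose [LawfulEnc α] [LawfulEnc β] {r s N : ℕ} {f : α → Matrix (Fin r) (Fin s) β}
    (h : Det pp O N f) : Det pp O N fun a => (f a)ᵀ := by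
  have h1 : Det pp O 0 fun v : Matrix (Fin r) (Fin s) β => vᵀ :=
    Det.of_wire (β := Matrix (Fin s) (Fin r) β) (fun j => ((j.1.2, j.1.1), j.2)) fun _ _ => rfl
  exact (h1.comp h).mono (by simp)

/-! ### Sampling -/

theorem Samp.comp {N : ℕ} {μ : PMF β} (h : Samp pp O N μ) : Comp pp O N fun _ (_ : α) => μ :=
  RSamp.comp h

theorem Samp.iid {N : ℕ} {μ : PMF β} (h : Samp pp O N μ) (r : ℕ) :
    Samp pp O (r * N) (iid μ r) := by
  have := RSamp.iid h r
  rw [iid_map, PMF.map_comp] at this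
  exact this

theorem Samp.map [LawfulEnc β] {N M : ℕ} {μ : PMF β} {g : β → γ} (h : Samp pp O N μ)
    (hg : Det pp O M g) : Samp pp O (N + M) (μ.map g) := by
  refine (RComp.seq h hg).congr fun o x => ?_
  rw [PMF.bind_map, PMF.map_comp, ← PMF.bind_pure_comp]
  congr 1; funext b
  simp only [Function.comp, LawfulEnc.dec_enc, PMF.pure_map]

end typed

/-! ### Ring operations -/

section ringops

variable {pp : Params} {S : OracleSig} {Ω : Type*} {O : Ω → Answers pp S}
variable {α : Type} [WordEnc pp.q α] [LawfulEnc α]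

instance : Fintype (Wire pp.Rq) := inferInstanceAs (Fintype (Fin pp.d))
instance : Fintype (Wire (Slots pp)) := inferInstanceAs (Fintype (Fin pp.l × Fin pp.n))

theorem card_wire_Rq : Fintype.card (Wire pp.Rq) = pp.d := Fintype.card_fin _

theorem card_wire_slots : Fintype.card (Wire (Slots pp)) = pp.d := by
  rw [← l_mul_n (pp := pp)]
  exact (Fintype.card_prod _ _).trans (by simp)

/-- Cost of operations on coefficient vectors. -/
def linC (pp : Params) : ℕ := pp.d * (pp.d * 3 + 3) + 1

/-- Cost of a multiplication. -/
def mulC (pp : Params) : ℕ := pp.d * (pp.d * (pp.d * 4 + 2) + 1) + 1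

theorem Det.constR (c : pp.Rq) : Det pp O (linC pp) fun _ : α => c := by
  refine (Det.of_sc (N := 1) fun j => Sc.const _).mono ?_
  rw [card_wire_Rq, linC]
  nlinarith

theorem Det.add {N M : ℕ} {f g : α → pp.Rq} (hf : Det pp O N f) (hg : Det pp O M g) :
    Det pp O (N + M + linC pp) fun a => f a + g a := by
  have h : Det pp O (linC pp) fun p : pp.Rq × pp.Rq => p.1 + p.2 := by
    have : Det pp O (Fintype.card (Wire pp.Rq) * 1 + 1) fun p : pp.Rq × pp.Rq => p.1 + p.2 := by
      refine Det.of_sc fun j => ?_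
      have := ((Sc.var (O := O) (Sum.inl j : Wire (pp.Rq × pp.Rq))).add (Sc.var (Sum.inr j)))
      refine RComp.congr this fun o x => ?_
      congr 1; funext _
      change _ = coef (ofCoef (fun i => x (.inl i)) + ofCoef (fun i => x (.inr i))) j
      rw [coef_add, coef_ofCoef, coef_ofCoef]
      rfl
    refine this.mono ?_
    rw [card_wire_Rq, linC]
    nlinarith
  exact h.comp (hf.pair hg)

theorem Det.sub {N M : ℕ} {f g : α → pp.Rq} (hf : Det pp O N f) (hg : Det pp O M g) :
    Det pp O (N + M + linC pp) fun a => f a - g a := by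
  have h : Det pp O (linC pp) fun p : pp.Rq × pp.Rq => p.1 - p.2 := by
    have : Det pp O (Fintype.card (Wire pp.Rq) * 3 + 1) fun p : pp.Rq × pp.Rq => p.1 - p.2 := by
      refine Det.of_sc fun j => ?_
      have := ((Sc.var (O := O) (Sum.inl j : Wire (pp.Rq × pp.Rq))).add
        ((Sc.const (-1)).mul (Sc.var (Sum.inr j))))
      refine RComp.congr this fun o x => ?_
      congr 1; funext _
      change _ = coef (ofCoef (fun i => x (.inl i)) - ofCoef (fun i => x (.inr i))) j
      rw [coef_sub, coef_ofCoef, coef_ofCoef]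
      exact (by intro u v; rw [neg_one_mul, sub_eq_add_neg] : ∀ u v : pp.W, u + -1 * v = u - v) _ _
    refine this.mono ?_
    rw [card_wire_Rq, linC]
    nlinarith
  exact h.comp (hf.pair hg)

theorem Det.mul {N M : ℕ} {f g : α → pp.Rq} (hf : Det pp O N f) (hg : Det pp O M g) :
    Det pp O (N + M + mulC pp) fun a => f a * g a := by
  have h : Det pp O (mulC pp) fun p : pp.Rq × pp.Rq => p.1 * p.2 := by
    have : Det pp O (Fintype.card (Wire pp.Rq) * (pp.d * (pp.d * (3 + 1) + 1 + 1) + 1) + 1)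
        fun p : pp.Rq × pp.Rq => p.1 * p.2 := by
      refine Det.of_sc fun k => ?_
      -- Schoolbook multiplication, with the structure constants of the monomial basis hard-wired.
      have h1 : Sc pp O ((Finset.univ : Finset (Fin pp.d)).card *
          ((Finset.univ : Finset (Fin pp.d)).card * (3 + 1) + 1 + 1) + 1)
          fun x : Wire (pp.Rq × pp.Rq) → pp.W => ∑ i : Fin pp.d, ∑ j : Fin pp.d,
            x (Sum.inl i) * x (Sum.inr j) *
              coef (AdjoinRoot.root pp.modulus ^ (i : ℕ) * AdjoinRoot.root pp.modulus ^ (j : ℕ)) k :=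
        Sc.sum _ fun i => Sc.sum _ fun j => ((Sc.var _).mul (Sc.var _)).mul (Sc.const _)
      rw [Finset.card_univ, Fintype.card_fin] at h1
      refine RComp.congr h1 fun o x => ?_
      congr 1; funext _
      change _ = coef (ofCoef (fun i => x (.inl i)) * ofCoef (fun i => x (.inr i))) k
      rw [eq_sum_root (ofCoef fun i => x (.inl i)), eq_sum_root (ofCoef fun i => x (.inr i)),
        coef_ofCoef, coef_ofCoef, Finset.sum_mul_sum]
      change _ = coefEquiv pp _ k
      simp only [map_sum, Finset.sum_apply]
      refine Finset.sum_congr rfl fun i _ => Finset.sum_congr rfl fun j _ => ?_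
      rw [smul_mul_smul_comm, map_smul]
      rfl
    refine this.mono ?_
    rw [card_wire_Rq, mulC]
  exact h.comp (hf.pair hg)

/-- Although `invNtt` is defined by choice, it is linear, so its matrix can be hard-wired into the
circuit. -/
theorem Det.invNtt {N : ℕ} {f : α → Slots pp} (hf : Det pp O N f) :
    Det pp O (N + linC pp) fun a => invNtt (f a) := by
  have h : Det pp O (linC pp) (Params.invNtt : Slots pp → pp.Rq) := by
    let L : (Wire (Slots pp) → pp.W) →ₗ[pp.W] (Wire pp.Rq → pp.W) :=
      (coefEquiv pp).toLinearMap ∘ₗ invNttL pp ∘ₗ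
        { toFun := fun x => (WordEnc.dec x : Slots pp)
          map_add' := fun _ _ => rfl
          map_smul' := fun _ _ => rfl }
    have := Det.of_raw (O := O) (f := (Params.invNtt : Slots pp → pp.Rq)) (RComp.linear L)
    refine this.mono ?_
    rw [card_wire_Rq, card_wire_slots, linC]
    nlinarith
  exact h.comp hf

theorem Det.QT {N : ℕ} {f : α → Slots pp} (hf : Det pp O N f) :
    Det pp O (N + linC pp) fun a => Params.QT (f a) := by
  have h : Det pp O (linC pp) (Params.QT : Slots pp → Slots pp) := by
    let L : (Wire (Slots pp) → pp.W) →ₗ[pp.W] (Wire (Slots pp) → pp.W) :=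
      { toFun := fun x => WordEnc.enc (Params.QT (WordEnc.dec x : Slots pp))
        map_add' := fun x y => by
          funext ⟨j, i⟩
          change ∑ k, Params.Q pp k j * (x (k, i) + y (k, i)) =
            ∑ k, Params.Q pp k j * x (k, i) + ∑ k, Params.Q pp k j * y (k, i)
          simp_rw [mul_add, Finset.sum_add_distrib]
        map_smul' := fun c x => by
          funext ⟨j, i⟩
          change ∑ k, Params.Q pp k j * (c * x (k, i)) = c * ∑ k, Params.Q pp k j * x (k, i)
          rw [Finset.mul_sum]
          exact Finset.sum_congr rfl fun k _ => by ring }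
    have := Det.of_raw (O := O) (f := (Params.QT : Slots pp → Slots pp)) (RComp.linear L)
    refine this.mono ?_
    rw [card_wire_slots, linC]
    nlinarith
  exact h.comp hf

/-- Cost of an inner product of length `r`. -/
def dotC (pp : Params) (r : ℕ) : ℕ := r * mulC pp + (pp.d * (r + 1) + 1)

theorem Det.dot {r N M : ℕ} {f g : α → Fin r → pp.Rq} (hf : Det pp O N f) (hg : Det pp O M g) :
    Det pp O (N + M + dotC pp r) fun a => f a ⬝ᵥ g a := by
  have h1 : Det pp O (r * mulC pp) fun p : (Fin r → pp.Rq) × (Fin r → pp.Rq) =>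
      fun i => p.1 i * p.2 i :=
    Det.vec fun i => ((Det.fst.proj i).mul (Det.snd.proj i)).mono (by simp)
  have h2 : Det pp O (pp.d * (r + 1) + 1) fun v : Fin r → pp.Rq => ∑ i, v i := by
    have : Det pp O (Fintype.card (Wire pp.Rq) * (r * (0 + 1) + 1) + 1)
        fun v : Fin r → pp.Rq => ∑ i, v i := by
      refine Det.of_sc fun k => ?_
      have h3 : Sc pp O ((Finset.univ : Finset (Fin r)).card * (0 + 1) + 1)
          fun x : Wire (Fin r → pp.Rq) → pp.W => ∑ i : Fin r, x (i, k) :=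
        Sc.sum _ fun i => Sc.var _
      rw [Finset.card_univ, Fintype.card_fin] at h3
      refine RComp.congr h3 fun o x => ?_
      congr 1; funext _
      change _ = coefEquiv pp (∑ i, ofCoef fun j => x (i, j)) k
      rw [map_sum, Finset.sum_apply]
      refine Finset.sum_congr rfl fun i _ => ?_
      exact (congrFun (coef_ofCoef fun j => x (i, j)) k).symm
    refine this.mono ?_
    rw [card_wire_Rq]
    simp
  exact (h2.comp h1).comp (hf.pair hg)

theorem Det.smulVec {r N M : ℕ} {f : α → pp.Rq} {g : α → Fin r → pp.Rq} (hf : Det pp O N f)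
    (hg : Det pp O M g) : Det pp O (N + M + r * mulC pp) fun a => f a • g a := by
  have h1 : Det pp O (r * mulC pp) fun p : pp.Rq × (Fin r → pp.Rq) => p.1 • p.2 :=
    Det.vec fun i => (Det.fst.mul (Det.snd.proj i)).mono (by simp)
  exact h1.comp (hf.pair hg)

theorem Det.subVec {r N M : ℕ} {f g : α → Fin r → pp.Rq} (hf : Det pp O N f)
    (hg : Det pp O M g) : Det pp O (N + M + r * linC pp) fun a => f a - g a := by
  have h1 : Det pp O (r * linC pp) fun p : (Fin r → pp.Rq) × (Fin r → pp.Rq) => p.1 - p.2 :=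
    Det.vec fun i => ((Det.fst.proj i).sub (Det.snd.proj i)).mono (by simp)
  exact h1.comp (hf.pair hg)

theorem Det.addVec {r N M : ℕ} {f g : α → Fin r → pp.Rq} (hf : Det pp O N f)
    (hg : Det pp O M g) : Det pp O (N + M + r * linC pp) fun a => f a + g a := by
  have h1 : Det pp O (r * linC pp) fun p : (Fin r → pp.Rq) × (Fin r → pp.Rq) => p.1 + p.2 :=
    Det.vec fun i => ((Det.fst.proj i).add (Det.snd.proj i)).mono (by simp)
  exact h1.comp (hf.pair hg)

theorem Det.mulVec {r s N M : ℕ} {f : α → Matrix (Fin r) (Fin s) pp.Rq} {g : α → Fin s → pp.Rq}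
    (hf : Det pp O N f) (hg : Det pp O M g) :
    Det pp O (N + M + r * dotC pp s) fun a => f a *ᵥ g a := by
  have h1 : Det pp O (r * dotC pp s)
      fun p : Matrix (Fin r) (Fin s) pp.Rq × (Fin s → pp.Rq) => p.1 *ᵥ p.2 :=
    Det.vec fun i => ((Det.fst.row i).dot Det.snd).mono (by simp)
  exact h1.comp (hf.pair hg)

/-- Square-and-multiply along the binary digits of the exponent: at most two multiplications per
bit. -/
theorem Det.pow {N : ℕ} {f : α → pp.Rq} (hf : Det pp O N f) (e : ℕ) :
    Det pp O (N + (linC pp + e.size * (2 * mulC pp))) fun a => f a ^ e := by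
  have h : Det pp O (linC pp + e.size * (2 * mulC pp)) fun a : pp.Rq => a ^ e := by
    induction e using Nat.binaryRec' with
    | zero => simpa using Det.constR (1 : pp.Rq)
    | bit b n hb ih =>
      by_cases h0 : Nat.bit b n = 0
      · simpa [h0] using Det.constR (1 : pp.Rq)
      have hsq : Det pp O (mulC pp) fun a : pp.Rq => a * a :=
        (Det.id.mul Det.id).mono (by simp)
      rw [Nat.size_bit h0]
      cases b
      · have := (hsq.comp ih).mono
          (M := linC pp + (n.size + 1) * (2 * mulC pp)) (by linarith)
        convert this using 3 with a
        rw [Nat.bit_false_apply, two_mul, pow_add]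
      · have := ((hsq.comp ih).mul Det.id).mono
          (M := linC pp + (n.size + 1) * (2 * mulC pp)) (by linarith)
        convert this using 3 with a
        rw [Nat.bit_true_apply, pow_succ, two_mul, pow_add]
  exact h.comp hf

end ringops

end

end PoA

namespace PoA
noncomputable section

open Params

/-! ### Fields of statements, openings and transcripts -/

section fields

variable {pp : Params} {S : OracleSig} {Ω : Type*} {O : Ω → Answers pp S}
variable {α : Type} [WordEnc pp.q α] [LawfulEnc α] {N : ℕ}

theorem Det.stmtTuple {f : α → Stmt pp} (h : Det pp O N f) : Det pp O N fun a => (f a).tuple := by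
  have h1 : Det pp O 0 (Stmt.tuple : Stmt pp → StmtTuple pp) :=
    Det.of_wire (β := StmtTuple pp) (fun j => j) fun _ _ => rfl
  exact (h1.comp h).mono (by simp)

theorem Det.stmtOfTuple {f : α → StmtTuple pp} (h : Det pp O N f) :
    Det pp O N fun a => Stmt.ofTuple (f a) := by
  have h1 : Det pp O 0 (Stmt.ofTuple : StmtTuple pp → Stmt pp) :=
    Det.of_wire (α := StmtTuple pp) (β := Stmt pp) (fun j => j) fun _ _ => rfl
  exact (h1.comp h).mono (by simp)

section stmt

variable {f : α → Stmt pp} (h : Det pp O N f)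
include h

theorem Det.stmtA : Det pp O N fun a => (f a).A := h.stmtTuple.fst'
theorem Det.pk1 : Det pp O N fun a => (f a).pk1 := h.stmtTuple.snd'.fst'
theorem Det.pk2 : Det pp O N fun a => (f a).pk2 := h.stmtTuple.snd'.snd'.fst'
theorem Det.stmtB : Det pp O N fun a => (f a).b := h.stmtTuple.snd'.snd'.snd'.fst'
theorem Det.aBin : Det pp O N fun a => (f a).aBin := h.stmtTuple.snd'.snd'.snd'.snd'.fst'
theorem Det.aBin' : Det pp O N fun a => (f a).aBin' :=
  h.stmtTuple.snd'.snd'.snd'.snd'.snd'.fst'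
theorem Det.aG : Det pp O N fun a => (f a).aG :=
  h.stmtTuple.snd'.snd'.snd'.snd'.snd'.snd'.fst'
theorem Det.com0 : Det pp O N fun a => (f a).com0 :=
  h.stmtTuple.snd'.snd'.snd'.snd'.snd'.snd'.snd'.fst'
theorem Det.com1 : Det pp O N fun a => (f a).com1 :=
  h.stmtTuple.snd'.snd'.snd'.snd'.snd'.snd'.snd'.snd'.fst'
theorem Det.com2 : Det pp O N fun a => (f a).com2 :=
  h.stmtTuple.snd'.snd'.snd'.snd'.snd'.snd'.snd'.snd'.snd'.fst'
theorem Det.com3 : Det pp O N fun a => (f a).com3 :=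
  h.stmtTuple.snd'.snd'.snd'.snd'.snd'.snd'.snd'.snd'.snd'.snd'

end stmt

theorem Det.opening {M K : ℕ} {c : α → pp.Rq} {r : α → Fin pp.m → pp.Rq} {e : α → Fin 3 → pp.Rq}
    (hc : Det pp O N c) (hr : Det pp O M r) (he : Det pp O K e) :
    Det pp O (N + (M + K)) fun a => (⟨c a, r a, e a⟩ : Opening pp) := by
  have h1 : Det pp O 0 fun t : pp.Rq × (Fin pp.m → pp.Rq) × (Fin 3 → pp.Rq) =>
      (⟨t.1, t.2.1, t.2.2⟩ : Opening pp) :=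
    Det.of_wire (α := pp.Rq × (Fin pp.m → pp.Rq) × (Fin 3 → pp.Rq)) (β := Opening pp)
      (fun j => j) fun _ _ => rfl
  exact (h1.comp (hc.pair (hr.pair he))).mono (by simp)

theorem Det.transcript {N₁ N₂ N₃ N₄ N₅ N₆ N₇ N₈ N₉ N₁₀ : ℕ} {f u1 u2 u3 : α → pp.Rq}
    {w : α → Fin pp.κ → pp.Rq}
    {φ : α → Slots pp} {h u4 c : α → pp.Rq} {z : α → Fin pp.m → pp.Rq}
    (hf : Det pp O N₁ f) (hu1 : Det pp O N₂ u1) (hu2 : Det pp O N₃ u2) (hu3 : Det pp O N₄ u3)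
    (hw : Det pp O N₅ w) (hφ : Det pp O N₆ φ) (hh : Det pp O N₇ h) (hu4 : Det pp O N₈ u4)
    (hc : Det pp O N₉ c) (hz : Det pp O N₁₀ z) :
    Det pp O ((N₁ + (N₂ + (N₃ + (N₄ + N₅)))) + (N₆ + ((N₇ + N₈) + (N₉ + N₁₀)))) fun a =>
      (⟨⟨f a, u1 a, u2 a, u3 a, w a⟩, φ a, ⟨h a, u4 a⟩, c a, z a⟩ : Transcript pp) := by
  have h1 : Det pp O 0 fun t : (pp.Rq × pp.Rq × pp.Rq × pp.Rq × (Fin pp.κ → pp.Rq)) ×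
        Slots pp × (pp.Rq × pp.Rq) × pp.Rq × (Fin pp.m → pp.Rq) =>
      (⟨⟨t.1.1, t.1.2.1, t.1.2.2.1, t.1.2.2.2.1, t.1.2.2.2.2⟩, t.2.1, ⟨t.2.2.1.1, t.2.2.1.2⟩,
        t.2.2.2.1, t.2.2.2.2⟩ : Transcript pp) :=
    Det.of_wire (α := (pp.Rq × pp.Rq × pp.Rq × pp.Rq × (Fin pp.κ → pp.Rq)) ×
        Slots pp × (pp.Rq × pp.Rq) × pp.Rq × (Fin pp.m → pp.Rq)) (β := Transcript pp)
      (fun j => j) fun _ _ => rfl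
  exact (h1.comp ((hf.pair (hu1.pair (hu2.pair (hu3.pair hw)))).pair
    (hφ.pair ((hh.pair hu4).pair (hc.pair hz))))).mono (by simp)

end fields

/-! ### The distributions of the scheme -/

section samplers

variable {pp : Params} {S : OracleSig} {Ω : Type*} {O : Ω → Answers pp S}

theorem RSamp.iid_scalar {μ : PMF pp.W} (h : RSamp pp O 1 (μ.map fun w (_ : Unit) => w)) (r : ℕ) :
    RSamp pp O r (PoA.iid μ r) := by
  have h1 := ((RSamp.iid h r).mono (M := r) (by simp)).rewire (b' := Fin r) id fun i => (i, ())
  refine RComp.congr h1 fun o x => ?_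
  rw [iid_map, PMF.map_comp, PMF.map_comp]
  exact PMF.map_id _

theorem Samp.of_coef {μ : PMF pp.W} (h : RSamp pp O 1 (μ.map fun w (_ : Unit) => w)) :
    Samp pp O pp.d ((PoA.iid μ pp.d).map (ofCoef : _ → pp.Rq)) := by
  refine RComp.congr (RSamp.iid_scalar h pp.d) fun o x => ?_
  rw [PMF.map_comp]
  have : (WordEnc.enc ∘ (ofCoef : _ → pp.Rq)) = id := funext coef_ofCoef
  rw [this, PMF.map_id]

theorem iid_map_ofInt (μ : PMF ℤ) :
    (iid μ pp.d).map (ofInt : _ → pp.Rq) = (iid (μ.map fun a : ℤ => (a : pp.W)) pp.d).map ofCoef := by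
  rw [iid_map, PMF.map_comp]
  rfl

/-- The integer sampling gates elaborate to an identity map after a monadic coercion; this
identifies them with plain pushforwards. -/
theorem PMF.do_cast (μ : PMF ℤ) :
    PMF.map (fun a => a) (do let a ← μ; pure (a : pp.W)) = μ.map fun a : ℤ => (a : pp.W) :=
  (PMF.map_id _).trans
    (show PMF.bind μ (PMF.pure ∘ fun a : ℤ => (a : pp.W)) = _ from PMF.bind_pure_comp _ _)

theorem Samp.smallR : Samp pp O pp.d pp.smallR := by
  rw [Params.smallR, iid_map_ofInt]
  exact Samp.of_coef (RSamp.gate (g := .drawSecret) fun x => PMF.do_cast _)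

theorem Samp.chal : Samp pp O pp.d pp.chal := by
  rw [Params.chal, iid_map_ofInt]
  exact Samp.of_coef (RSamp.gate (g := .drawChallenge) fun x => PMF.do_cast _)

theorem Samp.gauss : Samp pp O pp.d ((PoA.iid (PoA.gauss pp.σ pp.σ_pos) pp.d).map ofInt) := by
  rw [iid_map_ofInt]
  exact Samp.of_coef (RSamp.gate (g := .drawGauss) fun x => PMF.do_cast _)

theorem RSamp.unif : RSamp pp O 1 ((PMF.uniformOfFintype pp.W).map fun w (_ : Unit) => w) :=
  RSamp.gate (g := .unif) fun _ => rfl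

theorem Samp.unifR : Samp pp O pp.d pp.unifR := by
  rw [Params.unifR, ← iid_uniform]
  exact Samp.of_coef RSamp.unif

theorem Samp.unifSlots : Samp pp O pp.d pp.unifSlots := by
  have h := (RSamp.iid (RSamp.iid_scalar (O := O) RSamp.unif pp.n) pp.l)
  rw [iid_uniform, iid_uniform, l_mul_n] at h
  exact h

/-- The masked response before the shift by `c r`. -/
def Params.gaussVec (pp : Params) : PMF (Fin pp.m → pp.Rq) :=
  pp.mask.map fun z i => ofInt (z i)

theorem Samp.gaussVec : Samp pp O (pp.m * pp.d) pp.gaussVec := by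
  have := Samp.iid (Samp.gauss (pp := pp) (O := O)) pp.m
  rw [iid_map] at this
  exact this

/-- The ring element with the first `d / l` coefficients erased. -/
def Params.eraseHead (a : pp.Rq) : pp.Rq :=
  ofCoef fun k => if (k : ℕ) < pp.n then 0 else coef a k

/-- Erasing the head of a uniform element makes this law samplable and reduces its translation
invariance to that of `unifR`. -/
theorem Params.unifG_eq : pp.unifG = pp.unifR.map eraseHead := by
  rw [Params.unifG, Params.unifR, PMF.map_comp]
  congr 1; funext v
  simp only [Function.comp, eraseHead, coef_ofCoef]

theorem Det.eraseHead : Det pp O (pp.d + 1) (Params.eraseHead : pp.Rq → pp.Rq) := by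
  have : Det pp O (Fintype.card (Wire pp.Rq) * 1 + 1) (Params.eraseHead : pp.Rq → pp.Rq) := by
    refine Det.of_sc fun k : Fin pp.d => ?_
    have e : (fun x : Wire pp.Rq → pp.W =>
        (WordEnc.enc (Params.eraseHead (WordEnc.dec x : pp.Rq)) k : pp.W)) =
        fun x => if (k : ℕ) < pp.n then 0 else x k := by
      funext x
      change coef (ofCoef fun k : Fin pp.d => if (k : ℕ) < pp.n then 0
        else coef (ofCoef x : pp.Rq) k) k = _
      rw [coef_ofCoef, coef_ofCoef]
    rw [e]
    split_ifs
    · exact Sc.const 0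
    · exact (Sc.var _).mono (Nat.zero_le _)
  refine this.mono ?_
  rw [card_wire_Rq, mul_one]

theorem Samp.unifG : Samp pp O (pp.d + (pp.d + 1)) pp.unifG := by
  rw [unifG_eq]
  exact Samp.unifR.map Det.eraseHead

end samplers

end

end PoA

namespace PoA
noncomputable section

open Params

/-! ## Polynomial bounds -/

theorem PolyBounded.const (c : ℕ) : PolyBounded fun _ => c := ⟨Polynomial.C c, fun _ => by simp⟩

theorem PolyBounded.add {f g : ℕ → ℕ} (hf : PolyBounded f) (hg : PolyBounded g) :
    PolyBounded fun η => f η + g η := by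
  obtain ⟨P, hP⟩ := hf
  obtain ⟨R, hR⟩ := hg
  exact ⟨P + R, fun η => by rw [Polynomial.eval_add]; exact Nat.add_le_add (hP η) (hR η)⟩

theorem PolyBounded.mul {f g : ℕ → ℕ} (hf : PolyBounded f) (hg : PolyBounded g) :
    PolyBounded fun η => f η * g η := by
  obtain ⟨P, hP⟩ := hf
  obtain ⟨R, hR⟩ := hg
  exact ⟨P * R, fun η => by rw [Polynomial.eval_mul]; exact Nat.mul_le_mul (hP η) (hR η)⟩

theorem PolyBounded.of_le {f g : ℕ → ℕ} (hf : PolyBounded f) (h : ∀ η, g η ≤ f η) :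
    PolyBounded g := by
  obtain ⟨P, hP⟩ := hf
  exact ⟨P, fun η => (h η).trans (hP η)⟩

/-- The exponent itself is exponentially large, but its bit length, which governs the cost of
inversion, is polynomial when `d` and `log q` are. -/
theorem Params.size_invExp_le (pp : Params) : pp.invExp.size ≤ pp.d * (Nat.log 2 pp.q + 1) := by
  rw [Nat.size_le]
  calc pp.invExp < pp.q ^ pp.n := by
        have := two_le_q_pow (pp := pp)
        unfold invExp
        omega
    _ ≤ (2 ^ (Nat.log 2 pp.q + 1)) ^ pp.n :=
        Nat.pow_le_pow_left (Nat.lt_pow_succ_log_self one_lt_two _).le _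
    _ ≤ 2 ^ (pp.d * (Nat.log 2 pp.q + 1)) := by
        rw [← pow_mul, mul_comm]
        exact Nat.pow_le_pow_right two_pos (Nat.mul_le_mul_right _ n_le_d)

theorem Admissible.size_invExp {pp : ℕ → Params} (h : Admissible pp) :
    PolyBounded fun η => (pp η).invExp.size :=
  (h.d_poly.mul (h.log_q_poly.add (PolyBounded.const 1))).of_le fun η => size_invExp_le (pp η)

/-! ## The extractor -/

section extractor

variable {pp : Params}

/-- Querying the prover for a response. -/
theorem Comp.third : Comp pp (proverOracle (pp := pp)) 1
    fun S (t : Slots pp × pp.Rq) => PMF.pure (S.third t.1 t.2) := by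
  refine ⟨.seq (.call (S := proverSig pp) .third fun i => i) (.wire Sum.inr), le_rfl, fun S x => ?_⟩
  simp only [Circuit.run, PMF.pure_bind, PMF.pure_map]
  rfl

theorem Comp.challenges {S : OracleSig} {Ω : Type*} {O : Ω → Answers pp S} {α : Type}
    [WordEnc pp.q α] [LawfulEnc α] : Comp pp O (pp.d + pp.d) fun _ (_ : α) => pp.challenges := by
  have h1 : Comp pp O pp.d fun _ (φ : Slots pp) => pp.chal.map fun c => (φ, c) :=
    (Samp.chal.comp).keep
  exact (Samp.unifSlots.comp).seq h1

/-- What the extractor computes. -/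
def extract (S : Strategy pp) (x : Stmt pp) : PMF (Opening pp × (Fin pp.m → pp.Rq)) :=
  pp.challenges.bind fun t₁ => pp.challenges.bind fun t₂ => pp.challenges.map fun t₃ =>
    (extractOpening x t₁.2 t₂.2 (S.third t₁.1 t₁.2) (S.third t₂.1 t₂.2),
      extractSIS t₁.2 t₂.2 t₃.2 (S.third t₁.1 t₁.2) (S.third t₂.1 t₂.2) (S.third t₃.1 t₃.2))

theorem Det.vec3 {S : OracleSig} {Ω : Type*} {O : Ω → Answers pp S} {α β : Type}
    [WordEnc pp.q α] [LawfulEnc α] [WordEnc pp.q β] [LawfulEnc β] {N : ℕ} {f g h : α → β}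
    (hf : Det pp O N f) (hg : Det pp O N g) (hh : Det pp O N h) :
    Det pp O (3 * N) fun a => ![f a, g a, h a] := by
  have h1 : ∀ i : Fin 3, Det pp O N (![f, g, h] i) := by
    intro i
    fin_cases i
    · exact hf
    · exact hg
    · exact hh
  convert Det.vec h1 using 3 with a i
  fin_cases i <;> rfl

variable (pp) in
/-- Cost of computing the randomness of the extracted opening. -/
def openingC : ℕ :=
  2 * linC pp + pp.invExp.size * (2 * mulC pp) + pp.m * linC pp + pp.m * mulC pp

variable (pp) in
/-- Cost of the extractor. -/
def extractC : ℕ :=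
  6 * pp.d + 3 + (linC pp + openingC pp + 3 * (openingC pp + dotC pp pp.m + linC pp) +
    (2 * linC pp + 3 * (pp.m * linC pp) + 2 * (pp.m * mulC pp)))

section

variable {S : OracleSig} {Ω : Type*} {O : Ω → Answers pp S} {α : Type}
  [WordEnc pp.q α] [LawfulEnc α] {x : α → Stmt pp} {c₁ c₂ c₃ : α → pp.Rq}
  {z₁ z₂ z₃ : α → Fin pp.m → pp.Rq}

theorem Det.extractOpening (hx : Det pp O 0 x) (hc₁ : Det pp O 0 c₁) (hc₂ : Det pp O 0 c₂)
    (hz₁ : Det pp O 0 z₁) (hz₂ : Det pp O 0 z₂) :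
    Det pp O (linC pp + openingC pp + 3 * (openingC pp + dotC pp pp.m + linC pp))
      fun a => Params.extractOpening (x a) (c₁ a) (c₂ a) (z₁ a) (z₂ a) := by
  have hr := ((hc₁.sub hc₂).pow pp.invExp).smulVec (hz₁.subVec hz₂)
  refine Det.mono ((hc₁.sub hc₂).opening hr (Det.vec3 (hx.com1.sub (hx.pk1.dot hr))
    (hx.com2.sub (hx.pk2.dot hr)) (hx.com3.sub (hx.stmtB.dot hr)))) ?_
  unfold openingC
  linarith

theorem Det.extractSIS (hc₁ : Det pp O 0 c₁) (hc₂ : Det pp O 0 c₂) (hc₃ : Det pp O 0 c₃)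
    (hz₁ : Det pp O 0 z₁) (hz₂ : Det pp O 0 z₂) (hz₃ : Det pp O 0 z₃) :
    Det pp O (2 * linC pp + 3 * (pp.m * linC pp) + 2 * (pp.m * mulC pp))
      fun a => Params.extractSIS (c₁ a) (c₂ a) (c₃ a) (z₁ a) (z₂ a) (z₃ a) := by
  refine Det.mono (((hc₁.sub hc₂).smulVec (hz₃.subVec hz₁)).subVec
    ((hc₃.sub hc₁).smulVec (hz₁.subVec hz₂))) ?_
  linarith

end

/-- Only third-round answers are queried: neither the opening nor the SIS candidate involves the
prover's first two messages. -/
theorem Comp.extract : Comp pp (proverOracle (pp := pp)) (extractC pp) (extract (pp := pp)) := by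
  have hT : ∀ {α : Type} [WordEnc pp.q α] [LawfulEnc α] {t : α → Slots pp × pp.Rq},
      Det pp (proverOracle (pp := pp)) 0 t → Comp pp (proverOracle (pp := pp)) 1
        fun S a => PMF.pure (S.third (t a).1 (t a).2) :=
    fun ht => (Comp.third.pre ht).mono (by simp)
  let T := Slots pp × pp.Rq
  let Z := Fin pp.m → pp.Rq
  have out : Det pp (proverOracle (pp := pp)) _
      fun a : (((((Stmt pp × T) × T) × T) × Z) × Z) × Z =>
      (Params.extractOpening a.1.1.1.1.1.1 a.1.1.1.1.1.2.2 a.1.1.1.1.2.2 a.1.1.2 a.1.2,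
        Params.extractSIS a.1.1.1.1.1.2.2 a.1.1.1.1.2.2 a.1.1.1.2.2 a.1.1.2 a.1.2 a.2) :=
    (Det.extractOpening Det.id.fst'.fst'.fst'.fst'.fst'.fst' Det.id.fst'.fst'.fst'.fst'.fst'.snd'.snd'
      Det.id.fst'.fst'.fst'.fst'.snd'.snd' Det.id.fst'.fst'.snd' Det.id.fst'.snd').pair
    (Det.extractSIS Det.id.fst'.fst'.fst'.fst'.fst'.snd'.snd' Det.id.fst'.fst'.fst'.fst'.snd'.snd'
      Det.id.fst'.fst'.fst'.snd'.snd' Det.id.fst'.fst'.snd' Det.id.fst'.snd' Det.id.snd')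
  have h := Comp.bind (α := Stmt pp) Comp.challenges <| Comp.bind Comp.challenges <|
    Comp.bind Comp.challenges <|
    Comp.bind (hT (t := fun a => a.1.1.2) Det.id.fst'.fst'.snd') <|
    Comp.bind (hT (t := fun a => a.1.1.2) Det.id.fst'.fst'.snd') <|
    Comp.bindMap (hT (t := fun a => a.1.1.2) Det.id.fst'.fst'.snd') out
  refine RComp.congr (h.mono ?_) fun S x => ?_
  · unfold extractC
    linarith
  · simp only [PMF.pure_bind, PMF.pure_map]
    rfl

theorem exists_extractor : ∃ K : Extractor pp, K.size ≤ extractC pp ∧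
    ∀ S x, K.run S x = extract S x := by
  obtain ⟨K, hK, hF⟩ := Comp.extract (pp := pp)
  refine ⟨K, hK, fun S x => ?_⟩
  unfold Extractor.run
  rw [hF, PMF.map_comp, LawfulEnc.dec_enc]
  have : (WordEnc.dec ∘ WordEnc.enc : Opening pp × (Fin pp.m → pp.Rq) → _) = id :=
    funext LawfulEnc.dec_enc
  rw [this, PMF.map_id]

end extractor

theorem knowledgeSound_of_admissible {pp : ℕ → Params} (h : Admissible pp) :
    KnowledgeSound pp fun η => (pp η).knowledgeError := by
  choose K hK hF using fun η => exists_extractor (pp := pp η)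
  refine ⟨3, by norm_num, 1, fun _ => by simp, K, ?_, fun η x Ps ha => ?_⟩
  · refine PolyBounded.of_le (f := fun η => extractC (pp η)) ?_ hK
    simp only [extractC, openingC, dotC, linC, mulC, Params.m]
    repeat' first
      | exact h.d_poly
      | exact h.κ_poly
      | exact h.lam_poly
      | exact h.size_invExp
      | exact PolyBounded.const _
      | apply PolyBounded.add
      | apply PolyBounded.mul
  · have := extraction_cube (h.equidistribution η) x Ps ha
    simp only [Polynomial.eval_one, Nat.cast_one, div_one, hF]
    refine this.trans_eq ?_
    rw [prob_eq]
    congr 1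
    unfold extract
    simp only [Ex_bind, Ex_map]
    rfl

end

end PoA

namespace PoA
noncomputable section

open Params

/-! ## Indistinguishability -/

/-- The answers of no oracles. -/
def noAnswers (pp : Params) : Unit → Answers pp OracleSig.none := fun _ s => s.elim

theorem Comp.exists_algo {pp : Params} {α β : Type} [WordEnc pp.q α] [WordEnc pp.q β]
    [LawfulEnc α] [LawfulEnc β] {N : ℕ} {F : α → PMF β}
    (h : Comp pp (noAnswers pp) N fun _ => F) :
    ∃ C : Algo pp α β, C.size ≤ N ∧ ∀ a, C.run a = F a := by
  obtain ⟨C, hC, hF⟩ := h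
  refine ⟨C, hC, fun a => ?_⟩
  have := hF () (WordEnc.enc a)
  beta_reduce at this
  rw [LawfulEnc.dec_enc] at this
  unfold Algo.run
  refine (congrArg (PMF.map WordEnc.dec) this).trans ?_
  rw [PMF.map_comp]
  have : (WordEnc.dec ∘ WordEnc.enc : β → β) = id := funext LawfulEnc.dec_enc
  rw [this, PMF.map_id]

section indist

variable {pp : ℕ → Params} {α β : ℕ → Type} [∀ η, WordEnc (pp η).q (α η)]
  [∀ η, WordEnc (pp η).q (β η)]

theorem Indist.symm {X Y : ∀ η, PMF (α η)} (h : Indist pp α X Y) : Indist pp α Y X := by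
  intro D hD
  simpa only [abs_sub_comm] using h D hD

theorem Indist.trans {X Y Z : ∀ η, PMF (α η)} (h : Indist pp α X Y) (h' : Indist pp α Y Z) :
    Indist pp α X Z := by
  intro D hD
  refine ((h D hD).add (h' D hD)).of_abs_le fun η => ?_
  rw [abs_abs]
  exact abs_sub_le _ _ _

/-- Indistinguishability is preserved by polynomial-size postprocessing. -/
theorem Indist.bind [∀ η, LawfulEnc (α η)] {X Y : ∀ η, PMF (α η)} (h : Indist pp α X Y)
    {F : ∀ η, α η → PMF (β η)} {N : ℕ → ℕ}
    (hF : ∀ η, Comp (pp η) (noAnswers (pp η)) (N η) fun _ => F η) (hN : PolyBounded N) :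
    Indist pp β (fun η => (X η).bind (F η)) (fun η => (Y η).bind (F η)) := by
  intro D hD
  choose C hC hCF using hF
  have key : ∀ η (Z : PMF (α η)), Distinguisher.prob (D η) (Z.bind (F η)) =
      Distinguisher.prob (.seq (C η) (D η)) Z := by
    intro η Z
    unfold Distinguisher.prob
    rw [PMF.bind_bind]
    congr 2; funext a
    have := hCF η () (WordEnc.enc a)
    beta_reduce at this
    rw [LawfulEnc.dec_enc] at this
    simp only [Circuit.run]
    refine Eq.trans ?_ (congrArg (fun p => PMF.bind p _) this.symm)
    rw [PMF.bind_map]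
    rfl
  simp only [key]
  exact h (fun η => .seq (C η) (D η)) ((hN.add hD).of_le fun η => Nat.add_le_add_right (hC η) _)

end indist

theorem Ex_close {α : Type} (p : PMF α) {f g : α → ℝ≥0∞} {δ : ℝ} (hδ : 0 ≤ δ) (hf : ∀ a, f a ≤ 1)
    (hg : ∀ a, g a ≤ 1) (h : ∀ a ∈ p.support, |(f a).toReal - (g a).toReal| ≤ δ) :
    |(Ex p f).toReal - (Ex p g).toReal| ≤ δ := by
  have half : ∀ {f g : α → ℝ≥0∞}, (∀ a, f a ≤ 1) → (∀ a, g a ≤ 1) →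
      (∀ a ∈ p.support, (f a).toReal - (g a).toReal ≤ δ) →
      (Ex p f).toReal - (Ex p g).toReal ≤ δ := by
    intro f g hf hg h
    have h1 : Ex p f ≤ Ex p g + ENNReal.ofReal δ := by
      rw [← Ex_const p (ENNReal.ofReal δ), ← Ex_add]
      refine Ex_mono' _ fun a ha => ?_
      rw [← ENNReal.ofReal_toReal (ne_top_of_le_ne_top ENNReal.one_ne_top (hf a)),
        ← ENNReal.ofReal_toReal (ne_top_of_le_ne_top ENNReal.one_ne_top (hg a)),
        ← ENNReal.ofReal_add ENNReal.toReal_nonneg hδ]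
      exact ENNReal.ofReal_le_ofReal (by linarith [h a ha])
    have hG := ne_top_of_le_ne_top ENNReal.one_ne_top (Ex_le_one p hg)
    have := ENNReal.toReal_mono (ENNReal.add_ne_top.2 ⟨hG, ENNReal.ofReal_ne_top⟩) h1
    rw [ENNReal.toReal_add hG ENNReal.ofReal_ne_top, ENNReal.toReal_ofReal hδ] at this
    linarith
  rw [abs_sub_le_iff]
  exact ⟨half hf hg fun a ha => (abs_sub_le_iff.1 (h a ha)).1,
    half hg hf fun a ha => (abs_sub_le_iff.1 (h a ha)).2⟩

/-- Statistical closeness for each fixed outcome of a common source needs no bound on the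
distinguisher. -/
theorem Indist.of_close {pp : ℕ → Params} {α β : ℕ → Type} [∀ η, WordEnc (pp η).q (β η)]
    (X : ∀ η, PMF (α η)) (F G : ∀ η, α η → PMF (β η)) {δ : ℕ → ℝ} (hδ : Negligible δ)
    (hδ0 : ∀ η, 0 ≤ δ η)
    (h : ∀ η, ∀ a ∈ (X η).support, ∀ f : β η → ℝ≥0∞, (∀ b, f b ≤ 1) →
      |(Ex (F η a) f).toReal - (Ex (G η a) f).toReal| ≤ δ η) :
    Indist pp β (fun η => (X η).bind (F η)) (fun η => (X η).bind (G η)) := by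
  intro D _
  refine hδ.of_abs_le fun η => ?_
  rw [abs_abs]
  unfold Distinguisher.prob
  rw [prob_eq, prob_eq]
  simp only [Ex_bind]
  have h1 : ∀ b : β η, (Ex (Circuit.run (pp η) (S := OracleSig.none) (fun s => s.elim) (D η)
      (WordEnc.enc b)) fun o => ind (o () = 1)) ≤ 1 := fun b => Ex_ind_le_one _ _
  exact Ex_close _ (hδ0 η) (fun a => Ex_le_one _ h1) (fun a => Ex_le_one _ h1)
    fun a ha => h η a ha _ h1

/-! ## Uniform ring elements and matrices -/

section uniform

variable {pp : Params}

theorem unifR_eq : pp.unifR = PMF.uniformOfFintype pp.Rq :=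
  uniform_map_equiv (coefEquiv pp).symm.toEquiv

theorem Ex_unifR_add (s : pp.Rq) (f : pp.Rq → ℝ≥0∞) :
    (Ex pp.unifR fun u => f (u + s)) = Ex pp.unifR f := by
  have h : pp.unifR.map (Equiv.addRight s) = pp.unifR := by
    rw [unifR_eq]
    exact uniform_map_equiv _
  conv_rhs => rw [← h, Ex_map]
  rfl

theorem unifMat_transpose (r s : ℕ) : (pp.unifMat r s).map Matrix.transpose = pp.unifMat s r := by
  have h : ∀ r s, pp.unifMat r s = PMF.uniformOfFintype (Fin r → Fin s → pp.Rq) := by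
    intro r s
    unfold unifMat
    rw [unifR_eq, iid_uniform, iid_uniform]
  rw [h, h]
  exact uniform_map_equiv (Equiv.piComm fun (_ : Fin r) (_ : Fin s) => pp.Rq)

/-- Headless elements form an additive group, on which the uniform law is translation invariant. -/
theorem Ex_unifG_add (s : pp.Rq) (hs : ∀ k : Fin pp.d, (k : ℕ) < pp.n → coef s k = 0)
    (f : pp.Rq → ℝ≥0∞) : (Ex pp.unifG fun g => f (g + s)) = Ex pp.unifG f := by
  rw [unifG_eq, Ex_map, Ex_map, ← Ex_unifR_add s fun g => f (eraseHead g)]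
  congr 1; funext g
  congr 1
  apply (coefEquiv pp).injective
  rw [map_add]
  change coef (eraseHead g) + coef s = coef (eraseHead (g + s))
  unfold eraseHead
  rw [coef_ofCoef, coef_ofCoef, coef_add]
  funext k
  simp only [Pi.add_apply]
  split_ifs with hk
  · rw [hs k hk, add_zero]
  · rfl

/-- One-time-pad masking of three values that may depend on earlier masks and on other data. -/
theorem Ex_unifR_shift₃ {τ : Type} (p : PMF τ) (s₁ : pp.Rq) (s₂ : pp.Rq → τ → pp.Rq)
    (s₃ : τ → pp.Rq) (f : pp.Rq → pp.Rq → pp.Rq → τ → ℝ≥0∞) :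
    (Ex pp.unifR fun u₁ => Ex pp.unifR fun u₂ => Ex pp.unifR fun u₃ => Ex p fun y =>
      f (u₁ + s₁) (u₂ + s₂ u₁ y) (u₃ + s₃ y) y) =
    Ex pp.unifR fun u₁ => Ex pp.unifR fun u₂ => Ex pp.unifR fun u₃ => Ex p fun y =>
      f u₁ u₂ u₃ y := by
  -- The pads are independent of the other data, so `y` may be drawn before the last two; each shift
  -- is then constant relative to its pad.
  have e : ∀ g : pp.Rq → pp.Rq → τ → ℝ≥0∞,
      (Ex pp.unifR fun u₂ => Ex pp.unifR fun u₃ => Ex p fun y => g u₂ u₃ y) =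
      Ex p fun y => Ex pp.unifR fun u₂ => Ex pp.unifR fun u₃ => g u₂ u₃ y := by
    intro g
    rw [Ex_comm p]
    congr 1; funext u₂
    exact Ex_comm _ _ _
  simp only [e]
  rw [← Ex_unifR_add s₁ fun u₁ => Ex p fun y => Ex pp.unifR fun u₂ => Ex pp.unifR fun u₃ =>
    f u₁ u₂ u₃ y]
  congr 1; funext u₁; congr 1; funext y
  rw [← Ex_unifR_add (s₂ u₁ y) fun u₂ => Ex pp.unifR fun u₃ => f (u₁ + s₁) u₂ u₃ y]
  congr 1; funext u₂
  exact Ex_unifR_add (s₃ y) fun u₃ => f (u₁ + s₁) (u₂ + s₂ u₁ y) u₃ y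

end uniform

end

end PoA

namespace PoA
noncomputable section

open Params

/-! ## The commitment key as a single matrix -/

section keys

variable {pp : Params}

/-- A matrix with `κ + 6` rows applied to a vector. -/
abbrev KeySample (pp : Params) : Type :=
  Matrix (Fin (pp.κ + 6)) (Fin pp.m) pp.Rq × (Fin (pp.κ + 6) → pp.Rq)

/-- Prepending six entries. -/
def cons₆ {β : Type} {k : ℕ} (a₀ a₁ a₂ a₃ a₄ a₅ : β) (v : Fin k → β) : Fin (k + 6) → β :=
  Fin.cons (α := fun _ => β) a₀ <| Fin.cons (α := fun _ => β) a₁ <|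
    Fin.cons (α := fun _ => β) a₂ <| Fin.cons (α := fun _ => β) a₃ <|
    Fin.cons (α := fun _ => β) a₄ <| Fin.cons (α := fun _ => β) a₅ v

theorem Ex_iid_add_six {β : Type} (p : PMF β) (k : ℕ) (f : (Fin (k + 6) → β) → ℝ≥0∞) :
    Ex (iid p (k + 6)) f = Ex p fun a₀ => Ex p fun a₁ => Ex p fun a₂ => Ex p fun a₃ =>
      Ex p fun a₄ => Ex p fun a₅ => Ex (iid p k) fun v => f (cons₆ a₀ a₁ a₂ a₃ a₄ a₅ v) := by
  rw [Ex_iid_succ]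
  congr 1; funext a₀
  rw [Ex_iid_succ]
  congr 1; funext a₁
  rw [Ex_iid_succ]
  congr 1; funext a₂
  rw [Ex_iid_succ]
  congr 1; funext a₃
  rw [Ex_iid_succ]
  congr 1; funext a₄
  rw [Ex_iid_succ]
  rfl

/-- All rows of the key in one matrix. -/
def stack (A : Matrix (Fin pp.κ) (Fin pp.m) pp.Rq) (pk2 pk1 b aBin aBin' aG : Fin pp.m → pp.Rq) :
    Matrix (Fin (pp.κ + 6)) (Fin pp.m) pp.Rq :=
  Matrix.of (cons₆ pk2 pk1 b aBin aBin' aG fun i => A i)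

theorem stack_mulVec (A : Matrix (Fin pp.κ) (Fin pp.m) pp.Rq)
    (pk2 pk1 b aBin aBin' aG r : Fin pp.m → pp.Rq) :
    stack A pk2 pk1 b aBin aBin' aG *ᵥ r = cons₆ (pk2 ⬝ᵥ r) (pk1 ⬝ᵥ r) (b ⬝ᵥ r) (aBin ⬝ᵥ r)
      (aBin' ⬝ᵥ r) (aG ⬝ᵥ r) (A *ᵥ r) := by
  funext i
  refine Fin.cases rfl (fun i => ?_) i
  refine Fin.cases rfl (fun i => ?_) i
  refine Fin.cases rfl (fun i => ?_) i
  refine Fin.cases rfl (fun i => ?_) i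
  refine Fin.cases rfl (fun i => ?_) i
  refine Fin.cases rfl (fun i => ?_) i
  rfl

/-- The uniform rows and the randomness, after `A`, `pk1` and `pk2` have been fixed. -/
def keyTail (A : Matrix (Fin pp.κ) (Fin pp.m) pp.Rq) (pk1 pk2 : Fin pp.m → pp.Rq) :
    PMF (KeySample pp) :=
  (iid pp.unifR pp.m).bind fun b =>
  (iid pp.unifR pp.m).bind fun aBin =>
  (iid pp.unifR pp.m).bind fun aBin' =>
  (iid pp.unifR pp.m).bind fun aG =>
  (iid pp.smallR pp.m).map fun r =>
    (stack A pk2 pk1 b aBin aBin' aG, stack A pk2 pk1 b aBin aBin' aG *ᵥ r)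

variable (pp) in
/-- The honestly generated key, and its product with the commitment randomness. -/
def keyReal : PMF (KeySample pp) :=
  (pp.unifMat pp.κ pp.m).bind fun A =>
  (iid pp.smallR pp.κ).bind fun s1 => (iid pp.smallR pp.m).bind fun e1 =>
  (iid pp.smallR pp.κ).bind fun s2 => (iid pp.smallR pp.m).bind fun e2 =>
    keyTail A (Aᵀ *ᵥ s1 + e1) (Aᵀ *ᵥ s2 + e2)

/-- A module-LWE sample, or a uniform one. -/
abbrev LweSample (pp : Params) : Type :=
  Matrix (Fin pp.m) (Fin pp.κ) pp.Rq × (Fin pp.m → pp.Rq)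

/-- Completion of a sample for `pk1`. -/
def completeFst (t : LweSample pp) : PMF (KeySample pp) :=
  (iid pp.smallR pp.κ).bind fun s2 => (iid pp.smallR pp.m).bind fun e2 =>
    keyTail t.1ᵀ t.2 (t.1 *ᵥ s2 + e2)

/-- Completion of a sample for `pk2`. -/
def completeSnd (t : LweSample pp) : PMF (KeySample pp) :=
  (iid pp.unifR pp.m).bind fun u1 => keyTail t.1ᵀ u1 t.2

theorem keyReal_eq : keyReal pp = (mlweReal pp pp.m pp.κ).bind completeFst := by
  refine pmf_ext_Ex fun f => ?_
  unfold keyReal mlweReal completeFst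
  rw [← unifMat_transpose]
  simp only [Ex_bind, Ex_map, Matrix.transpose_transpose]

/-- The middle hybrid, with `pk₁` uniform and `pk₂` still an LWE vector, seen from both sides; only
the order of the draws differs. -/
theorem ideal_completeFst : (lweIdeal pp pp.m pp.κ).bind completeFst =
    (mlweReal pp pp.m pp.κ).bind completeSnd := by
  refine pmf_ext_Ex fun f => ?_
  unfold lweIdeal mlweReal completeFst completeSnd
  simp only [Ex_bind, Ex_map]
  congr 1; funext A
  rw [Ex_comm]
  congr 1; funext s
  rw [Ex_comm]

/-- Once both public keys are uniform, all `κ + 6` rows are independent and uniform, so the key with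
its product by `r` is a dual module-LWE sample. -/
theorem ideal_completeSnd : (lweIdeal pp pp.m pp.κ).bind completeSnd =
    dualReal pp (pp.κ + 6) pp.m := by
  refine pmf_ext_Ex fun f => ?_
  unfold lweIdeal dualReal completeSnd keyTail
  let R := iid pp.unifR pp.m
  let P : PMF ((Fin pp.m → pp.Rq) × (Fin pp.m → pp.Rq) × (Fin pp.m → pp.Rq) × (Fin pp.m → pp.Rq) ×
      (Fin pp.m → pp.Rq) × (Fin pp.m → pp.Rq)) :=
    R.bind fun a => R.bind fun b => R.bind fun c => R.bind fun d => R.bind fun e => R.map fun f =>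
      (a, b, c, d, e, f)
  have h := Ex_comm (pp.unifMat pp.κ pp.m) P fun A t => Ex (iid pp.smallR pp.m) fun r =>
    f (stack A t.1 t.2.1 t.2.2.1 t.2.2.2.1 t.2.2.2.2.1 t.2.2.2.2.2,
      stack A t.1 t.2.1 t.2.2.1 t.2.2.2.1 t.2.2.2.2.1 t.2.2.2.2.2 *ᵥ r)
  simp only [P, R, Ex_bind, Ex_map] at h
  rw [← unifMat_transpose]
  simp only [Ex_bind, Ex_map, Matrix.transpose_transpose]
  rw [h]
  exact (Ex_iid_add_six (iid pp.unifR pp.m) pp.κ fun M =>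
    Ex (iid pp.smallR pp.m) fun r => f (Matrix.of M, Matrix.of M *ᵥ r)).symm

/-! ### The reductions are efficient -/

variable {S : OracleSig} {Ω : Type*} {O : Ω → Answers pp S} {α : Type}
  [WordEnc pp.q α] [LawfulEnc α]

theorem Det.rows {β : Type} [WordEnc pp.q β] [LawfulEnc β] {r s N : ℕ}
    {f : α → Matrix (Fin r) (Fin s) β} (h : Det pp O N f) :
    Det pp O N fun a => (fun i => f a i : Fin r → Fin s → β) := by
  have h1 : Det pp O 0 fun v : Matrix (Fin r) (Fin s) β => (fun i => v i : Fin r → Fin s → β) :=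
    Det.of_wire (β := Fin r → Fin s → β) (fun j => ((j.1, j.2.1), j.2.2)) fun _ _ => rfl
  exact (h1.comp h).mono (by simp)

theorem Det.stack {A : α → Matrix (Fin pp.κ) (Fin pp.m) pp.Rq}
    {pk2 pk1 b aBin aBin' aG : α → Fin pp.m → pp.Rq} {N : ℕ} (hA : Det pp O N A)
    (h0 : Det pp O N pk2) (h1 : Det pp O N pk1) (h2 : Det pp O N b) (h3 : Det pp O N aBin)
    (h4 : Det pp O N aBin') (h5 : Det pp O N aG) :
    Det pp O (7 * N) fun a => PoA.stack (A a) (pk2 a) (pk1 a) (b a) (aBin a) (aBin' a) (aG a) :=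
  (h0.cons (h1.cons (h2.cons (h3.cons (h4.cons (h5.cons hA.rows)))))).ofRows.mono (by linarith)

/-- Sampling a vector and continuing. -/
theorem Samp.thenBind {β γ : Type} [WordEnc pp.q β] [LawfulEnc β] [WordEnc pp.q γ] {N M : ℕ}
    {μ : PMF β} {G : α × β → PMF γ} (h : Samp pp O N μ) (hG : Comp pp O M fun _ => G) :
    Comp pp O (N + M) fun _ a => μ.bind fun b => G (a, b) :=
  Comp.bind h.comp hG

theorem Samp.thenMap {β γ : Type} [WordEnc pp.q β] [LawfulEnc β] [WordEnc pp.q γ] {N M : ℕ}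
    {μ : PMF β} {g : α × β → γ} (h : Samp pp O N μ) (hg : Det pp O M g) :
    Comp pp O (N + M) fun _ a => μ.map fun b => g (a, b) :=
  Comp.bindMap h.comp hg

variable (pp) in
/-- Cost of sampling the uniform rows and the randomness. -/
def keyTailC : ℕ := 5 * (pp.m * pp.d) + (pp.κ + 6) * dotC pp pp.m

theorem Comp.keyTail : Comp pp O (keyTailC pp) fun _
    (t : Matrix (Fin pp.κ) (Fin pp.m) pp.Rq × (Fin pp.m → pp.Rq) × (Fin pp.m → pp.Rq)) =>
      PoA.keyTail t.1 t.2.1 t.2.2 := by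
  let V := Fin pp.m → pp.Rq
  let T := Matrix (Fin pp.κ) (Fin pp.m) pp.Rq × V × V
  have hst : Det pp O 0 fun a : ((((T × V) × V) × V) × V) × V =>
      PoA.stack a.1.1.1.1.1.1 a.1.1.1.1.1.2.2 a.1.1.1.1.1.2.1 a.1.1.1.1.2 a.1.1.1.2 a.1.1.2 a.1.2 :=
    (Det.stack Det.id.fst'.fst'.fst'.fst'.fst'.fst' Det.id.fst'.fst'.fst'.fst'.fst'.snd'.snd'
      Det.id.fst'.fst'.fst'.fst'.fst'.snd'.fst' Det.id.fst'.fst'.fst'.fst'.snd'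
      Det.id.fst'.fst'.fst'.snd' Det.id.fst'.fst'.snd' Det.id.fst'.snd').mono (by simp)
  have hU := Samp.iid (Samp.unifR (pp := pp) (O := O)) pp.m
  have hS := Samp.iid (Samp.smallR (pp := pp) (O := O)) pp.m
  have h := hU.thenBind (α := T) <| hU.thenBind <| hU.thenBind <| hU.thenBind <|
    hS.thenMap (hst.pair (hst.mulVec Det.id.snd'))
  refine h.mono ?_
  unfold keyTailC
  linarith

variable (pp) in
/-- Cost of completing a sample for one of the keys. -/
def completeC : ℕ :=
  pp.κ * pp.d + pp.m * pp.d + (pp.m * dotC pp pp.κ + pp.m * linC pp) + keyTailC pp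

theorem Comp.completeFst : Comp pp O (completeC pp) fun _ => PoA.completeFst (pp := pp) := by
  have hS := fun r => Samp.iid (Samp.smallR (pp := pp) (O := O)) r
  have h := (hS pp.κ).thenBind (α := LweSample pp) <| (hS pp.m).thenBind <|
    Comp.keyTail.pre (Det.id.fst'.fst'.fst'.transpose.pair (Det.id.fst'.fst'.snd'.pair
      ((Det.id.fst'.fst'.fst'.mulVec Det.id.fst'.snd').addVec Det.id.snd')))
  refine h.mono ?_
  unfold completeC
  linarith

theorem Comp.completeSnd : Comp pp O (completeC pp) fun _ => PoA.completeSnd (pp := pp) := by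
  have hU := Samp.iid (Samp.unifR (pp := pp) (O := O)) pp.m
  have h := hU.thenBind (α := LweSample pp) <|
    Comp.keyTail.pre (Det.id.fst'.fst'.transpose.pair (Det.id.snd'.pair Det.id.fst'.snd'))
  refine h.mono ?_
  unfold completeC
  have := Nat.zero_le (pp.κ * pp.d + (pp.m * dotC pp pp.κ + pp.m * linC pp))
  linarith

end keys

/-- Under module-LWE and dual module-LWE, the key and its product with the randomness look
uniform. -/
theorem keyReal_indist {pp : ℕ → Params} (h : Admissible pp) (hM : MLWEHard pp)
    (hD : DualMLWEHard pp) :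
    Indist pp (fun η => KeySample (pp η)) (fun η => keyReal (pp η))
      (fun η => lweIdeal (pp η) ((pp η).κ + 6) (pp η).m) := by
  have hC : PolyBounded fun η => completeC (pp η) := by
    simp only [completeC, keyTailC, dotC, linC, mulC, Params.m]
    repeat' first
      | exact h.d_poly
      | exact h.κ_poly
      | exact h.lam_poly
      | exact PolyBounded.const _
      | apply PolyBounded.add
      | apply PolyBounded.mul
  -- Module-LWE is used twice, once per public key, with the remaining draws as postprocessing; dual
  -- module-LWE ends the chain.
  have h1 := Indist.bind (β := fun η => KeySample (pp η)) hM (fun η => Comp.completeFst) hC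
  have h2 := Indist.bind (β := fun η => KeySample (pp η)) hM (fun η => Comp.completeSnd) hC
  simp only [← keyReal_eq, ideal_completeFst] at h1
  simp only [ideal_completeSnd] at h2
  exact (h1.trans h2).trans hD

end

end PoA

namespace PoA
noncomputable section

open Params

/-! ## The simulator -/

section sim

variable {pp : Params}

/-- The transcript determined by a statement, the masked values, the challenges and the response
through the verification equations. -/
def completeTranscript (x : Stmt pp) (f u1 u2 h : pp.Rq) (φ : Slots pp) (c : pp.Rq)
    (z : Fin pp.m → pp.Rq) : Transcript pp :=
  ⟨⟨f, u1, u2,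
      (x.aBin ⬝ᵥ z - c * f) * (x.aBin ⬝ᵥ z - c * f + c) + x.aBin' ⬝ᵥ z - c * u1,
      x.A *ᵥ z - c • x.com0⟩,
    φ,
    ⟨h, x.aG ⬝ᵥ z + (x.aBin ⬝ᵥ z) * invNtt (QT φ) - (x.pk1 ⬝ᵥ z) * invNtt φ
      - c * (invNtt (QT φ) * f - invNtt φ * x.com1 + u2 - h)⟩, c, z⟩

/-- Opening proof term, challenges and response, in the order `(h, φ, c, z)`. -/
abbrev Coins (pp : Params) : Type := pp.Rq × Slots pp × pp.Rq × (Fin pp.m → pp.Rq)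

variable (pp) in
/-- The part of a simulated transcript that does not depend on the statement. -/
def coins : PMF (Coins pp) :=
  pp.unifG.bind fun h => pp.unifSlots.bind fun φ => pp.chal.bind fun c =>
    pp.gaussVec.map fun z => (h, φ, c, z)

/-- The simulator. -/
def simulate (x : Stmt pp) : PMF (Transcript pp) :=
  pp.unifR.bind fun f => pp.unifR.bind fun u1 => pp.unifR.bind fun u2 =>
    (coins pp).map fun t => completeTranscript x f u1 u2 t.1 t.2.1 t.2.2.1 t.2.2.2

/-- The verification equations determine `u₃`, `w` and `u₄` from the other entries; for `u₃` this
uses that bit vectors are idempotent. The witness remains only in `f`, `u₁`, `u₂` and `h`. -/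
theorem responseTranscript_eq {x : Stmt pp} {w : Wit pp} (h0 : x.com0 = x.A *ᵥ w.r)
    (h1 : x.com1 = x.pk1 ⬝ᵥ w.r + (w.v : pp.Rq)) (z : Fin pp.m → pp.Rq) (g : pp.Rq)
    (φ : Slots pp) (c : pp.Rq) :
    responseTranscript x w z g φ c = completeTranscript x (x.aBin ⬝ᵥ w.r + bits w.v)
      (x.aBin' ⬝ᵥ w.r + (x.aBin ⬝ᵥ z - c * (x.aBin ⬝ᵥ w.r)) * (1 - 2 * bits w.v))
      (x.aG ⬝ᵥ w.r + g)
      (g + (invNtt (QT φ) * bits w.v - invNtt φ * (w.v : pp.Rq))) φ c z := by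
  unfold responseTranscript completeTranscript prove1 prove2
  simp only [Transcript.mk.injEq, Msg1.mk.injEq, Msg2.mk.injEq, true_and, and_true, h0, h1,
    dotProduct_sub, dotProduct_smul, smul_eq_mul, Matrix.mulVec_sub, Matrix.mulVec_smul]
  refine ⟨?_, by ring, by ring⟩
  linear_combination (-c ^ 2) * (bits_mul_self (pp := pp) w.v)

/-- The statement for messages `(v, m2, m3)` read off from a key sample. -/
def stmtOf (v : ℕ) (m2 m3 : pp.Rq) (t : KeySample pp) : Stmt pp where
  A := Matrix.of fun i => t.1 i.succ.succ.succ.succ.succ.succ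
  pk2 := t.1 0
  pk1 := t.1 (Fin.succ 0)
  b := t.1 (Fin.succ (Fin.succ 0))
  aBin := t.1 (Fin.succ (Fin.succ (Fin.succ 0)))
  aBin' := t.1 (Fin.succ (Fin.succ (Fin.succ (Fin.succ 0))))
  aG := t.1 (Fin.succ (Fin.succ (Fin.succ (Fin.succ (Fin.succ 0)))))
  com0 := fun i => t.2 i.succ.succ.succ.succ.succ.succ
  com1 := t.2 (Fin.succ 0) + (v : pp.Rq)
  com2 := t.2 0 + m2
  com3 := t.2 (Fin.succ (Fin.succ 0)) + m3

/-- The ideal honest transcript, as a function of a key sample. -/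
def honestView (v : ℕ) (m2 m3 : pp.Rq) (t : KeySample pp) : PMF (Stmt pp × Transcript pp) :=
  (coins pp).map fun a =>
    (stmtOf v m2 m3 t, completeTranscript (stmtOf v m2 m3 t)
      (t.2 (Fin.succ (Fin.succ (Fin.succ 0))) + bits v)
      (t.2 (Fin.succ (Fin.succ (Fin.succ (Fin.succ 0)))) +
        ((stmtOf v m2 m3 t).aBin ⬝ᵥ a.2.2.2 - a.2.2.1 * t.2 (Fin.succ (Fin.succ (Fin.succ 0)))) *
          (1 - 2 * bits v))
      (t.2 (Fin.succ (Fin.succ (Fin.succ (Fin.succ (Fin.succ 0))))) +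
        (a.1 - (invNtt (QT a.2.1) * bits v - invNtt a.2.1 * (v : pp.Rq))))
      a.1 a.2.1 a.2.2.1 a.2.2.2)

/-- The simulated transcript, as a function of a key sample. -/
def simView (v : ℕ) (m2 m3 : pp.Rq) (t : KeySample pp) : PMF (Stmt pp × Transcript pp) :=
  (simulate (stmtOf v m2 m3 t)).map fun T => (stmtOf v m2 m3 t, T)

/-- The statement of an honest instance. -/
abbrev honestStmt (v : ℕ) (m2 m3 : pp.Rq) (A : Matrix (Fin pp.κ) (Fin pp.m) pp.Rq)
    (pk2 pk1 b aBin aBin' aG r : Fin pp.m → pp.Rq) : Stmt pp :=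
  ⟨A, pk1, pk2, b, aBin, aBin', aG, A *ᵥ r, pk1 ⬝ᵥ r + (v : pp.Rq), pk2 ⬝ᵥ r + m2, b ⬝ᵥ r + m3⟩

theorem stmtOf_stack (v : ℕ) (m2 m3 : pp.Rq) (A : Matrix (Fin pp.κ) (Fin pp.m) pp.Rq)
    (pk2 pk1 b aBin aBin' aG r : Fin pp.m → pp.Rq) :
    stmtOf v m2 m3 (stack A pk2 pk1 b aBin aBin' aG, stack A pk2 pk1 b aBin aBin' aG *ᵥ r) =
      honestStmt v m2 m3 A pk2 pk1 b aBin aBin' aG r := by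
  rw [stack_mulVec]
  rfl

/-- The ideal run of the honest prover, as a function of the key sample. -/
theorem idealRun_eq_honestView (v : ℕ) (hv : v < 2 ^ 64) (m2 m3 : pp.Rq)
    (A : Matrix (Fin pp.κ) (Fin pp.m) pp.Rq) (pk2 pk1 b aBin aBin' aG r : Fin pp.m → pp.Rq)
    (x : Stmt pp) (hx : x = honestStmt v m2 m3 A pk2 pk1 b aBin aBin' aG r) :
    (idealRun x ⟨r, v, m2, m3⟩).map (fun t => (x, t)) = honestView v m2 m3
      (stack A pk2 pk1 b aBin aBin' aG, stack A pk2 pk1 b aBin aBin' aG *ᵥ r) := by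
  refine pmf_ext_Ex fun F => ?_
  unfold honestView
  rw [stmtOf_stack, ← hx, stack_mulVec]
  unfold idealRun coins gaussVec
  simp only [Ex_bind, Ex_map]
  -- With `φ` drawn before `g`, the shift from `g` to `h` is a constant with vanishing head, so `h`
  -- has the law of `g`.
  rw [Ex_comm, Ex_comm (pp.unifG)]
  congr 1; funext φ
  symm
  rw [← Ex_unifG_add (invNtt (QT φ) * bits v - invNtt φ * (v : pp.Rq))
    (coef_proof_vanish φ v hv)]
  congr 1; funext g
  congr 1; funext c
  congr 1; funext z
  rw [responseTranscript_eq (by rw [hx]) (by rw [hx])]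
  rw [add_sub_cancel_right]
  subst hx
  rfl

/-- Honest instances with the secret keys sampled before the uniform rows. -/
theorem Ex_genInstance (v : ℕ) (m2 m3 : pp.Rq) (F : Stmt pp × Wit pp → ℝ≥0∞) :
    Ex (genInstance pp v m2 m3) F = Ex (pp.unifMat pp.κ pp.m) fun A =>
      Ex (iid pp.smallR pp.κ) fun s1 => Ex (iid pp.smallR pp.m) fun e1 =>
      Ex (iid pp.smallR pp.κ) fun s2 => Ex (iid pp.smallR pp.m) fun e2 =>
      Ex (iid pp.unifR pp.m) fun b => Ex (iid pp.unifR pp.m) fun aBin =>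
      Ex (iid pp.unifR pp.m) fun aBin' => Ex (iid pp.unifR pp.m) fun aG =>
      Ex (iid pp.smallR pp.m) fun r =>
        F (honestStmt v m2 m3 A (Aᵀ *ᵥ s2 + e2) (Aᵀ *ᵥ s1 + e1) b aBin aBin' aG r,
          ⟨r, v, m2, m3⟩) := by
  let V := Fin pp.m → pp.Rq
  let U := iid pp.unifR pp.m
  let P : PMF (V × V × V × V) :=
    U.bind fun a => U.bind fun b => U.bind fun c => U.map fun d => (a, b, c, d)
  let R : PMF ((Fin pp.κ → pp.Rq) × V × (Fin pp.κ → pp.Rq) × V) :=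
    (iid pp.smallR pp.κ).bind fun a => (iid pp.smallR pp.m).bind fun b =>
      (iid pp.smallR pp.κ).bind fun c => (iid pp.smallR pp.m).map fun d => (a, b, c, d)
  unfold genInstance
  simp only [Ex_bind, Ex_map]
  congr 1; funext A
  have h := Ex_comm P R fun u t => Ex (iid pp.smallR pp.m) fun r =>
    F (honestStmt v m2 m3 A (Aᵀ *ᵥ t.2.2.1 + t.2.2.2) (Aᵀ *ᵥ t.1 + t.2.1) u.1 u.2.1 u.2.2.1
      u.2.2.2 r, ⟨r, v, m2, m3⟩)
  simp only [P, R, U, Ex_bind, Ex_map] at h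
  exact h

theorem genInstance_bind_idealRun (v : ℕ) (hv : v < 2 ^ 64) (m2 m3 : pp.Rq) :
    ((genInstance pp v m2 m3).bind fun xw => (idealRun xw.1 xw.2).map fun t => (xw.1, t)) =
      (keyReal pp).bind (honestView v m2 m3) := by
  refine pmf_ext_Ex fun F => ?_
  rw [Ex_bind, Ex_genInstance]
  simp only [idealRun_eq_honestView v hv m2 m3 _ _ _ _ _ _ _ _ _ rfl]
  unfold keyReal keyTail
  simp only [Ex_bind, Ex_map]

theorem genInstance_bind_simulate (v : ℕ) (m2 m3 : pp.Rq) :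
    ((genInstance pp v m2 m3).bind fun xw => (simulate xw.1).map fun t => (xw.1, t)) =
      (keyReal pp).bind (simView v m2 m3) := by
  refine pmf_ext_Ex fun F => ?_
  rw [Ex_bind, Ex_genInstance]
  unfold keyReal keyTail simView
  simp only [Ex_bind, Ex_map, stmtOf_stack]

/-- The products of `r` with `a_bin`, `a'_bin` and `a_g` do not enter the statement; they remain
free to serve as one-time pads. -/
theorem stmtOf_cons₆ (v : ℕ) (m2 m3 : pp.Rq) (M : Matrix (Fin (pp.κ + 6)) (Fin pp.m) pp.Rq)
    (a₀ a₁ a₂ a₃ a₄ a₅ : pp.Rq) (w : Fin pp.κ → pp.Rq) :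
    stmtOf v m2 m3 (M, cons₆ a₀ a₁ a₂ a₃ a₄ a₅ w) =
      { stmtOf v m2 m3 (M, 0) with
        com0 := w
        com1 := a₁ + (v : pp.Rq)
        com2 := a₀ + m2
        com3 := a₂ + m3 } := rfl

/-- On uniform key samples the two views coincide. -/
theorem ideal_views (v : ℕ) (m2 m3 : pp.Rq) :
    (lweIdeal pp (pp.κ + 6) pp.m).bind (honestView v m2 m3) =
      (lweIdeal pp (pp.κ + 6) pp.m).bind (simView v m2 m3) := by
  refine pmf_ext_Ex fun F => ?_
  unfold lweIdeal
  simp only [Ex_bind, Ex_map]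
  congr 1; funext M
  rw [Ex_iid_add_six, Ex_iid_add_six]
  congr 1; funext a₀
  congr 1; funext a₁
  congr 1; funext a₂
  let x : (Fin pp.κ → pp.Rq) → Stmt pp := fun w =>
    { stmtOf v m2 m3 (M, 0) with
      com0 := w
      com1 := a₁ + (v : pp.Rq)
      com2 := a₀ + m2
      com3 := a₂ + m3 }
  let p : PMF ((Fin pp.κ → pp.Rq) × Coins pp) :=
    (iid pp.unifR pp.κ).bind fun w => (coins pp).map fun t => (w, t)
  -- The three hidden products pad `f`, `u₁` and `u₂`. The shift of `u₁` involves the first pad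
  -- itself, hence the dependence of the second shift on it.
  have h := Ex_unifR_shift₃ p (bits v)
    (fun u y => ((x y.1).aBin ⬝ᵥ y.2.2.2.2 - y.2.2.2.1 * u) * (1 - 2 * bits v))
    (fun y => y.2.1 - (invNtt (QT y.2.2.1) * bits v - invNtt y.2.2.1 * (v : pp.Rq)))
    (fun u₁ u₂ u₃ y => F (x y.1, completeTranscript (x y.1) u₁ u₂ u₃ y.2.1 y.2.2.1 y.2.2.2.1
      y.2.2.2.2))
  simp only [p, Ex_bind, Ex_map] at h
  have hx : ∀ a₃ a₄ a₅ w, stmtOf v m2 m3 (M, cons₆ a₀ a₁ a₂ a₃ a₄ a₅ w) = x w :=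
    fun a₃ a₄ a₅ w => stmtOf_cons₆ v m2 m3 M a₀ a₁ a₂ a₃ a₄ a₅ w
  have h3 : ∀ (a₃ a₄ a₅ : pp.Rq) (w : Fin pp.κ → pp.Rq), cons₆ a₀ a₁ a₂ a₃ a₄ a₅ w
      (Fin.succ (Fin.succ (Fin.succ 0))) = a₃ := fun _ _ _ _ => rfl
  have h4 : ∀ (a₃ a₄ a₅ : pp.Rq) (w : Fin pp.κ → pp.Rq), cons₆ a₀ a₁ a₂ a₃ a₄ a₅ w
      (Fin.succ (Fin.succ (Fin.succ (Fin.succ 0)))) = a₄ := fun _ _ _ _ => rfl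
  have h5 : ∀ (a₃ a₄ a₅ : pp.Rq) (w : Fin pp.κ → pp.Rq), cons₆ a₀ a₁ a₂ a₃ a₄ a₅ w
      (Fin.succ (Fin.succ (Fin.succ (Fin.succ (Fin.succ 0))))) = a₅ := fun _ _ _ _ => rfl
  unfold honestView simView simulate
  simp only [Ex_bind, Ex_map, hx, h3, h4, h5]
  refine h.trans (Eq.symm ?_)
  -- The simulator draws its own masks and ignores the three hidden products, which average out.
  rw [Ex_const, Ex_const, Ex_const, Ex_comm]
  congr 1; funext u₁
  rw [Ex_comm]
  congr 1; funext u₂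
  rw [Ex_comm]

end sim
end
end PoA

namespace PoA
noncomputable section

open Params

/-! ### The simulator is efficient -/

section simcost

variable {pp : Params} {S : OracleSig} {Ω : Type*} {O : Ω → Answers pp S}

variable (pp) in
/-- Cost of completing a transcript. -/
def transcriptC : ℕ :=
  40 * linC pp + 20 * mulC pp + 20 * dotC pp pp.m + pp.κ * (dotC pp pp.m + mulC pp + linC pp)

/-- The inputs of `completeTranscript`. -/
abbrev TranscriptInput (pp : Params) : Type := Stmt pp × (pp.Rq × pp.Rq × pp.Rq) × Coins pp

theorem Det.completeTranscript : Det pp O (transcriptC pp) fun t : TranscriptInput pp =>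
    PoA.completeTranscript t.1 t.2.1.1 t.2.1.2.1 t.2.1.2.2 t.2.2.1 t.2.2.2.1 t.2.2.2.2.1
      t.2.2.2.2.2 := by
  have hx : Det pp O 0 fun t : TranscriptInput pp => t.1 := Det.id.fst'
  have hf : Det pp O 0 fun t : TranscriptInput pp => t.2.1.1 := Det.id.snd'.fst'.fst'
  have hu1 : Det pp O 0 fun t : TranscriptInput pp => t.2.1.2.1 := Det.id.snd'.fst'.snd'.fst'
  have hu2 : Det pp O 0 fun t : TranscriptInput pp => t.2.1.2.2 := Det.id.snd'.fst'.snd'.snd'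
  have hh : Det pp O 0 fun t : TranscriptInput pp => t.2.2.1 := Det.id.snd'.snd'.fst'
  have hφ : Det pp O 0 fun t : TranscriptInput pp => t.2.2.2.1 := Det.id.snd'.snd'.snd'.fst'
  have hc : Det pp O 0 fun t : TranscriptInput pp => t.2.2.2.2.1 := Det.id.snd'.snd'.snd'.snd'.fst'
  have hz : Det pp O 0 fun t : TranscriptInput pp => t.2.2.2.2.2 := Det.id.snd'.snd'.snd'.snd'.snd'
  have hF := hφ.invNtt
  have hP := hφ.QT.invNtt
  have hs := (hx.aBin.dot hz).sub (hc.mul hf)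
  have hu3 := ((hs.mul (hs.add hc)).add (hx.aBin'.dot hz)).sub (hc.mul hu1)
  have hw := (hx.stmtA.mulVec hz).subVec (hc.smulVec hx.com0)
  have hu4 := (((hx.aG.dot hz).add ((hx.aBin.dot hz).mul hP)).sub ((hx.pk1.dot hz).mul hF)).sub
    (hc.mul ((((hP.mul hf).sub (hF.mul hx.com1)).add hu2).sub hh))
  refine (Det.transcript hf hu1 hu2 hu3 hw hφ hh hu4 hc hz).mono ?_
  unfold transcriptC
  have h1 := Nat.zero_le (linC pp)
  have h2 := Nat.zero_le (mulC pp)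
  have h3 := Nat.zero_le (dotC pp pp.m)
  linarith

variable (pp) in
/-- Cost of sampling the part of a transcript that does not depend on the statement. -/
def coinsC : ℕ := 4 * pp.d + 1 + pp.m * pp.d

theorem Comp.coins {α : Type} [WordEnc pp.q α] [LawfulEnc α] :
    Comp pp O (coinsC pp) fun _ (_ : α) => PoA.coins pp := by
  have hg : Det pp O 0 fun a : (((α × pp.Rq) × Slots pp) × pp.Rq) × (Fin pp.m → pp.Rq) =>
      (a.1.1.1.2, a.1.1.2, a.1.2, a.2) :=
    Det.id.fst'.fst'.fst'.snd'.pair (Det.id.fst'.fst'.snd'.pair (Det.id.fst'.snd'.pair Det.id.snd'))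
  have h := Samp.unifG.thenBind (O := O) (α := α) <| Samp.unifSlots.thenBind <|
    Samp.chal.thenBind <| Samp.gaussVec.thenMap hg
  refine h.mono ?_
  unfold coinsC
  linarith

variable (pp) in
/-- Cost of the simulator. -/
def simulateC : ℕ := 3 * pp.d + coinsC pp + transcriptC pp

theorem Comp.simulate : Comp pp O (simulateC pp) fun _ => PoA.simulate (pp := pp) := by
  have hg := (Det.completeTranscript (O := O)).comp
    (f := fun a : (((Stmt pp × pp.Rq) × pp.Rq) × pp.Rq) × Coins pp =>
      ((a.1.1.1.1, (a.1.1.1.2, a.1.1.2, a.1.2), a.2) : TranscriptInput pp))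
    (Det.id.fst'.fst'.fst'.fst'.pair ((Det.id.fst'.fst'.fst'.snd'.pair
      (Det.id.fst'.fst'.snd'.pair Det.id.fst'.snd')).pair Det.id.snd'))
  have h := Samp.unifR.thenBind (O := O) (α := Stmt pp) <| Samp.unifR.thenBind <|
    Samp.unifR.thenBind <| Comp.bindMap Comp.coins hg
  refine h.mono ?_
  unfold simulateC
  linarith

variable (pp) in
/-- Cost of reading off the statement from a key sample. -/
def stmtOfC : ℕ := 6 * linC pp

theorem Det.stmtOf (v : ℕ) (m2 m3 : pp.Rq) :
    Det pp O (stmtOfC pp) (PoA.stmtOf (pp := pp) v m2 m3) := by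
  have hM : Det pp O 0 fun t : KeySample pp => t.1 := Det.id.fst'
  have hU : Det pp O 0 fun t : KeySample pp => t.2 := Det.id.snd'
  have hA : Det pp O 0 fun t : KeySample pp =>
      (Matrix.of fun i => t.1 i.succ.succ.succ.succ.succ.succ :
        Matrix (Fin pp.κ) (Fin pp.m) pp.Rq) :=
    Det.of_wire (α := KeySample pp) (β := Matrix (Fin pp.κ) (Fin pp.m) pp.Rq)
      (fun j => Sum.inl ((j.1.1.succ.succ.succ.succ.succ.succ, j.1.2), j.2)) fun _ _ => rfl
  have hc : Det pp O 0 fun t : KeySample pp =>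
      (fun i => t.2 i.succ.succ.succ.succ.succ.succ : Fin pp.κ → pp.Rq) :=
    Det.of_wire (α := KeySample pp) (β := Fin pp.κ → pp.Rq)
      (fun j => Sum.inr (j.1.succ.succ.succ.succ.succ.succ, j.2)) fun _ _ => rfl
  have h := (hA.pair <| (hM.row (Fin.succ 0)).pair <| (hM.row 0).pair <|
    (hM.row (Fin.succ (Fin.succ 0))).pair <| (hM.row (Fin.succ (Fin.succ (Fin.succ 0)))).pair <|
    (hM.row (Fin.succ (Fin.succ (Fin.succ (Fin.succ 0))))).pair <|
    (hM.row (Fin.succ (Fin.succ (Fin.succ (Fin.succ (Fin.succ 0)))))).pair <| hc.pair <|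
    ((hU.proj (Fin.succ 0)).add (Det.constR (v : pp.Rq))).pair <|
    ((hU.proj 0).add (Det.constR m2)).pair
    ((hU.proj (Fin.succ (Fin.succ 0))).add (Det.constR m3))).stmtOfTuple
  refine Det.mono h ?_
  unfold stmtOfC
  linarith

variable (pp) in
/-- Cost of the two views. -/
def viewC : ℕ := 2 * stmtOfC pp + simulateC pp + 40 * linC pp + 10 * mulC pp + 2 * dotC pp pp.m

theorem Comp.simView (v : ℕ) (m2 m3 : pp.Rq) :
    Comp pp O (viewC pp) fun _ => PoA.simView (pp := pp) v m2 m3 := by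
  have h0 : Comp pp O (simulateC pp) fun _ x => (PoA.simulate (pp := pp) x).map fun t => (x, t) :=
    Comp.simulate.keep
  have h := Comp.pre (f := PoA.stmtOf v m2 m3) h0 (Det.stmtOf v m2 m3)
  refine h.mono ?_
  unfold viewC
  omega

/-- The reduction must evaluate the honest view on a key sample, so this view has to be cheap as
well; the messages and the bits of `v` are hard-wired constants. -/
theorem Comp.honestView (v : ℕ) (m2 m3 : pp.Rq) :
    Comp pp O (viewC pp) fun _ => PoA.honestView (pp := pp) v m2 m3 := by
  have hx : Det pp O (0 + stmtOfC pp) fun a : KeySample pp × Coins pp =>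
      PoA.stmtOf v m2 m3 a.1 := (Det.stmtOf v m2 m3).comp Det.id.fst'
  have hU : Det pp O 0 fun a : KeySample pp × Coins pp => a.1.2 := Det.id.fst'.snd'
  have hh : Det pp O 0 fun a : KeySample pp × Coins pp => a.2.1 := Det.id.snd'.fst'
  have hφ : Det pp O 0 fun a : KeySample pp × Coins pp => a.2.2.1 := Det.id.snd'.snd'.fst'
  have hc : Det pp O 0 fun a : KeySample pp × Coins pp => a.2.2.2.1 := Det.id.snd'.snd'.snd'.fst'
  have hz : Det pp O 0 fun a : KeySample pp × Coins pp => a.2.2.2.2 := Det.id.snd'.snd'.snd'.snd'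
  have hf := (hU.proj (Fin.succ (Fin.succ (Fin.succ 0)))).add (Det.constR (bits v))
  have haz : Det pp O (dotC pp pp.m) fun a : KeySample pp × Coins pp =>
      (PoA.stmtOf v m2 m3 a.1).aBin ⬝ᵥ a.2.2.2.2 :=
    (((Det.id.fst'.fst').row (Fin.succ (Fin.succ (Fin.succ 0)))).dot hz).mono (by simp)
  have hu1 := (hU.proj (Fin.succ (Fin.succ (Fin.succ (Fin.succ 0))))).add
    ((haz.sub (hc.mul (hU.proj (Fin.succ (Fin.succ (Fin.succ 0)))))).mul
      (Det.constR (1 - 2 * bits v)))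
  have hu2 := (hU.proj (Fin.succ (Fin.succ (Fin.succ (Fin.succ (Fin.succ 0)))))).add
    (hh.sub ((hφ.QT.invNtt.mul (Det.constR (bits v))).sub
      (hφ.invNtt.mul (Det.constR (v : pp.Rq)))))
  have hT := (Det.completeTranscript (O := O)).comp
    (hx.pair ((hf.pair (hu1.pair hu2)).pair Det.id.snd'))
  have h := Comp.bindMap (α := KeySample pp) Comp.coins (hx.pair hT)
  refine Comp.mono h ?_
  unfold viewC simulateC
  have h1 := Nat.zero_le (linC pp)
  have h2 := Nat.zero_le (mulC pp)
  have h3 := Nat.zero_le (dotC pp pp.m)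
  linarith [Nat.zero_le pp.d]

end simcost

/-! ## Zero-knowledge -/

theorem genInstance_support {pp : Params} {v : ℕ} {m2 m3 : pp.Rq} {xw : Stmt pp × Wit pp}
    (h : xw ∈ (genInstance pp v m2 m3).support) (i : Fin pp.m) (k : Fin pp.d) :
    |lift (xw.2.r i) k| ≤ 1 := by
  unfold genInstance at h
  simp only [PMF.mem_support_bind_iff, PMF.mem_support_map_iff] at h
  obtain ⟨A, -, b, -, aBin, -, aBin', -, aG, -, s1, -, e1, -, s2, -, e2, -, r, hr, rfl⟩ := h
  exact smallR_support (iid_support _ _ _ hr i) k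

theorem hvzk_of_hard {pp : ℕ → Params} (h : Admissible pp) (hM : MLWEHard pp)
    (hD : DualMLWEHard pp) : HVZK pp := by
  choose Sim hSim hrun using fun η =>
    Comp.exists_algo (Comp.simulate (pp := pp η) (O := noAnswers (pp η)))
  have hC : PolyBounded fun η => viewC (pp η) := by
    simp only [viewC, stmtOfC, simulateC, coinsC, transcriptC, dotC, linC, mulC, Params.m]
    repeat' first
      | exact h.d_poly
      | exact h.κ_poly
      | exact h.lam_poly
      | exact PolyBounded.const _
      | apply PolyBounded.add
      | apply PolyBounded.mul
  refine ⟨Sim, hC.of_le fun η => (hSim η).trans (by unfold viewC; omega), fun v m2 m3 hv => ?_⟩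
  have hk := keyReal_indist h hM hD
  have h1 := Indist.of_close (pp := pp) (β := fun η => Stmt (pp η) × Transcript (pp η))
    (fun η => genInstance (pp η) (v η) (m2 η) (m3 η))
    (fun η xw => (condFlag (honestRun xw.1 xw.2)).map fun t => (xw.1, t))
    (fun η xw => (idealRun xw.1 xw.2).map fun t => (xw.1, t))
    (negligible_pow (by norm_num : (0 : ℝ) ≤ 1 / 2) (by norm_num)) (fun η => by positivity)
    (fun η xw hxw f hf => by
      rw [Ex_map, Ex_map]
      exact honestRun_close η (h.rejection η) xw.1 xw.2 (genInstance_support hxw) _ fun _ => hf _)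
  have h2 := hk.bind (β := fun η => Stmt (pp η) × Transcript (pp η))
    (fun η => Comp.honestView (v η) (m2 η) (m3 η)) hC
  have h3 := hk.bind (β := fun η => Stmt (pp η) × Transcript (pp η))
    (fun η => Comp.simView (v η) (m2 η) (m3 η)) hC
  simp only [fun η => genInstance_bind_idealRun (pp := pp η) (v η) (hv η) (m2 η) (m3 η)] at h1
  simp only [ideal_views] at h2
  simp only [← genInstance_bind_simulate] at h3
  simp only [hrun]
  -- Real run, ideal run on honest keys, common view on uniform keys, simulation on honest keys: a
  -- statistical step, then the key assumption used forwards for the honest view and backwards for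
  -- the simulated one.
  exact h1.trans (h2.trans h3.symm)

end

end PoA

theorem mainTheorem9 :
    ∃ C : ℝ, 0 < C ∧ ∀ pp : ℕ → PoA.Params, PoA.Admissible pp →
      PoA.Complete pp ∧
      PoA.KnowledgeSound pp (fun η =>
        C * (((pp η).l + 3) / ((pp η).q : ℝ) ^ ((pp η).d / (pp η).l)) + C * (pp η).ε) ∧
      (PoA.MLWEHard pp → PoA.DualMLWEHard pp → PoA.HVZK pp) := by
  refine ⟨2, by norm_num, fun pp h => ⟨PoA.complete_of_admissible h, ?_, PoA.hvzk_of_hard h⟩⟩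
  exact PoA.knowledgeSound_of_admissible h
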